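/- Let $\mathbb T^3=\mathbb R^3/2\pi\mathbb Z^3$, let $0<T<\infty$, and for $s\ge 0$ let $H^s=H^s(\mathbb T^3)$ be the space of real vector fields $f=\sum_{k\in\mathbb Z^3}\hat f_k e^{ik\cdot x}\in L^2(\mathbb T^3;\mathbb R^3)$ with $\|f\|_{H^s}^2=\sum_{k}(1+|k|^{2s})|\hat f_k|^2<\infty$. Let $u\in L^\infty(0,T;H^{1/2})\cap L^2(0,T;H^{3/2})$ (not necessarily divergence-free) and $w_0\in H^{1/2}$. A function $w:[0,T)\to L^2(\mathbb T^3;\mathbb R^3)$ is called a strong solution of $$w_t+(u\cdot\nabla)w+(\nabla u)^\top w-\Delta w=0,\qquad w(0)=w_0,$$ where $((u\cdot\nabla)w)_i=\sum_j u_j\partial_jw_i$ and $((\nabla u)^\top w)_i=\sum_j(\partial_iu_j)w_j$, if $w\in L^\infty(0,T;H^{1/2})\cap L^2(0,T;H^{3/2})$ and $$(w(t),\phi(t))_{L^2}+\int_0^t\big((u\cdot\nabla)w(s)+(\nabla u)^\top w(s),\phi(s)\big)_{L^2}\,ds=(w_0,\phi(0))_{L^2}+\int_0^t(w(s),\partial_t\phi(s))_{L^2}\,ds-\int_0^t(\nabla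 w(s),\nabla\phi(s))_{L^2}\,ds$$ for all $t\in[0,T)$ and all test functions $\phi\in C_c^\infty([0,T)\times\mathbb T^3;\mathbb R^3)$. Then there exists exactly one strong solution $w$: any strong solution $v$ satisfies $v(t)=w(t)$ in $L^2(\mathbb T^3;\mathbb R^3)$ for every $t\in[0,T)$. Moreover $w(t)\in H^{1/2}$ for every $t\in[0,T)$, and $w:[0,T)\to H^{1/2}$ is continuous. -/

import Mathlib

open MeasureTheory Set Filter Topology
open scoped ContDiff

noncomputable section

namespace Magnetization

instance factTwoPiPos : Fact (0 < 2 * Real.pi) := ⟨Real.two_pi_pos⟩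

/-- The torus `ℝ³ / 2πℤ³`, with Lebesgue measure (total mass `(2π)³`) as `volume`. -/
abbrev Torus : Type := Fin 3 → AddCircle (2 * Real.pi)

/-- Euclidean `ℝ³`. -/
abbrev E3 : Type := EuclideanSpace ℝ (Fin 3)

/-- `L²(𝕋³; ℝ³)`: square integrable vector fields modulo equality almost everywhere. -/
abbrev L2 : Type := Lp E3 2 (volume : Measure Torus)

/-- The quotient map `ℝ³ → 𝕋³`. -/
def proj (y : Fin 3 → ℝ) : Torus := fun i => (y i : AddCircle (2 * Real.pi))

/-! ### Fourier coefficients and Sobolev spaces -/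

/-- The character `x ↦ exp (i k·x)` on the torus. -/
def character (k : Fin 3 → ℤ) (x : Torus) : ℂ := ∏ j, fourier (k j) (x j)

/-- The `k`-th Fourier coefficient of the `i`-th component of a vector field,
`(2π)⁻³ ∫ fᵢ(x) exp (-i k·x) dx`, so that `fᵢ = ∑ₖ coeff f k i * exp (i k·x)`. -/
def coeff (f : L2) (k : Fin 3 → ℤ) (i : Fin 3) : ℂ :=
  (((2 * Real.pi) ^ 3 : ℝ) : ℂ)⁻¹ * ∫ x : Torus, ((f x i : ℝ) : ℂ) * character (-k) x

/-- The Euclidean length `|k|` of a frequency. -/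
def freqNorm (k : Fin 3 → ℤ) : ℝ := Real.sqrt (∑ j, (k j : ℝ) ^ 2)

/-- The Sobolev norm `‖f‖_{H^s} = (∑ₖ (1 + |k|^{2s}) |f̂ₖ|²)^{1/2}`, with value `⊤ = +∞` exactly when
`f` does not belong to `H^s` (for `s ≥ 0`). -/
def hNorm (s : ℝ) (f : L2) : ENNReal :=
  (∑' k : Fin 3 → ℤ,
    ENNReal.ofReal (1 + freqNorm k ^ (2 * s)) * ∑ i, ‖coeff f k i‖ₑ ^ 2) ^ (1 / 2 : ℝ)

/-- Membership in `H^s(𝕋³)`. -/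
def MemH (s : ℝ) (f : L2) : Prop := hNorm s f < ⊤

/-- Membership in the Bochner space `L^p(0,T;H^s)`, `s ≥ 0`. Since `H^s` embeds continuously in
`L²` and both are separable Hilbert spaces, strong measurability with values in `H^s` is the same
as strong measurability with values in `L²` together with almost all values lying in `H^s`. -/
def MemLpH (p : ENNReal) (T s : ℝ) (u : ℝ → L2) : Prop :=
  AEStronglyMeasurable u (volume.restrict (Ioo 0 T)) ∧
    (∀ᵐ t ∂(volume.restrict (Ioo 0 T)), MemH s (u t)) ∧
    eLpNorm (fun t => hNorm s (u t)) p (volume.restrict (Ioo 0 T)) < ⊤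

/-- `w : [0,T) → H^s` is well defined and continuous for the norm of `H^s`. -/
def ContinuousIntoH (T s : ℝ) (w : ℝ → L2) : Prop :=
  (∀ t ∈ Ico 0 T, MemH s (w t)) ∧
    ∀ t₀ ∈ Ico 0 T, Tendsto (fun t => hNorm s (w t - w t₀)) (𝓝[Ico 0 T] t₀) (𝓝 0)

/-! ### Derivatives -/

/-- The classical partial derivative `∂ⱼ f` of a function on the torus. -/
def pderiv (j : Fin 3) (f : Torus → ℝ) (x : Torus) : ℝ :=
  deriv (fun h : ℝ => f (x + Pi.single j (h : AddCircle (2 * Real.pi)))) 0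

/-- `g = ∂ⱼ f` in the weak sense on the torus, both in `L²`. -/
def IsWeakPartial (j : Fin 3) (f g : L2) : Prop :=
  ∀ ψ : Torus → ℝ, ContDiff ℝ ∞ (fun y => ψ (proj y)) →
    ∫ x, pderiv j ψ x • f x = -∫ x, ψ x • g x

open Classical in
/-- The weak partial derivative `∂ⱼ f`, which is a (unique) element of `L²` for `f ∈ H¹`; the value
is `0` if `f` has no weak partial derivative in `L²`. -/
def weakPartial (j : Fin 3) (f : L2) : L2 :=
  if h : ∃ g, IsWeakPartial j f g then h.choose else 0

/-! ### The linear system -/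

/-- `((u·∇)w + (∇u)ᵀ w, φ)_{L²}`, where `((u·∇)w)ᵢ = ∑ⱼ uⱼ ∂ⱼwᵢ` and
`((∇u)ᵀ w)ᵢ = ∑ⱼ (∂ᵢuⱼ) wⱼ`. -/
def transportPairing (u w : L2) (φ : Torus → E3) : ℝ :=
  ∫ x, ∑ i, (∑ j, (u x j * weakPartial j w x i + weakPartial i u x j * w x j)) * φ x i

/-- `(∇w, ∇φ)_{L²} = ∑ᵢⱼ ∫ ∂ⱼwᵢ ∂ⱼφᵢ`. -/
def gradPairing (w : L2) (φ : Torus → E3) : ℝ :=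
  ∫ x, ∑ i, ∑ j, weakPartial j w x i * pderiv j (fun y => φ y i) x

/-- `(w, φ)_{L²}`. -/
def pairing (w : L2) (φ : Torus → E3) : ℝ := ∫ x, ∑ i, w x i * φ x i

/-- Test functions `φ ∈ C_c^∞([0,T) × 𝕋³; ℝ³)`: smooth up to and including `t = 0` (as restrictions
of smooth functions on `ℝ × 𝕋³`), and vanishing for `t` close to `T`. -/
def IsTest (T : ℝ) (φ : ℝ → Torus → E3) : Prop :=
  ContDiff ℝ ∞ (fun p : ℝ × (Fin 3 → ℝ) => φ p.1 (proj p.2)) ∧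
    ∃ T' < T, ∀ t, T' ≤ t → ∀ x, φ t x = 0

/-- `w` is a strong solution on `[0,T)` of `w_t + (u·∇)w + (∇u)ᵀ w - Δw = 0` with initial
value `w₀`. -/
def IsStrongSolution (T : ℝ) (u : ℝ → L2) (w₀ : L2) (w : ℝ → L2) : Prop :=
  MemLpH ⊤ T (1 / 2) w ∧ MemLpH 2 T (3 / 2) w ∧
    ∀ φ : ℝ → Torus → E3, IsTest T φ → ∀ t ∈ Ico 0 T,
      pairing (w t) (φ t) + ∫ s in (0 : ℝ)..t, transportPairing (u s) (w s) (φ s) =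
        pairing w₀ (φ 0)
          + (∫ s in (0 : ℝ)..t, pairing (w s) (fun x => deriv (fun r => φ r x) s))
          - ∫ s in (0 : ℝ)..t, gradPairing (w s) (φ s)

end Magnetization

end

noncomputable section

namespace Magnetization

open scoped ENNReal NNReal ComplexConjugate

/-! ### Cauchy–Schwarz for extended nonnegative sums and integrals -/

/-! Everything is moved to Fourier coefficients, where the equation becomes a countable family of
linear ODEs `y' = -|k|² y - F_k`, with `F` the convolution (`transport`) that represents the
transport term. Here `sobN n` is the squared Sobolev norm of order `n/2`, so the relevant orders are
`sobN (-1)` for forcings, `sobN 1` for the state and `sobN 3` for the dissipation.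

Two facts make the problem subcritical for a fixed point. First, a product of an `H¹` and an `L²`
function lies in `H^{-1/2}` (`tsum_conv_le`), hence `‖(u·∇)w + (∇u)ᵀw‖_{H^{-1/2}} ≤ C ‖u‖_{H¹}
‖w‖_{H¹}` (`sobN_transport_le`); the divergence of `u` plays no role. Second, by interpolation `u`
lies in `L⁴(0,T;H¹)` (`isVelocity_of_memLpH`), so the rate `γ = (2C²‖u‖²_{H¹})²` is integrable in
time.

The energy inequality (`IsModeSol.energy`) is used with the weight `exp (-∫ (γ + 2))`. It controls
the weighted integral of `γ‖w‖²_{H^{1/2}} + ‖w‖²_{H^{3/2}}` by the initial data and the weighted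
`L²(0,T;H^{-1/2})` norm of the forcing. By Young's inequality that integrand dominates four times
the squared `H^{-1/2}` norm of the transport term (`four_mul_transport_le`). Consequently the map
sending a forcing `F` to the transport term of the solution driven by `F` contracts by `1/2` on all
of `[0,T]`, without smallness of `u` or `T`. Its fixed point is a solution
(`exists_isModeSol_transport`), and the same inequality with zero data reads `4I ≤ I`, which is
uniqueness (`IsModeSol.eq_zero_of_transport`).

It remains to pass between the ODE family and strong solutions. Uniqueness applied to the complex
conjugate shows that the solution is real. A time independent summable majorant of the modes gives
continuity into `H^{1/2}` by dominated convergence. The weak formulation follows from the product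
rule mode by mode together with trilinear Parseval identities; conversely, testing with characters
times a time cutoff recovers the ODEs from the weak formulation (`IsStrongSolution.coeff_eq`). -/

theorem lintegral_mul_sq_le {α : Type*} [MeasurableSpace α] (μ : Measure α) {f g : α → ℝ≥0∞}
    (hf : AEMeasurable f μ) (hg : AEMeasurable g μ) :
    (∫⁻ x, f x * g x ∂μ) ^ 2 ≤ (∫⁻ x, f x ^ 2 ∂μ) * ∫⁻ x, g x ^ 2 ∂μ := by
  have h := ENNReal.lintegral_mul_le_Lp_mul_Lq μ Real.HolderConjugate.two_two hf hg
  simp only [Pi.mul_apply, ENNReal.rpow_two] at h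
  calc (∫⁻ x, f x * g x ∂μ) ^ 2
      ≤ ((∫⁻ x, f x ^ 2 ∂μ) ^ (1 / 2 : ℝ) * (∫⁻ x, g x ^ 2 ∂μ) ^ (1 / 2 : ℝ)) ^ 2 := by gcongr
    _ = _ := by
      rw [mul_pow, ← ENNReal.rpow_natCast, ← ENNReal.rpow_natCast, ← ENNReal.rpow_mul,
        ← ENNReal.rpow_mul]
      norm_num

theorem tsum_mul_sq_le {ι : Type*} (f g : ι → ℝ≥0∞) :
    (∑' i, f i * g i) ^ 2 ≤ (∑' i, f i ^ 2) * ∑' i, g i ^ 2 := by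
  let _ : MeasurableSpace ι := ⊤
  have h := lintegral_mul_sq_le (Measure.count : Measure ι) (f := f) (g := g)
    (measurable_from_top.aemeasurable) (measurable_from_top.aemeasurable)
  simpa only [lintegral_count' measurable_from_top] using h

theorem sum_mul_sq_le {ι : Type*} (s : Finset ι) (f g : ι → ℝ≥0∞) :
    (∑ i ∈ s, f i * g i) ^ 2 ≤ (∑ i ∈ s, f i ^ 2) * ∑ i ∈ s, g i ^ 2 := by
  have h := tsum_mul_sq_le (fun i : s => f i) (fun i : s => g i)
  simpa only [Finset.tsum_subtype s (fun i => f i * g i), Finset.tsum_subtype s (fun i => f i ^ 2),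
    Finset.tsum_subtype s (fun i => g i ^ 2)] using h

theorem add_sq_le (a b : ℝ≥0∞) : (a + b) ^ 2 ≤ 2 * (a ^ 2 + b ^ 2) := by
  have h := sum_mul_sq_le Finset.univ (![1, 1] : Fin 2 → ℝ≥0∞) ![a, b]
  simp only [Fin.sum_univ_two, Matrix.cons_val_zero, Matrix.cons_val_one, one_mul, one_pow] at h
  convert h using 2
  norm_num

/-! ### The weight `⟨k⟩ = (1 + |k|²)^{1/2}` -/

abbrev Freq : Type := Fin 3 → ℤ

/-- The Japanese bracket `(1 + |k|²)^{1/2}` of a frequency. -/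
def jap (k : Freq) : ℝ≥0 := NNReal.sqrt (1 + ∑ j, ((k j).natAbs : ℝ≥0) ^ 2)

theorem jap_sq (k : Freq) : jap k ^ 2 = 1 + ∑ j, ((k j).natAbs : ℝ≥0) ^ 2 := by
  simp [jap]

theorem one_le_jap (k : Freq) : 1 ≤ jap k := by
  rw [← one_le_sq_iff₀ zero_le, jap_sq]
  exact le_self_add

theorem jap_pos (k : Freq) : 0 < jap k := zero_lt_one.trans_le (one_le_jap k)

theorem jap_ne_zero (k : Freq) : jap k ≠ 0 := (jap_pos k).ne'

theorem natAbs_le_jap (k : Freq) (j : Fin 3) : ((k j).natAbs : ℝ≥0) ≤ jap k := by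
  rw [← sq_le_sq₀ zero_le zero_le, jap_sq]
  exact (Finset.single_le_sum (f := fun j => ((k j).natAbs : ℝ≥0) ^ 2)
    (fun _ _ => zero_le) (Finset.mem_univ j)).trans le_add_self

theorem jap_neg (k : Freq) : jap (-k) = jap k := by simp [jap]

theorem jap_sq_real (k : Freq) : (jap k : ℝ) ^ 2 = 1 + ∑ j, (k j : ℝ) ^ 2 := by
  have h := congrArg (fun x : ℝ≥0 => (x : ℝ)) (jap_sq k)
  push_cast at h
  rw [h]
  congr 1
  refine Finset.sum_congr rfl fun j _ => ?_
  rw [Nat.cast_natAbs, Int.cast_abs, sq_abs]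

/-! ### Lattice sums -/

/-- Telescoping: `c` is a discrete antiderivative whose increment pays for the two new terms `±(n +
1)` of the symmetric interval. -/
theorem sum_Icc_neg_le {h c : ℕ → ℝ} (h0 : h 0 ≤ c 0) (hs : ∀ n, 2 * h (n + 1) ≤ c (n + 1) - c n)
    (N : ℕ) : ∑ m ∈ Finset.Icc (-(N : ℤ)) N, h m.natAbs ≤ c N := by
  induction N with
  | zero => simpa using h0
  | succ n ih =>
    have e : Finset.Icc (-((n + 1 : ℕ) : ℤ)) ((n + 1 : ℕ) : ℤ) =
        insert ((n + 1 : ℕ) : ℤ) (insert (-((n + 1 : ℕ) : ℤ)) (Finset.Icc (-(n : ℤ)) n)) := by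
      ext m
      simp only [Finset.mem_Icc, Finset.mem_insert]
      omega
    rw [e, Finset.sum_insert (by simp; omega), Finset.sum_insert (by simp)]
    have := hs n
    rw [Int.natAbs_neg, Int.natAbs_natCast]
    linarith

/-- Increments of the concave functions `6 s^{1/3}` and `6 s^{2/3}`. These exponents appear because
a lattice weight of degree `-2` or `-1` is split evenly over three coordinates. -/
theorem cbrt_step (n : ℕ) :
    2 * ((n : ℝ) + 2) ^ (-(2 / 3) : ℝ) ≤ 6 * ((n : ℝ) + 2) ^ (1 / 3 : ℝ) - 6 * ((n : ℝ) + 1) ^ (1 / 3 : ℝ) ∧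
    2 * ((n : ℝ) + 2) ^ (-(1 / 3) : ℝ) ≤ 6 * ((n : ℝ) + 2) ^ (2 / 3 : ℝ) - 6 * ((n : ℝ) + 1) ^ (2 / 3 : ℝ) := by
  set x := ((n : ℝ) + 1) ^ (1 / 3 : ℝ) with hx
  set y := ((n : ℝ) + 2) ^ (1 / 3 : ℝ) with hy
  have hn : (0 : ℝ) ≤ n := n.cast_nonneg
  have hx0 : 0 < x := by positivity
  have hy0 : 0 < y := by positivity
  have hx3 : x ^ 3 = n + 1 := by
    rw [hx, ← Real.rpow_natCast, ← Real.rpow_mul (by positivity)]; norm_num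
  have hy3 : y ^ 3 = n + 2 := by
    rw [hy, ← Real.rpow_natCast, ← Real.rpow_mul (by positivity)]; norm_num
  have hxy : x ≤ y := by rw [hx, hy]; gcongr; norm_num
  have hx2 : ((n : ℝ) + 1) ^ (2 / 3 : ℝ) = x ^ 2 := by
    rw [hx, ← Real.rpow_natCast, ← Real.rpow_mul (by positivity)]; norm_num
  have hy2 : ((n : ℝ) + 2) ^ (2 / 3 : ℝ) = y ^ 2 := by
    rw [hy, ← Real.rpow_natCast, ← Real.rpow_mul (by positivity)]; norm_num
  have hym2 : ((n : ℝ) + 2) ^ (-(2 / 3) : ℝ) = (y ^ 2)⁻¹ := by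
    rw [Real.rpow_neg (by positivity), hy2]
  have hym1 : ((n : ℝ) + 2) ^ (-(1 / 3) : ℝ) = y⁻¹ := by rw [Real.rpow_neg (by positivity)]
  -- With `x³ = n + 1` and `y³ = n + 2`, factor `y³ - x³ = 1` and bound the quadratic factor by
  -- `3y²`.
  have key : 1 ≤ (y - x) * (3 * y ^ 2) := by
    have : (y - x) * (y ^ 2 + x * y + x ^ 2) = 1 := by linear_combination hy3 - hx3
    nlinarith [mul_nonneg (sub_nonneg.2 hxy) hx0.le, mul_nonneg (sub_nonneg.2 hxy) hy0.le,
      mul_nonneg (mul_nonneg (sub_nonneg.2 hxy) (sub_nonneg.2 hxy)) (add_pos hx0 hy0).le,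
      mul_nonneg (mul_nonneg (sub_nonneg.2 hxy) (sub_nonneg.2 hxy)) hy0.le]
  have key2 : (y ^ 2)⁻¹ ≤ 3 * (y - x) := by
    rw [inv_le_iff_one_le_mul₀ (by positivity)]; linarith
  rw [hx2, hy2, hym2, hym1]
  refine ⟨by linarith, ?_⟩
  have : y⁻¹ = y * (y ^ 2)⁻¹ := by field_simp
  rw [this]
  nlinarith [mul_nonneg (sub_nonneg.2 hxy) hx0.le]

theorem sum_box_prod_le {h : ℕ → ℝ} (hh : ∀ n, 0 ≤ h n) {N : ℕ} {B : ℝ}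
    (hB : ∑ m ∈ Finset.Icc (-(N : ℤ)) N, h m.natAbs ≤ B) :
    ∑ m ∈ Fintype.piFinset (fun _ : Fin 3 => Finset.Icc (-(N : ℤ)) N), ∏ j, h (m j).natAbs
      ≤ B ^ 3 := by
  rw [← Finset.prod_univ_sum (fun _ : Fin 3 => Finset.Icc (-(N : ℤ)) N) (fun _ m => h m.natAbs)]
  simp only [Finset.prod_const, Finset.card_univ, Fintype.card_fin]
  gcongr
  exact Finset.sum_nonneg fun _ _ => hh _

/-- Sums of a weight over the frequencies with `⟨m⟩ ≤ R` are bounded through boxes. -/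
theorem tsum_jap_le {R : ℝ≥0} {q : Freq → ℝ≥0∞} {h : ℕ → ℝ} (hh : ∀ n, 0 ≤ h n) {B : ℝ}
    (hq : ∀ m, jap m ≤ R → q m ≤ ENNReal.ofReal (4 * ∏ j, h (m j).natAbs))
    (hB : ∑ m ∈ Finset.Icc (-(⌊R⌋₊ : ℤ)) ⌊R⌋₊, h m.natAbs ≤ B) :
    ∑' m : Freq, (if jap m ≤ R then q m else 0) ≤ ENNReal.ofReal (4 * B ^ 3) := by
  rw [tsum_eq_sum (s := Fintype.piFinset (fun _ : Fin 3 => Finset.Icc (-(⌊R⌋₊ : ℤ)) ⌊R⌋₊))]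
  · calc _ ≤ ∑ m ∈ Fintype.piFinset (fun _ : Fin 3 => Finset.Icc (-(⌊R⌋₊ : ℤ)) ⌊R⌋₊),
          ENNReal.ofReal (4 * ∏ j, h (m j).natAbs) := by
          refine Finset.sum_le_sum fun m _ => ?_
          split_ifs with hm
          · exact hq m hm
          · exact zero_le
      _ ≤ _ := by
        rw [← ENNReal.ofReal_sum_of_nonneg
          (fun m _ => mul_nonneg (by norm_num) (Finset.prod_nonneg fun _ _ => hh _)),
          ← Finset.mul_sum]
        gcongr
        exact sum_box_prod_le hh hB
  · intro m hm
    rw [if_neg]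
    intro hR
    refine hm (Fintype.mem_piFinset.2 fun j => ?_)
    have := Nat.le_floor ((natAbs_le_jap m j).trans hR)
    rw [Finset.mem_Icc]
    omega

theorem jap_rpow_le (m : Freq) (j : Fin 3) : 1 + ((m j).natAbs : ℝ) ≤ 2 * (jap m : ℝ) := by
  have h1 : (1 : ℝ) ≤ jap m := by exact_mod_cast one_le_jap m
  have h2 : ((m j).natAbs : ℝ) ≤ jap m := by exact_mod_cast natAbs_le_jap m j
  linarith

/-- Since `1 + |m_j| ≤ 2⟨m⟩`, one has `⟨m⟩⁻² ≤ 4 ∏ (1 + |m_j|)^{-2/3}`, and the sum over a box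
factors. The constant is `4 · 6³ · 2`, the last `2` coming from `⌊R⌋ + 1 ≤ 2R`. -/
theorem sum_jap_zpow_neg_two_le (R : ℝ≥0) (hR : 1 ≤ R) :
    ∑' m : Freq, (if jap m ≤ R then (((jap m ^ 2)⁻¹ : ℝ≥0) : ℝ≥0∞) else 0) ≤ ((1728 * R : ℝ≥0) : ℝ≥0∞) := by
  have hfl : ((⌊R⌋₊ : ℕ) : ℝ) + 1 ≤ 2 * R := by
    have h1 : ((⌊R⌋₊ : ℕ) : ℝ≥0) ≤ R := Nat.floor_le zero_le
    have h1' : ((⌊R⌋₊ : ℕ) : ℝ) ≤ R := by exact_mod_cast h1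
    have h2 : (1 : ℝ) ≤ R := by exact_mod_cast hR
    linarith
  refine (tsum_jap_le (h := fun n => ((n : ℝ) + 1) ^ (-(2 / 3) : ℝ)) (fun n => by positivity)
    (B := 6 * ((⌊R⌋₊ : ℝ) + 1) ^ (1 / 3 : ℝ)) ?_ ?_).trans ?_
  · intro m _
    rw [← ENNReal.ofReal_coe_nnreal]
    apply ENNReal.ofReal_le_ofReal
    have hj : (0 : ℝ) < jap m := by exact_mod_cast jap_pos m
    have : ∀ j : Fin 3, (2 * (jap m : ℝ)) ^ (-(2 / 3) : ℝ) ≤ (((m j).natAbs : ℝ) + 1) ^ (-(2 / 3) : ℝ) :=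
      fun j => Real.rpow_le_rpow_of_nonpos (by positivity) (by linarith [jap_rpow_le m j]) (by norm_num)
    have h3 := Finset.prod_le_prod (s := Finset.univ) (fun (j : Fin 3) _ => by positivity)
      (fun j _ => this j)
    rw [Finset.prod_const, Finset.card_univ, Fintype.card_fin, ← Real.rpow_natCast,
      ← Real.rpow_mul (by positivity)] at h3
    norm_num at h3 ⊢
    rw [mul_pow, mul_inv] at h3
    linarith
  · apply sum_Icc_neg_le (h := fun n => ((n : ℝ) + 1) ^ (-(2 / 3) : ℝ))
      (c := fun n => 6 * ((n : ℝ) + 1) ^ (1 / 3 : ℝ))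
    · norm_num
    · intro n
      have := (cbrt_step n).1
      push_cast
      rw [add_assoc]
      norm_num at this ⊢
      exact this
  · rw [← ENNReal.ofReal_coe_nnreal]
    apply ENNReal.ofReal_le_ofReal
    rw [mul_pow, ← Real.rpow_natCast (_ ^ _), ← Real.rpow_mul (by positivity)]
    norm_num
    linarith

/-- As for the exponent `-2`, with each coordinate carrying `-1/3`; the constant is `4 · 6³ · 2²`.
Half of the factor `4` is not needed here. -/
theorem sum_jap_zpow_neg_one_le (R : ℝ≥0) (hR : 1 ≤ R) :
    ∑' m : Freq, (if jap m ≤ R then (((jap m)⁻¹ : ℝ≥0) : ℝ≥0∞) else 0) ≤ ((3456 * R ^ 2 : ℝ≥0) : ℝ≥0∞) := by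
  have hfl : ((⌊R⌋₊ : ℕ) : ℝ) + 1 ≤ 2 * R := by
    have h1 : ((⌊R⌋₊ : ℕ) : ℝ≥0) ≤ R := Nat.floor_le zero_le
    have h1' : ((⌊R⌋₊ : ℕ) : ℝ) ≤ R := by exact_mod_cast h1
    have h2 : (1 : ℝ) ≤ R := by exact_mod_cast hR
    linarith
  refine (tsum_jap_le (h := fun n => ((n : ℝ) + 1) ^ (-(1 / 3) : ℝ)) (fun n => by positivity)
    (B := 6 * ((⌊R⌋₊ : ℝ) + 1) ^ (2 / 3 : ℝ)) ?_ ?_).trans ?_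
  · intro m _
    rw [← ENNReal.ofReal_coe_nnreal]
    apply ENNReal.ofReal_le_ofReal
    have hj : (0 : ℝ) < jap m := by exact_mod_cast jap_pos m
    have : ∀ j : Fin 3, (2 * (jap m : ℝ)) ^ (-(1 / 3) : ℝ) ≤ (((m j).natAbs : ℝ) + 1) ^ (-(1 / 3) : ℝ) :=
      fun j => Real.rpow_le_rpow_of_nonpos (by positivity) (by linarith [jap_rpow_le m j]) (by norm_num)
    have h3 := Finset.prod_le_prod (s := Finset.univ) (fun (j : Fin 3) _ => by positivity)
      (fun j _ => this j)
    rw [Finset.prod_const, Finset.card_univ, Fintype.card_fin, ← Real.rpow_natCast,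
      ← Real.rpow_mul (by positivity)] at h3
    norm_num at h3 ⊢
    rw [Real.rpow_neg (by positivity), Real.rpow_one, mul_inv] at h3
    have : 0 ≤ (jap m : ℝ)⁻¹ := by positivity
    linarith
  · apply sum_Icc_neg_le (h := fun n => ((n : ℝ) + 1) ^ (-(1 / 3) : ℝ))
      (c := fun n => 6 * ((n : ℝ) + 1) ^ (2 / 3 : ℝ))
    · norm_num
    · intro n
      have := (cbrt_step n).2
      push_cast
      rw [add_assoc]
      norm_num at this ⊢
      exact this
  · rw [← ENNReal.ofReal_coe_nnreal]
    apply ENNReal.ofReal_le_ofReal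
    rw [mul_pow, ← Real.rpow_natCast (_ ^ _), ← Real.rpow_mul (by positivity)]
    norm_num
    have : ((⌊R⌋₊ : ℝ) + 1) ^ 2 ≤ (2 * R) ^ 2 := by gcongr
    nlinarith

/-! ### The convolution estimate `H¹ × L² → H^{-1/2}` -/

/-- The constant of the convolution estimate. -/
def convConst : ℝ≥0 := 2 * (1728 + 3456)

theorem tsum_conv_shift (f : Freq → ℝ≥0∞) (k : Freq) : ∑' m, f (k - m) = ∑' m, f m :=
  (Equiv.subLeft k).tsum_eq f

theorem tsum_conv_shift' (f : Freq → ℝ≥0∞) (m : Freq) : ∑' k, f (k - m) = ∑' k, f k :=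
  (Equiv.subRight m).tsum_eq f

/-- Split the convolution at `⟨m⟩ ≤ ⟨k⟩`. In the low part Cauchy–Schwarz against `⟨m⟩⁻¹` costs `∑
⟨m⟩⁻² ≲ ⟨k⟩`, exactly cancelled by the outer weight. In the high part Cauchy–Schwarz puts all of `b`
in one factor, and after exchanging the sums `∑_{⟨k⟩ ≤ ⟨m⟩} ⟨k⟩⁻¹ ≲ ⟨m⟩²` restores the `H¹` weight
on `a`. No Sobolev embedding is used. -/
theorem tsum_conv_le (a b : Freq → ℝ≥0∞) :
    ∑' k, ((jap k)⁻¹ : ℝ≥0) * (∑' m, a m * b (k - m)) ^ 2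
      ≤ convConst * ((∑' m, ((jap m ^ 2 : ℝ≥0) : ℝ≥0∞) * a m ^ 2) * ∑' m, b m ^ 2) := by
  set A := ∑' m, ((jap m ^ 2 : ℝ≥0) : ℝ≥0∞) * a m ^ 2 with hA
  set B := ∑' m, b m ^ 2 with hB
  have hJ : ∀ m, ((jap m : ℝ≥0) : ℝ≥0∞) * (((jap m)⁻¹ : ℝ≥0) : ℝ≥0∞) = 1 := fun m => by
    rw [← ENNReal.coe_mul, mul_inv_cancel₀ (jap_ne_zero m), ENNReal.coe_one]
  let p : Freq → ℝ≥0∞ := fun k => ∑' m, (if jap m ≤ jap k then a m else 0) * b (k - m)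
  let q : Freq → ℝ≥0∞ := fun k => ∑' m, (if jap m ≤ jap k then 0 else a m) * b (k - m)
  have hpq : ∀ k, ∑' m, a m * b (k - m) = p k + q k := fun k => by
    rw [← ENNReal.tsum_add]
    refine tsum_congr fun m => ?_
    split_ifs <;> simp
  have hp : ∀ k, p k ^ 2 ≤ ((1728 * jap k : ℝ≥0) : ℝ≥0∞) *
      ∑' m, ((jap m ^ 2 : ℝ≥0) : ℝ≥0∞) * a m ^ 2 * b (k - m) ^ 2 := fun k => by
    calc p k ^ 2 = (∑' m, (if jap m ≤ jap k then (((jap m)⁻¹ : ℝ≥0) : ℝ≥0∞) else 0) *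
          (((jap m : ℝ≥0) : ℝ≥0∞) * a m * b (k - m))) ^ 2 := by
          congr 1
          refine tsum_congr fun m => ?_
          split_ifs
          · rw [← mul_assoc, ← mul_assoc, mul_comm (((jap m)⁻¹ : ℝ≥0) : ℝ≥0∞), hJ, one_mul]
          · simp
      _ ≤ _ := tsum_mul_sq_le _ _
      _ ≤ _ := by
        gcongr with m
        · refine le_trans (le_of_eq (tsum_congr fun m => ?_)) (sum_jap_zpow_neg_two_le _ (one_le_jap k))
          split_ifs
          · rw [← ENNReal.coe_pow, inv_pow]
          · simp
        · rw [mul_pow, mul_pow, ENNReal.coe_pow]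
  have hq : ∀ k, q k ^ 2 ≤ B * ∑' m, (if jap k ≤ jap m then a m ^ 2 else 0) := fun k => by
    refine (tsum_mul_sq_le _ _).trans ?_
    rw [mul_comm]
    gcongr with m
    · rw [hB, tsum_conv_shift (fun m => b m ^ 2)]
    · split_ifs with h1 h2 h2
      · simp
      · simp
      · exact le_rfl
      · exact absurd (le_of_not_ge h1) h2
  calc ∑' k, ((jap k)⁻¹ : ℝ≥0) * (∑' m, a m * b (k - m)) ^ 2
      ≤ ∑' k, ((((jap k)⁻¹ : ℝ≥0) : ℝ≥0∞) * (2 * (((1728 * jap k : ℝ≥0) : ℝ≥0∞) *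
          ∑' m, ((jap m ^ 2 : ℝ≥0) : ℝ≥0∞) * a m ^ 2 * b (k - m) ^ 2)) +
          (((jap k)⁻¹ : ℝ≥0) : ℝ≥0∞) * (2 * (B * ∑' m, (if jap k ≤ jap m then a m ^ 2 else 0)))) := by
        refine ENNReal.tsum_le_tsum fun k => ?_
        rw [hpq, ← mul_add, ← mul_add]
        gcongr
        exact (add_sq_le _ _).trans (by gcongr; exacts [hp k, hq k])
    _ = 2 * 1728 * ∑' k, ∑' m, ((jap m ^ 2 : ℝ≥0) : ℝ≥0∞) * a m ^ 2 * b (k - m) ^ 2 +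
        2 * B * ∑' k, ∑' m, (if jap k ≤ jap m then (((jap k)⁻¹ : ℝ≥0) : ℝ≥0∞) else 0) * a m ^ 2 := by
        rw [ENNReal.tsum_add, ← ENNReal.tsum_mul_left, ← ENNReal.tsum_mul_left]
        congr 1
        · refine tsum_congr fun k => ?_
          rw [ENNReal.coe_mul]
          calc _ = (((jap k : ℝ≥0) : ℝ≥0∞) * (((jap k)⁻¹ : ℝ≥0) : ℝ≥0∞)) * (2 * 1728 *
              ∑' m, ((jap m ^ 2 : ℝ≥0) : ℝ≥0∞) * a m ^ 2 * b (k - m) ^ 2) := by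
                push_cast; ring
            _ = _ := by rw [hJ, one_mul]
        · refine tsum_congr fun k => ?_
          rw [show ∀ x y z : ℝ≥0∞, x * (2 * (y * z)) = 2 * y * (x * z) by intros; ring]
          refine congrArg (2 * B * ·) ?_
          rw [← ENNReal.tsum_mul_left]
          refine tsum_congr fun m => ?_
          split_ifs <;> simp
    _ ≤ 2 * 1728 * (A * B) + 2 * B * (3456 * A) := by
        gcongr
        · rw [ENNReal.tsum_comm]
          simp only [ENNReal.tsum_mul_left]
          simp only [tsum_conv_shift' (fun m => b m ^ 2), ENNReal.tsum_mul_right]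
          exact le_rfl
        · rw [ENNReal.tsum_comm, hA, ← ENNReal.tsum_mul_left]
          refine ENNReal.tsum_le_tsum fun m => ?_
          rw [ENNReal.tsum_mul_right, ← mul_assoc]
          gcongr
          refine (sum_jap_zpow_neg_one_le _ (one_le_jap m)).trans (le_of_eq ?_)
          push_cast; rfl
    _ = _ := by
        rw [convConst]
        push_cast
        ring

/-! ### Absolutely continuous functions with a given derivative -/

/-- Transfers absolute continuity along maps that do not increase distances: real and imaginary
parts, conjugation, `exp (-·)` on the half line, and the comparison of a primitive with the
primitive of the norm. -/
theorem _root_.AbsolutelyContinuousOnInterval.of_dist_le {X Y : Type*} [PseudoMetricSpace X]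
    [PseudoMetricSpace Y] {f : ℝ → X} {g : ℝ → Y} {a b : ℝ}
    (hg : AbsolutelyContinuousOnInterval g a b)
    (h : ∀ x ∈ uIcc a b, ∀ y ∈ uIcc a b, dist (f x) (f y) ≤ dist (g x) (g y)) :
    AbsolutelyContinuousOnInterval f a b := by
  rw [absolutelyContinuousOnInterval_iff] at hg ⊢
  intro ε hε
  obtain ⟨δ, hδ, H⟩ := hg ε hε
  refine ⟨δ, hδ, fun E hE hsum => lt_of_le_of_lt ?_ (H E hE hsum)⟩
  exact Finset.sum_le_sum fun i hi => h _ (hE.1 i hi).1 _ (hE.1 i hi).2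

/-- `f` is absolutely continuous on `[0,T]`, with derivative `f'` almost everywhere. -/
structure HasACDeriv {F : Type*} [NormedAddCommGroup F] [NormedSpace ℝ F] (T : ℝ) (f f' : ℝ → F) :
    Prop where
  ac : AbsolutelyContinuousOnInterval f 0 T
  ae_deriv : ∀ᵐ x, x ∈ uIcc 0 T → HasDerivAt f (f' x) x

namespace HasACDeriv

variable {F : Type*} [NormedAddCommGroup F] [NormedSpace ℝ F] {T : ℝ} {f f' g g' : ℝ → F}

theorem of_integral [CompleteSpace F] (hf : IntervalIntegrable f' volume 0 T) (a : F) :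
    HasACDeriv T (fun t => a + ∫ s in (0 : ℝ)..t, f' s) f' := by
  refine ⟨(hf.norm.absolutelyContinuousOnInterval_intervalIntegral (c := 0) (by simp)).of_dist_le
    fun x hx y hy => ?_, ?_⟩
  · have h0 : (0 : ℝ) ∈ uIcc 0 T := by simp
    have hx' : IntervalIntegrable f' volume 0 x := hf.mono_set (uIcc_subset_uIcc h0 hx)
    have hy' : IntervalIntegrable f' volume 0 y := hf.mono_set (uIcc_subset_uIcc h0 hy)
    rw [dist_add_left, dist_eq_norm, dist_eq_norm,
      intervalIntegral.integral_interval_sub_left hx' hy',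
      intervalIntegral.integral_interval_sub_left hx'.norm hy'.norm]
    exact intervalIntegral.norm_integral_le_abs_integral_norm
  · filter_upwards [hf.ae_hasDerivAt_integral] with x hx hxT
    exact (hx hxT 0 (by simp)).const_add a

theorem of_hasDerivAt (h : ∀ x, HasDerivAt f (f' x) x) (hc : Continuous f') :
    HasACDeriv T f f' := by
  refine ⟨ContDiffOn.absolutelyContinuousOnInterval (ContDiff.contDiffOn ?_),
    Eventually.of_forall fun x _ => h x⟩
  rw [contDiff_one_iff_deriv]
  refine ⟨fun x => (h x).differentiableAt, ?_⟩
  rwa [show deriv f = f' from funext fun x => (h x).deriv]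

theorem congr_deriv (h : HasACDeriv T f f') (he : ∀ᵐ x, x ∈ uIcc 0 T → f' x = g' x) :
    HasACDeriv T f g' :=
  ⟨h.ac, by filter_upwards [h.ae_deriv, he] with x hx hx' hT using hx' hT ▸ hx hT⟩

theorem congr_fun (h : HasACDeriv T f f') (hT : 0 ≤ T) (he : EqOn g f (Icc 0 T)) :
    HasACDeriv T g f' := by
  refine ⟨h.ac.of_dist_le fun x hx y hy => ?_, ?_⟩
  · rw [uIcc_of_le hT] at hx hy
    rw [he hx, he hy]
  · have h0 : ∀ᵐ x : ℝ, x ≠ 0 := by simp [ae_iff, measure_singleton]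
    have h1 : ∀ᵐ x : ℝ, x ≠ T := by simp [ae_iff, measure_singleton]
    filter_upwards [h.ae_deriv, h0, h1] with x hx hx0 hxT hm
    refine (hx hm).congr_of_eventuallyEq ?_
    rw [uIcc_of_le hT] at hm
    filter_upwards [Ioo_mem_nhds (lt_of_le_of_ne hm.1 hx0.symm) (lt_of_le_of_ne hm.2 hxT)] with z hz
    exact he ⟨hz.1.le, hz.2.le⟩

theorem mono (h : HasACDeriv T f f') {t : ℝ} (ht : t ∈ uIcc 0 T) : HasACDeriv t f f' := by
  have hs : uIcc 0 t ⊆ uIcc 0 T := uIcc_subset_uIcc (by simp) ht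
  exact ⟨h.ac.mono hs, by filter_upwards [h.ae_deriv] with x hx hxt using hx (hs hxt)⟩

theorem continuousOn (h : HasACDeriv T f f') (hT : 0 ≤ T) : ContinuousOn f (Icc 0 T) := by
  simpa [uIcc_of_le hT] using h.ac.continuousOn

theorem add (hf : HasACDeriv T f f') (hg : HasACDeriv T g g') :
    HasACDeriv T (fun t => f t + g t) (fun t => f' t + g' t) :=
  ⟨hf.ac.add hg.ac, by
    filter_upwards [hf.ae_deriv, hg.ae_deriv] with x hx hx' hT using (hx hT).add (hx' hT)⟩

theorem sub (hf : HasACDeriv T f f') (hg : HasACDeriv T g g') :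
    HasACDeriv T (fun t => f t - g t) (fun t => f' t - g' t) :=
  ⟨hf.ac.sub hg.ac, by
    filter_upwards [hf.ae_deriv, hg.ae_deriv] with x hx hx' hT using (hx hT).sub (hx' hT)⟩

theorem mul {A : Type*} [NormedRing A] [NormMulClass A] [NormedAlgebra ℝ A] {f f' g g' : ℝ → A}
    (hf : HasACDeriv T f f') (hg : HasACDeriv T g g') :
    HasACDeriv T (fun t => f t * g t) (fun t => f' t * g t + f t * g' t) :=
  ⟨hf.ac.smul hg.ac, by
    filter_upwards [hf.ae_deriv, hg.ae_deriv] with x hx hx' hT using (hx hT).mul (hx' hT)⟩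

/-- The difference with the primitive is absolutely continuous and has zero derivative almost
everywhere, hence is constant. This form is needed because the forcing is only square integrable in
time. -/
theorem eq_add_integral [CompleteSpace F] (h : HasACDeriv T f f')
    (hi : IntervalIntegrable f' volume 0 T) {t : ℝ} (ht : t ∈ uIcc 0 T) :
    f t = f 0 + ∫ s in (0 : ℝ)..t, f' s := by
  have hd := h.sub (of_integral hi 0)
  obtain ⟨C, hC⟩ := hd.ac.const_of_ae_hasDerivAt_zero (by
    filter_upwards [hd.ae_deriv] with x hx hT using by simpa using hx hT)
  have h0 := hC 0 (by simp)
  have h1 := hC t ht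
  simp only [intervalIntegral.integral_same, zero_add, sub_zero] at h0 h1
  rw [← sub_eq_iff_eq_add, h1, h0]

theorem re {f f' : ℝ → ℂ} (h : HasACDeriv T f f') :
    HasACDeriv T (fun t => (f t).re) (fun t => (f' t).re) :=
  ⟨h.ac.of_dist_le fun x _ y _ => by
      rw [Real.dist_eq, dist_eq_norm, ← Complex.sub_re]; exact Complex.abs_re_le_norm _, by
    filter_upwards [h.ae_deriv] with x hx hT
    exact (Complex.reCLM.hasFDerivAt.comp_hasDerivAt x (hx hT))⟩

theorem im {f f' : ℝ → ℂ} (h : HasACDeriv T f f') :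
    HasACDeriv T (fun t => (f t).im) (fun t => (f' t).im) :=
  ⟨h.ac.of_dist_le fun x _ y _ => by
      rw [Real.dist_eq, dist_eq_norm, ← Complex.sub_im]; exact Complex.abs_im_le_norm _, by
    filter_upwards [h.ae_deriv] with x hx hT
    exact (Complex.imCLM.hasFDerivAt.comp_hasDerivAt x (hx hT))⟩

/-- On `[0, ∞)` the map `s ↦ exp (-s)` is 1-Lipschitz, which is why `G` is assumed nonnegative. -/
theorem exp_neg {G g : ℝ → ℝ} (h : HasACDeriv T G g) (h0 : ∀ t ∈ uIcc 0 T, 0 ≤ G t) :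
    HasACDeriv T (fun t => Real.exp (-G t)) (fun t => -(g t * Real.exp (-G t))) := by
  have key : ∀ a b : ℝ, 0 ≤ a → a ≤ b → |Real.exp (-a) - Real.exp (-b)| ≤ |a - b| := by
    intro a b ha hab
    have h1 : Real.exp (-b) ≤ Real.exp (-a) := Real.exp_le_exp.2 (by linarith)
    have h2 : Real.exp (-a) ≤ 1 := Real.exp_le_one_iff.2 (by linarith)
    have h3 : 1 - (b - a) ≤ Real.exp (-(b - a)) := by
      have := Real.add_one_le_exp (-(b - a)); linarith
    have h4 : Real.exp (-b) = Real.exp (-a) * Real.exp (-(b - a)) := by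
      rw [← Real.exp_add]; ring_nf
    rw [abs_of_nonneg (by linarith), abs_of_nonpos (by linarith), h4]
    have h5 := Real.exp_pos (-a)
    nlinarith
  refine ⟨h.ac.of_dist_le fun x hx y hy => ?_, ?_⟩
  · rw [Real.dist_eq, Real.dist_eq]
    rcases le_total (G x) (G y) with hxy | hxy
    · exact key _ _ (h0 x hx) hxy
    · rw [abs_sub_comm, abs_sub_comm (G x)]
      exact key _ _ (h0 y hy) hxy
  · filter_upwards [h.ae_deriv] with x hx hT
    convert! (hx hT).neg.exp using 1
    simp only [Pi.neg_apply]
    ring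

end HasACDeriv

/-! ### The energy inequality for a single Fourier mode -/

theorem intervalIntegrable_of_lintegral_sq {f : ℝ → ℂ} {T : ℝ} (hT : 0 ≤ T)
    (hf : AEStronglyMeasurable f (volume.restrict (Ioc 0 T)))
    (hf2 : ∫⁻ t in Ioc 0 T, ‖f t‖ₑ ^ 2 < ⊤) :
    IntervalIntegrable f volume 0 T ∧ IntervalIntegrable (fun t => ‖f t‖ ^ 2) volume 0 T := by
  have hm : MemLp f 2 (volume.restrict (Ioc 0 T)) := by
    refine ⟨hf, ?_⟩
    rw [eLpNorm_lt_top_iff_lintegral_rpow_enorm_lt_top (by norm_num) (by norm_num)]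
    simpa using hf2
  rw [intervalIntegrable_iff_integrableOn_Ioc_of_le hT,
    intervalIntegrable_iff_integrableOn_Ioc_of_le hT]
  exact ⟨hm.integrable (by norm_num), hm.integrable_norm_pow (p := 2) (by norm_num)⟩

/-- The derivative of `E|y|²` contains `-2(J² - 1)|y|² - (g + 2)|y|²`: the extra `2` in the weight
compensates the missing dissipation and leaves `-(g + 2J²)|y|²`. Completing the square absorbs the
cross term into `J²|y|² + J⁻²|f|²`. -/
theorem mode_energy_pointwise (y f : ℂ) {J g E : ℝ} (hJ : 0 < J) (hE : 0 ≤ E) :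
    -((g + 2) * E) * (y.re * y.re + y.im * y.im) +
      E * (((-((J ^ 2 - 1 : ℝ) : ℂ) * y - f).re * y.re + y.re * (-((J ^ 2 - 1 : ℝ) : ℂ) * y - f).re) +
        ((-((J ^ 2 - 1 : ℝ) : ℂ) * y - f).im * y.im + y.im * (-((J ^ 2 - 1 : ℝ) : ℂ) * y - f).im))
      ≤ E * ((J ^ 2)⁻¹ * ‖f‖ ^ 2) - E * ((g + J ^ 2) * ‖y‖ ^ 2) := by
  have e : ∀ z : ℂ, ‖z‖ ^ 2 = z.re ^ 2 + z.im ^ 2 := fun z => by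
    rw [← Complex.normSq_eq_norm_sq, Complex.normSq_apply]; ring
  rw [e, e, ← mul_sub]
  have hr : (-((J ^ 2 - 1 : ℝ) : ℂ) * y - f).re = -(J ^ 2 - 1) * y.re - f.re := by
    rw [← Complex.ofReal_neg, Complex.sub_re, Complex.re_ofReal_mul]
  have hi : (-((J ^ 2 - 1 : ℝ) : ℂ) * y - f).im = -(J ^ 2 - 1) * y.im - f.im := by
    rw [← Complex.ofReal_neg, Complex.sub_im, Complex.im_ofReal_mul]
  rw [hr, hi]
  have h1 : ∀ a b : ℝ, 0 ≤ J ^ 2 * a ^ 2 + 2 * a * b + (J ^ 2)⁻¹ * b ^ 2 := fun a b => by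
    have : J ^ 2 * a ^ 2 + 2 * a * b + (J ^ 2)⁻¹ * b ^ 2 = (J * a + J⁻¹ * b) ^ 2 := by
      field_simp; ring
    rw [this]; positivity
  have h2 := mul_nonneg hE (add_nonneg (h1 y.re f.re) (h1 y.im f.im))
  linarith

/-- The energy inequality for `y' = -(J² - 1) y - f`, with the weight `exp (-∫ (g + 2))`. -/
theorem mode_energy {T J : ℝ} (hT : 0 ≤ T) (hJ : 0 < J) {y f : ℝ → ℂ} {g : ℝ → ℝ}
    (hy : HasACDeriv T y (fun t => -((J ^ 2 - 1 : ℝ) : ℂ) * y t - f t))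
    (hg : IntervalIntegrable g volume 0 T) (hg0 : ∀ t, 0 ≤ g t)
    (hf : AEStronglyMeasurable f (volume.restrict (Ioc 0 T)))
    (hf2 : ∫⁻ t in Ioc 0 T, ‖f t‖ₑ ^ 2 < ⊤) :
    ENNReal.ofReal (Real.exp (-∫ s in (0 : ℝ)..T, (g s + 2))) * ‖y T‖ₑ ^ 2 +
      ∫⁻ t in Ioc 0 T, ENNReal.ofReal (Real.exp (-∫ s in (0 : ℝ)..t, (g s + 2))) *
        ((ENNReal.ofReal (g t) + ENNReal.ofReal (J ^ 2)) * ‖y t‖ₑ ^ 2) ≤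
    ‖y 0‖ₑ ^ 2 + ∫⁻ t in Ioc 0 T, ENNReal.ofReal (Real.exp (-∫ s in (0 : ℝ)..t, (g s + 2))) *
        (ENNReal.ofReal (J ^ 2)⁻¹ * ‖f t‖ₑ ^ 2) := by
  obtain ⟨hfi, hfi2⟩ := intervalIntegrable_of_lintegral_sq hT hf hf2
  have hg2 : IntervalIntegrable (fun s => g s + 2) volume 0 T := hg.add (by simp)
  have hG := HasACDeriv.of_integral hg2 0
  simp only [zero_add] at hG
  have hG0 : ∀ t ∈ uIcc 0 T, 0 ≤ ∫ s in (0 : ℝ)..t, (g s + 2) := fun t ht => by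
    rw [uIcc_of_le hT] at ht
    exact intervalIntegral.integral_nonneg ht.1 fun s _ => by linarith [hg0 s]
  have hE := hG.exp_neg hG0
  set E : ℝ → ℝ := fun t => Real.exp (-∫ s in (0 : ℝ)..t, (g s + 2)) with hEdef
  have hE0 : ∀ t, 0 < E t := fun t => Real.exp_pos _
  have hEc : ContinuousOn E (uIcc 0 T) := hE.ac.continuousOn
  have hyc : ContinuousOn y (uIcc 0 T) := hy.ac.continuousOn
  -- The quantity differentiated is `E · (y.re² + y.im²)`, the weighted energy.
  have hΦ := hE.mul ((hy.re.mul hy.re).add (hy.im.mul hy.im))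
  have hQ : IntervalIntegrable (fun t => E t * ((J ^ 2)⁻¹ * ‖f t‖ ^ 2)) volume 0 T :=
    (hfi2.const_mul _).continuousOn_mul hEc
  have hP : IntervalIntegrable (fun t => E t * ((g t + J ^ 2) * ‖y t‖ ^ 2)) volume 0 T :=
    ((hg.add (by simp)).mul_continuousOn (hyc.norm.pow 2)).continuousOn_mul hEc
  have hyi : IntervalIntegrable (fun t => -((J ^ 2 - 1 : ℝ) : ℂ) * y t - f t) volume 0 T :=
    (hyc.intervalIntegrable.const_mul _).sub hfi
  have hyr : IntervalIntegrable (fun t => (-((J ^ 2 - 1 : ℝ) : ℂ) * y t - f t).re) volume 0 T :=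
    ⟨hyi.1.re, hyi.2.re⟩
  have hym : IntervalIntegrable (fun t => (-((J ^ 2 - 1 : ℝ) : ℂ) * y t - f t).im) volume 0 T :=
    ⟨hyi.1.im, hyi.2.im⟩
  have hrc : ContinuousOn (fun t => (y t).re) (uIcc 0 T) := hy.re.ac.continuousOn
  have hic : ContinuousOn (fun t => (y t).im) (uIcc 0 T) := hy.im.ac.continuousOn
  have hΦ' : IntervalIntegrable _ volume 0 T :=
    ((hg2.mul_continuousOn hEc).neg.mul_continuousOn ((hrc.mul hrc).add (hic.mul hic))).add
      ((((hyr.mul_continuousOn hrc).add (hyr.continuousOn_mul hrc)).add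
        ((hym.mul_continuousOn hic).add (hym.continuousOn_mul hic))).continuousOn_mul hEc)
  have hFTC := hΦ.eq_add_integral hΦ' right_mem_uIcc
  have e : ∀ z : ℂ, z.re * z.re + z.im * z.im = ‖z‖ ^ 2 := fun z => by
    rw [← Complex.normSq_eq_norm_sq, Complex.normSq_apply]
  have hle : E T * ‖y T‖ ^ 2 + ∫ t in (0 : ℝ)..T, E t * ((g t + J ^ 2) * ‖y t‖ ^ 2) ≤
      ‖y 0‖ ^ 2 + ∫ t in (0 : ℝ)..T, E t * ((J ^ 2)⁻¹ * ‖f t‖ ^ 2) := by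
    have h1 := intervalIntegral.integral_mono_on hT hΦ' (hQ.sub hP) fun t _ =>
      mode_energy_pointwise (y t) (f t) (g := g t) hJ (hE0 t).le
    rw [intervalIntegral.integral_sub hQ hP] at h1
    have h2 : E 0 = 1 := by simp [hEdef]
    rw [e, e, h2, one_mul] at hFTC
    have h3 := hFTC.le.trans (add_le_add le_rfl h1)
    linarith
  have conv : ∀ h : ℝ → ℝ, (∀ t, 0 ≤ h t) → IntervalIntegrable h volume 0 T →
      ENNReal.ofReal (∫ t in (0 : ℝ)..T, h t) = ∫⁻ t in Ioc 0 T, ENNReal.ofReal (h t) :=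
    fun h h0 hi => by
      rw [intervalIntegral.integral_of_le hT, ofReal_integral_eq_lintegral_ofReal
        ((intervalIntegrable_iff_integrableOn_Ioc_of_le hT).1 hi) (Eventually.of_forall h0)]
  have hn : ∀ z : ℂ, ENNReal.ofReal (‖z‖ ^ 2) = ‖z‖ₑ ^ 2 := fun z => by
    rw [ENNReal.ofReal_pow (norm_nonneg _), ofReal_norm]
  have hJ2 : 0 ≤ (J ^ 2)⁻¹ := by positivity
  have h3 := ENNReal.ofReal_le_ofReal hle
  rw [ENNReal.ofReal_add (by have := hE0 T; positivity)
      (intervalIntegral.integral_nonneg hT fun t _ => by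
        have := hE0 t; have := hg0 t; positivity),
    ENNReal.ofReal_add (by positivity) (intervalIntegral.integral_nonneg hT fun t _ => by
        have := hE0 t; positivity),
    conv _ (fun t => by have := hE0 t; have := hg0 t; positivity) hP,
    conv _ (fun t => by have := hE0 t; positivity) hQ, ENNReal.ofReal_mul (hE0 T).le, hn, hn] at h3
  simpa only [ENNReal.ofReal_mul (hE0 _).le, ENNReal.ofReal_mul hJ2, hn,
    ENNReal.ofReal_mul (add_nonneg (hg0 _) (sq_nonneg J)), ENNReal.ofReal_add (hg0 _) (sq_nonneg J)]
    using h3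

/-- The solution of `y' = -l y - f`, `y(0) = a`. -/
def modeSol (l : ℝ) (a : ℂ) (f : ℝ → ℂ) (t : ℝ) : ℂ :=
  Complex.exp (-(l * t : ℝ)) * (a + ∫ s in (0 : ℝ)..t, -(Complex.exp ((l * s : ℝ)) * f s))

theorem modeSol_zero (l : ℝ) (a : ℂ) (f : ℝ → ℂ) : modeSol l a f 0 = a := by simp [modeSol]

theorem hasACDeriv_modeSol {T : ℝ} (l : ℝ) (a : ℂ) {f : ℝ → ℂ}
    (hf : IntervalIntegrable f volume 0 T) :
    HasACDeriv T (modeSol l a f) (fun t => -(l : ℂ) * modeSol l a f t - f t) := by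
  have hc : Continuous fun s : ℝ => Complex.exp ((l * s : ℝ)) := by fun_prop
  have h1 := HasACDeriv.of_integral (hf.continuousOn_mul hc.continuousOn).neg a
  have h2 : HasACDeriv T (fun t : ℝ => Complex.exp (-(l * t : ℝ)))
      (fun t => -(l : ℂ) * Complex.exp (-(l * t : ℝ))) := by
    refine HasACDeriv.of_hasDerivAt (fun x => ?_) (by fun_prop)
    have : HasDerivAt (fun t : ℝ => ((-(l * t : ℝ) : ℝ) : ℂ)) ((-(l * 1) : ℝ) : ℂ) x :=
      (((hasDerivAt_id x).const_mul l).neg).ofReal_comp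
    have := this.cexp
    push_cast at this ⊢
    convert! this using 1
    ring
  have h3 := h2.mul h1
  refine (h3.congr_deriv (Eventually.of_forall fun t _ => ?_))
  simp only [modeSol, Pi.neg_apply]
  have : Complex.exp (-((l * t : ℝ) : ℂ)) * Complex.exp ((l * t : ℝ) : ℂ) = 1 := by
    rw [← Complex.exp_add]; simp
  linear_combination (-f t) * this

/-! ### Characters and Fourier coefficients on the torus -/

theorem character_zero (x : Torus) : character 0 x = 1 := by simp [character]

theorem character_add (k m : Freq) (x : Torus) :
    character (k + m) x = character k x * character m x := by
  simp only [character, Pi.add_apply, fourier_add, Finset.prod_mul_distrib]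

theorem character_neg (k : Freq) (x : Torus) : character (-k) x = conj (character k x) := by
  simp only [character, Pi.neg_apply, fourier_neg, map_prod]

theorem norm_character (k : Freq) (x : Torus) : ‖character k x‖ = 1 := by
  rw [character, norm_prod]
  exact Finset.prod_eq_one fun j _ => Circle.norm_coe _

theorem continuous_character (k : Freq) : Continuous (character k) := by
  unfold character
  fun_prop

/-- The character as a continuous map. -/
def characterMap (k : Freq) : C(Torus, ℂ) := ⟨character k, continuous_character k⟩

@[simp] theorem characterMap_apply (k : Freq) (x : Torus) : characterMap k x = character k x := rfl

/-- The volume `(2π)³` of the torus. -/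
def vol : ℝ := (2 * Real.pi) ^ 3

theorem vol_pos : 0 < vol := by unfold vol; positivity

theorem vol_ne_zero : (vol : ℂ) ≠ 0 := by exact_mod_cast vol_pos.ne'

/-- For `n ≠ 0`, translation by half a period of the character changes its sign but not its
integral. -/
theorem integral_fourier_volume (n : ℤ) :
    ∫ x : AddCircle (2 * Real.pi), fourier n x = if n = 0 then ((2 * Real.pi : ℝ) : ℂ) else 0 := by
  split_ifs with hn
  · subst hn
    simp [measureReal_def, AddCircle.measure_univ, Real.pi_pos.le]
  · have h := fourier_add_half_inv_index hn Real.two_pi_pos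
    have h1 : ∫ x : AddCircle (2 * Real.pi), fourier n (x + ((2 * Real.pi / 2 / n : ℝ) : AddCircle (2 * Real.pi)))
        = ∫ x : AddCircle (2 * Real.pi), fourier n x :=
      integral_add_right_eq_self _ _
    simp only [h, integral_neg] at h1
    exact self_eq_neg.1 h1.symm

theorem integral_character (k : Freq) :
    ∫ x : Torus, character k x = if k = 0 then (vol : ℂ) else 0 := by
  unfold character
  rw [integral_fintype_prod_volume_eq_prod
    (fun (j : Fin 3) (x : AddCircle (2 * Real.pi)) => (fourier (k j) x : ℂ))]
  simp only [integral_fourier_volume]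
  split_ifs with hk
  · subst hk
    simp [vol]
  · obtain ⟨j, hj⟩ := Function.ne_iff.1 hk
    exact Finset.prod_eq_zero (Finset.mem_univ j) (if_neg hj)

theorem character_single (z : Torus) (i : Fin 3) :
    character (Pi.single i 1) z = fourier 1 (z i) := by
  unfold character
  rw [Finset.prod_eq_single i]
  · simp
  · intro j _ hj
    simp [Pi.single_eq_of_ne hj]
  · simp

/-! ### Density of trigonometric polynomials and the Hilbert basis of characters. -/

/-- The algebra of trigonometric polynomials. -/
def characterSubalgebra : StarSubalgebra ℂ C(Torus, ℂ) where
  toSubalgebra := Algebra.adjoin ℂ (range characterMap)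
  star_mem' := by
    change Algebra.adjoin ℂ (range characterMap) ≤ star (Algebra.adjoin ℂ (range characterMap))
    refine Algebra.adjoin_le ?_
    rintro _ ⟨n, rfl⟩
    refine Algebra.subset_adjoin ⟨-n, ?_⟩
    ext1 x
    simp only [characterMap_apply, character_neg, starRingEnd_apply, ContinuousMap.star_apply]

theorem characterSubalgebra_coe :
    characterSubalgebra.toSubalgebra.toSubmodule = Submodule.span ℂ (range characterMap) := by
  apply Algebra.adjoin_eq_span_of_subset
  refine .trans (fun x ↦ Submonoid.closure_induction (fun _ ↦ id) ⟨0, ?_⟩ ?_) Submodule.subset_span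
  · ext z
    simp [character_zero]
  · rintro _ _ _ _ ⟨m, rfl⟩ ⟨n, rfl⟩
    exact ⟨m + n, by ext z; simp [character_add]⟩

theorem characterSubalgebra_separatesPoints : characterSubalgebra.SeparatesPoints := by
  intro x y hxy
  rw [Ne, funext_iff, not_forall] at hxy
  obtain ⟨i, hi⟩ := hxy
  refine ⟨_, ⟨characterMap (Pi.single i 1), Algebra.subset_adjoin ⟨Pi.single i 1, rfl⟩, rfl⟩, ?_⟩
  dsimp only
  rw [characterMap_apply, characterMap_apply, character_single, character_single, fourier_one,
    fourier_one]
  exact fun h => hi (AddCircle.injective_toCircle Real.two_pi_pos.ne' (Circle.ext h))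

/-- Stone–Weierstrass, for the span of the characters, which is already an algebra closed under
conjugation. -/
theorem span_characterMap_closure_eq_top :
    (Submodule.span ℂ (range characterMap)).topologicalClosure = ⊤ := by
  rw [← characterSubalgebra_coe]
  exact congr_arg (Subalgebra.toSubmodule <| StarSubalgebra.toSubalgebra ·)
    (ContinuousMap.starSubalgebra_topologicalClosure_eq_top_of_separatesPoints _
      characterSubalgebra_separatesPoints)

/-- The normalised characters in `L²(𝕋³; ℂ)`. -/
def characterLp (k : Freq) : Lp ℂ 2 (volume : Measure Torus) :=
  (((Real.sqrt vol)⁻¹ : ℝ) : ℂ) • ContinuousMap.toLp (E := ℂ) 2 volume ℂ (characterMap k)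

theorem characterLp_ae (k : Freq) :
    characterLp k =ᵐ[volume] fun x => (((Real.sqrt vol)⁻¹ : ℝ) : ℂ) * character k x := by
  filter_upwards [Lp.coeFn_smul (((Real.sqrt vol)⁻¹ : ℝ) : ℂ)
    (ContinuousMap.toLp (E := ℂ) 2 (volume : Measure Torus) ℂ (characterMap k)),
    ContinuousMap.coeFn_toLp (p := 2) (𝕜 := ℂ) (volume : Measure Torus) (characterMap k)] with x h1 h2
  rw [characterLp, h1, Pi.smul_apply, h2, smul_eq_mul, characterMap_apply]

theorem sqrt_vol_sq : (((Real.sqrt vol)⁻¹ : ℝ) : ℂ) * (((Real.sqrt vol)⁻¹ : ℝ) : ℂ) = (vol : ℂ)⁻¹ := by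
  rw [← Complex.ofReal_mul, ← mul_inv, Real.mul_self_sqrt vol_pos.le, Complex.ofReal_inv]

theorem orthonormal_characterLp : Orthonormal ℂ characterLp := by
  rw [orthonormal_iff_ite]
  intro m n
  rw [L2.inner_def]
  have : ∀ᵐ x : Torus, inner ℂ (characterLp m x) (characterLp n x) =
      (vol : ℂ)⁻¹ * character (n - m) x := by
    filter_upwards [characterLp_ae m, characterLp_ae n] with x h1 h2
    rw [h1, h2, RCLike.inner_apply, map_mul, Complex.conj_ofReal, ← character_neg, sub_eq_add_neg,
      character_add, ← sqrt_vol_sq]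
    ring
  rw [integral_congr_ae this, integral_const_mul, integral_character]
  simp only [sub_eq_zero]
  by_cases h : m = n
  · rw [if_pos h, if_pos h.symm, inv_mul_cancel₀ vol_ne_zero]
  · rw [if_neg h, if_neg (Ne.symm h), mul_zero]

/-- Uniform density passes to `L²` because continuous functions have dense range there; the
normalising factor does not change the span. -/
theorem span_characterLp_closure_eq_top :
    (Submodule.span ℂ (range characterLp)).topologicalClosure = ⊤ := by
  have hc : (((Real.sqrt vol)⁻¹ : ℝ) : ℂ) ≠ 0 := by
    have := Real.sqrt_pos.2 vol_pos
    exact_mod_cast (inv_pos.2 this).ne'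
  have h1 : Submodule.span ℂ (range characterLp) = Submodule.span ℂ
      (range fun k => ContinuousMap.toLp (E := ℂ) 2 (volume : Measure Torus) ℂ (characterMap k)) := by
    refine le_antisymm (Submodule.span_le.2 ?_) (Submodule.span_le.2 ?_)
    · rintro _ ⟨k, rfl⟩
      exact Submodule.smul_mem _ _ (Submodule.subset_span ⟨k, rfl⟩)
    · rintro _ ⟨k, rfl⟩
      have := Submodule.smul_mem (Submodule.span ℂ (range characterLp))
        (((Real.sqrt vol)⁻¹ : ℝ) : ℂ)⁻¹ (Submodule.subset_span ⟨k, rfl⟩)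
      rwa [characterLp, smul_smul, inv_mul_cancel₀ hc, one_smul] at this
  rw [h1]
  simpa only [Submodule.map_span, ContinuousLinearMap.coe_coe, ← range_comp, Function.comp_def] using
    (ContinuousMap.toLp_denseRange ℂ (volume : Measure Torus) ℂ
      (p := 2) (by norm_num)).topologicalClosure_map_submodule span_characterMap_closure_eq_top

/-- The Hilbert basis of normalised characters. -/
def characterBasis : HilbertBasis Freq ℂ (Lp ℂ 2 (volume : Measure Torus)) :=
  HilbertBasis.mk orthonormal_characterLp span_characterLp_closure_eq_top.ge

theorem characterBasis_apply (k : Freq) : characterBasis k = characterLp k := by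
  rw [characterBasis, HilbertBasis.coe_mk]

/-! ### Fourier coefficients, Parseval, Riesz–Fischer and convolution. -/

/-- The Fourier coefficient of a complex function on the torus. -/
def cf (ψ : Torus → ℂ) (k : Freq) : ℂ := (vol : ℂ)⁻¹ * ∫ x, ψ x * character (-k) x

theorem cf_congr_ae {ψ η : Torus → ℂ} (h : ψ =ᵐ[volume] η) (k : Freq) : cf ψ k = cf η k := by
  unfold cf
  congr 1
  refine integral_congr_ae ?_
  filter_upwards [h] with x hx
  rw [hx]

theorem coeff_eq_cf (f : L2) (k : Freq) (i : Fin 3) :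
    coeff f k i = cf (fun x => ((f x i : ℝ) : ℂ)) k := rfl

theorem cf_conj (ψ : Torus → ℂ) (k : Freq) : cf (fun x => conj (ψ x)) k = conj (cf ψ (-k)) := by
  unfold cf
  rw [map_mul, map_inv₀, Complex.conj_ofReal, ← integral_conj]
  congr 1
  refine integral_congr_ae (Eventually.of_forall fun x => ?_)
  simp only [map_mul, neg_neg, character_neg]

theorem integrable_mul_character {ψ : Torus → ℂ} (h : Integrable ψ) (k : Freq) :
    Integrable fun x => ψ x * character k x :=
  h.mul_bdd (c := 1) (continuous_character k).aestronglyMeasurable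
    (Eventually.of_forall fun x => (norm_character k x).le)

theorem cf_add {ψ η : Torus → ℂ} (hψ : Integrable ψ) (hη : Integrable η) (k : Freq) :
    cf (fun x => ψ x + η x) k = cf ψ k + cf η k := by
  unfold cf
  simp only [add_mul]
  rw [integral_add (integrable_mul_character hψ _) (integrable_mul_character hη _), mul_add]

theorem cf_sub {ψ η : Torus → ℂ} (hψ : Integrable ψ) (hη : Integrable η) (k : Freq) :
    cf (fun x => ψ x - η x) k = cf ψ k - cf η k := by
  unfold cf
  simp only [sub_mul]
  rw [integral_sub (integrable_mul_character hψ _) (integrable_mul_character hη _), mul_sub]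

theorem cf_const_mul (c : ℂ) (ψ : Torus → ℂ) (k : Freq) :
    cf (fun x => c * ψ x) k = c * cf ψ k := by
  unfold cf
  simp only [mul_assoc]
  rw [integral_const_mul]
  ring

theorem cf_mul_character (ψ : Torus → ℂ) (k m : Freq) :
    cf (fun x => ψ x * character (-k) x) (-m) = cf ψ (k - m) := by
  unfold cf
  congr 2
  ext x
  rw [mul_assoc, ← character_add]
  congr 3
  abel

theorem cf_character (m k : Freq) : cf (character m) k = if k = m then 1 else 0 := by
  unfold cf
  simp only [← character_add, integral_character, add_neg_eq_zero, eq_comm (a := m)]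
  split_ifs
  · exact inv_mul_cancel₀ vol_ne_zero
  · simp

theorem inner_characterLp (k : Freq) {ψ : Torus → ℂ} (hψ : MemLp ψ 2 volume) :
    inner ℂ (characterLp k) (hψ.toLp ψ) = (Real.sqrt vol : ℂ) * cf ψ k := by
  rw [L2.inner_def]
  have : ∀ᵐ x : Torus, inner ℂ (characterLp k x) (hψ.toLp ψ x) =
      (((Real.sqrt vol)⁻¹ : ℝ) : ℂ) * (ψ x * character (-k) x) := by
    filter_upwards [characterLp_ae k, hψ.coeFn_toLp] with x h1 h2
    rw [h1, h2, RCLike.inner_apply, map_mul, Complex.conj_ofReal, ← character_neg]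
    ring
  rw [integral_congr_ae this, integral_const_mul, cf, ← mul_assoc]
  congr 1
  have h : (vol : ℂ) = (Real.sqrt vol : ℂ) * (Real.sqrt vol : ℂ) := by
    rw [← Complex.ofReal_mul, Real.mul_self_sqrt vol_pos.le]
  have h0 : (Real.sqrt vol : ℂ) ≠ 0 := by exact_mod_cast (Real.sqrt_pos.2 vol_pos).ne'
  rw [h]
  push_cast
  field_simp

/-- **Parseval's identity**, in bilinear form. -/
theorem hasSum_cf_mul {ψ η : Torus → ℂ} (hψ : MemLp ψ 2 volume) (hη : MemLp η 2 volume) :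
    HasSum (fun k => cf ψ k * cf η (-k)) ((vol : ℂ)⁻¹ * ∫ x, ψ x * η x) := by
  have hη' : MemLp (fun x => conj (η x)) 2 volume := hη.star
  -- Conjugating `η` turns the sesquilinear Parseval identity into the bilinear one; the coefficient
  -- of the conjugate brings in the frequency `-k`.
  have h := characterBasis.hasSum_inner_mul_inner (hη'.toLp _) (hψ.toLp ψ)
  have h0 : (vol : ℂ) = (Real.sqrt vol : ℂ) * (Real.sqrt vol : ℂ) := by
    rw [← Complex.ofReal_mul, Real.mul_self_sqrt vol_pos.le]
  have e1 : ∀ k, inner ℂ (hη'.toLp _) (characterBasis k) * inner ℂ (characterBasis k) (hψ.toLp ψ) =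
      (vol : ℂ) * (cf ψ k * cf η (-k)) := fun k => by
    rw [← inner_conj_symm, characterBasis_apply, inner_characterLp, inner_characterLp, cf_conj,
      map_mul, Complex.conj_ofReal, Complex.conj_conj, h0]
    ring
  have e2 : inner ℂ (hη'.toLp _) (hψ.toLp ψ) = ∫ x, ψ x * η x := by
    rw [L2.inner_def]
    refine integral_congr_ae ?_
    filter_upwards [hη'.coeFn_toLp, hψ.coeFn_toLp] with x h1 h2
    rw [h1, h2, RCLike.inner_apply, Complex.conj_conj]
  simp only [e1, e2] at h
  have h2 := h.mul_left (vol : ℂ)⁻¹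
  simpa only [← mul_assoc, inv_mul_cancel₀ vol_ne_zero, one_mul] using h2

theorem hasSum_cf_norm_sq {ψ : Torus → ℂ} (hψ : MemLp ψ 2 volume) :
    HasSum (fun k => ‖cf ψ k‖ ^ 2) (vol⁻¹ * ∫ x, ‖ψ x‖ ^ 2) := by
  have hη : MemLp (fun x => conj (ψ x)) 2 volume := hψ.star
  have h := hasSum_cf_mul hψ hη
  simp only [cf_conj, neg_neg, Complex.mul_conj'] at h
  rw [show (vol : ℂ)⁻¹ * ∫ x, (‖ψ x‖ : ℂ) ^ 2 = ((vol⁻¹ * ∫ x, ‖ψ x‖ ^ 2 : ℝ) : ℂ) by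
    push_cast
    congr 1
    have := integral_ofReal (𝕜 := ℂ) (μ := (volume : Measure Torus)) (f := fun x => ‖ψ x‖ ^ 2)
    push_cast at this
    exact this] at h
  exact_mod_cast h

theorem tsum_cf_enorm_sq {ψ : Torus → ℂ} (hψ : MemLp ψ 2 volume) :
    ∑' k, ‖cf ψ k‖ₑ ^ 2 = ENNReal.ofReal vol⁻¹ * ∫⁻ x, ‖ψ x‖ₑ ^ 2 := by
  have h := hasSum_cf_norm_sq hψ
  have hn : ∀ z : ℂ, ENNReal.ofReal (‖z‖ ^ 2) = ‖z‖ₑ ^ 2 := fun z => by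
    rw [ENNReal.ofReal_pow (norm_nonneg _), ofReal_norm]
  simp only [← hn]
  rw [← ENNReal.ofReal_tsum_of_nonneg (fun k => by positivity) h.summable, h.tsum_eq,
    ENNReal.ofReal_mul (inv_nonneg.2 vol_pos.le),
    ofReal_integral_eq_lintegral_ofReal ((memLp_two_iff_integrable_sq_norm hψ.1).1 hψ)
      (Eventually.of_forall fun x => by positivity)]

/-- **Riesz–Fischer**. -/
theorem exists_memLp_cf_eq {c : Freq → ℂ} (hc : ∑' k, ‖c k‖ₑ ^ 2 < ⊤) :
    ∃ ψ : Torus → ℂ, MemLp ψ 2 volume ∧ ∀ k, cf ψ k = c k := by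
  have hm : Memℓp (fun k => (Real.sqrt vol : ℂ) * c k) 2 := by
    rw [memℓp_gen_iff (by norm_num)]
    have h1 : Summable fun k => ‖c k‖ ^ 2 := by
      have := ENNReal.summable_toReal hc.ne
      simpa using this
    simpa [mul_pow] using h1.mul_left _
  let v : lp (fun _ : Freq => ℂ) 2 := ⟨_, hm⟩
  refine ⟨characterBasis.repr.symm v, Lp.memLp _, fun k => ?_⟩
  have h := characterBasis.repr_apply_apply (characterBasis.repr.symm v) k
  rw [LinearIsometryEquiv.apply_symm_apply, characterBasis_apply,
    ← Lp.toLp_coeFn (characterBasis.repr.symm v) (Lp.memLp _), inner_characterLp] at h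
  have h0 : (Real.sqrt vol : ℂ) ≠ 0 := by exact_mod_cast (Real.sqrt_pos.2 vol_pos).ne'
  exact (mul_left_cancel₀ h0 h).symm

theorem memLp_mul_of_bound {η b : Torus → ℂ} (hη : MemLp η 2 volume)
    (hb : AEStronglyMeasurable b volume) {C : ℝ} (hC : ∀ x, ‖b x‖ ≤ C) :
    MemLp (fun x => η x * b x) 2 volume :=
  hη.of_le_mul (c := C) (hη.1.mul hb) (Eventually.of_forall fun x => by
    rw [norm_mul, mul_comm]
    gcongr
    exact hC x)

/-- The Fourier coefficients of a product are the convolution. -/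
theorem hasSum_cf_conv {ψ η : Torus → ℂ} (hψ : MemLp ψ 2 volume) (hη : MemLp η 2 volume)
    (k : Freq) : HasSum (fun m => cf ψ m * cf η (k - m)) (cf (fun x => ψ x * η x) k) := by
  -- The `k`-th coefficient of `ψη` is the pairing of `ψ` with `η` times a character, and that
  -- multiplication merely shifts the frequencies of `η`.
  have hη' : MemLp (fun x => η x * character (-k) x) 2 volume :=
    memLp_mul_of_bound hη (continuous_character _).aestronglyMeasurable
      fun x => (norm_character _ x).le
  have h := hasSum_cf_mul hψ hη'
  simp only [cf_mul_character] at h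
  simpa only [cf, mul_assoc] using h

/-! ### Weighted norms of coefficient families -/

/-- Families of Fourier coefficients of vector fields. -/
abbrev Coef : Type := Freq → Fin 3 → ℂ

/-- The squared Sobolev norm `∑ ⟨k⟩ⁿ |yₖ|²`. -/
def sobN (n : ℤ) (y : Coef) : ℝ≥0∞ := ∑' k, ((jap k ^ n : ℝ≥0) : ℝ≥0∞) * ∑ i, ‖y k i‖ₑ ^ 2

theorem sobN_mono {m n : ℤ} (h : m ≤ n) (y : Coef) : sobN m y ≤ sobN n y := by
  unfold sobN
  gcongr with k
  exact one_le_jap k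

theorem sobN_sub_le (n : ℤ) (y z : Coef) : sobN n (y - z) ≤ 2 * (sobN n y + sobN n z) := by
  unfold sobN
  rw [← ENNReal.tsum_add, ← ENNReal.tsum_mul_left]
  refine ENNReal.tsum_le_tsum fun k => ?_
  rw [← mul_add, ← Finset.sum_add_distrib, mul_left_comm,
    Finset.mul_sum _ _ (2 : ℝ≥0∞)]
  gcongr with i
  refine le_trans ?_ (add_sq_le _ _)
  gcongr
  exact enorm_sub_le

theorem enorm_sq_le_sobN {n : ℤ} (hn : 0 ≤ n) (y : Coef) (k : Freq) (i : Fin 3) :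
    ‖y k i‖ₑ ^ 2 ≤ sobN n y := by
  refine le_trans ?_ (sobN_mono hn y)
  refine le_trans ?_ (ENNReal.le_tsum k)
  rw [zpow_zero, ENNReal.coe_one, one_mul]
  exact Finset.single_le_sum (f := fun i => ‖y k i‖ₑ ^ 2) (fun _ _ => zero_le) (Finset.mem_univ i)

/-- Interpolation `‖y‖_{H¹}⁴ ≤ ‖y‖_{H^{1/2}}² ‖y‖_{H^{3/2}}²`. -/
theorem sobN_two_sq_le (y : Coef) : sobN 2 y ^ 2 ≤ sobN 1 y * sobN 3 y := by
  -- Write `⟨k⟩² = ⟨k⟩^{1/2} · ⟨k⟩^{3/2}`, distribute the square root of the coefficient sum over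
  -- both factors, and apply Cauchy–Schwarz.
  have e : ∀ k : Freq, ((jap k ^ (2 : ℤ) : ℝ≥0) : ℝ≥0∞) * ∑ i, ‖y k i‖ₑ ^ 2 =
      (((NNReal.sqrt (jap k) : ℝ≥0) : ℝ≥0∞) * (∑ i, ‖y k i‖ₑ ^ 2) ^ (1 / 2 : ℝ)) *
      (((jap k * NNReal.sqrt (jap k) : ℝ≥0) : ℝ≥0∞) * (∑ i, ‖y k i‖ₑ ^ 2) ^ (1 / 2 : ℝ)) := fun k => by
    rw [mul_mul_mul_comm, ← ENNReal.coe_mul, mul_left_comm (NNReal.sqrt _), NNReal.mul_self_sqrt,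
      ← ENNReal.rpow_add_of_nonneg _ _ (by norm_num) (by norm_num)]
    norm_num
    rw [sq]
  have hh : ∀ x : ℝ≥0∞, (x ^ (1 / 2 : ℝ)) ^ 2 = x := fun x => by
    rw [← ENNReal.rpow_natCast, ← ENNReal.rpow_mul]; norm_num
  unfold sobN
  rw [tsum_congr e]
  refine (tsum_mul_sq_le _ _).trans (le_of_eq ?_)
  congr 1
  · refine tsum_congr fun k => ?_
    rw [mul_pow, hh, ← ENNReal.coe_pow, NNReal.sq_sqrt, zpow_one]
  · refine tsum_congr fun k => ?_
    rw [mul_pow, hh, ← ENNReal.coe_pow, mul_pow, NNReal.sq_sqrt, zpow_ofNat]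
    ring_nf

theorem freqNorm_nonneg (k : Freq) : 0 ≤ freqNorm k := Real.sqrt_nonneg _

theorem jap_sq_eq_freqNorm (k : Freq) : (jap k : ℝ) ^ 2 = 1 + freqNorm k ^ 2 := by
  rw [jap_sq_real, freqNorm, Real.sq_sqrt (Finset.sum_nonneg fun _ _ => sq_nonneg _)]

theorem weight_half (k : Freq) :
    ((jap k ^ (1 : ℤ) : ℝ≥0) : ℝ≥0∞) ≤ ENNReal.ofReal (1 + freqNorm k ^ (2 * (1 / 2 : ℝ))) ∧
    ENNReal.ofReal (1 + freqNorm k ^ (2 * (1 / 2 : ℝ))) ≤ 2 * ((jap k ^ (1 : ℤ) : ℝ≥0) : ℝ≥0∞) := by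
  have h0 := freqNorm_nonneg k
  have h1 := jap_sq_eq_freqNorm k
  have h2 : (1 : ℝ) ≤ jap k := by exact_mod_cast one_le_jap k
  rw [show (2 * (1 / 2 : ℝ)) = 1 by norm_num, Real.rpow_one, zpow_one, ← ENNReal.ofReal_coe_nnreal,
    show (2 : ℝ≥0∞) = ENNReal.ofReal 2 by simp, ← ENNReal.ofReal_mul (by norm_num)]
  refine ⟨ENNReal.ofReal_le_ofReal ?_, ENNReal.ofReal_le_ofReal ?_⟩
  · nlinarith
  · have : freqNorm k ≤ jap k := by nlinarith
    linarith

/-- Together with `weight_half` this makes the inhomogeneous weight `1 + |k|^{2s}` of the statement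
interchangeable with powers of `⟨k⟩`, which multiply cleanly. -/
theorem weight_three_half (k : Freq) :
    ((jap k ^ (3 : ℤ) : ℝ≥0) : ℝ≥0∞) ≤ 4 * ENNReal.ofReal (1 + freqNorm k ^ (2 * (3 / 2 : ℝ))) ∧
    ENNReal.ofReal (1 + freqNorm k ^ (2 * (3 / 2 : ℝ))) ≤ 2 * ((jap k ^ (3 : ℤ) : ℝ≥0) : ℝ≥0∞) := by
  have h0 := freqNorm_nonneg k
  have h1 := jap_sq_eq_freqNorm k
  have h2 : (1 : ℝ) ≤ jap k := by exact_mod_cast one_le_jap k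
  rw [show (2 * (3 / 2 : ℝ)) = (3 : ℕ) by norm_num, Real.rpow_natCast, zpow_ofNat,
    ← ENNReal.ofReal_coe_nnreal,
    show (2 : ℝ≥0∞) = ENNReal.ofReal 2 by simp, ← ENNReal.ofReal_mul (by norm_num),
    show (4 : ℝ≥0∞) = ENNReal.ofReal 4 by simp, ← ENNReal.ofReal_mul (by norm_num)]
  push_cast
  have h3 : (jap k : ℝ) ≤ 1 + freqNorm k := by nlinarith
  have h4 : freqNorm k ≤ jap k := by nlinarith
  refine ⟨ENNReal.ofReal_le_ofReal ?_, ENNReal.ofReal_le_ofReal ?_⟩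
  · calc (jap k : ℝ) ^ 3 ≤ (1 + freqNorm k) ^ 3 := by gcongr
      -- With `r = |k|`, `4(1 + r³) - (1 + r)³ = 3(1 + r)(1 - r)²`.
      _ ≤ _ := by nlinarith [mul_nonneg (by linarith : 0 ≤ 1 + freqNorm k) (sq_nonneg (1 - freqNorm k))]
  · have h5 : freqNorm k ^ 3 ≤ (jap k : ℝ) ^ 3 := by gcongr
    have h6 : (1 : ℝ) ≤ (jap k : ℝ) ^ 3 := one_le_pow₀ h2
    linarith

theorem hNorm_sq (s : ℝ) (f : L2) : hNorm s f ^ 2 = ∑' k : Fin 3 → ℤ,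
    ENNReal.ofReal (1 + freqNorm k ^ (2 * s)) * ∑ i, ‖coeff f k i‖ₑ ^ 2 := by
  rw [hNorm, ← ENNReal.rpow_natCast, ← ENNReal.rpow_mul]
  norm_num

theorem sobN_one_le (f : L2) : sobN 1 (coeff f) ≤ hNorm (1 / 2) f ^ 2 := by
  rw [hNorm_sq, sobN]
  gcongr with k
  exact (weight_half k).1

theorem hNorm_half_sq_le (f : L2) : hNorm (1 / 2) f ^ 2 ≤ 2 * sobN 1 (coeff f) := by
  rw [hNorm_sq, sobN, ← ENNReal.tsum_mul_left]
  refine ENNReal.tsum_le_tsum fun k => ?_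
  rw [← mul_assoc]
  gcongr
  exact (weight_half k).2

theorem sobN_three_le (f : L2) : sobN 3 (coeff f) ≤ 4 * hNorm (3 / 2) f ^ 2 := by
  rw [hNorm_sq, sobN, ← ENNReal.tsum_mul_left]
  refine ENNReal.tsum_le_tsum fun k => ?_
  rw [← mul_assoc]
  gcongr
  exact (weight_three_half k).1

theorem hNorm_three_half_sq_le (f : L2) : hNorm (3 / 2) f ^ 2 ≤ 2 * sobN 3 (coeff f) := by
  rw [hNorm_sq, sobN, ← ENNReal.tsum_mul_left]
  refine ENNReal.tsum_le_tsum fun k => ?_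
  rw [← mul_assoc]
  gcongr
  exact (weight_three_half k).2

/-! ### Coefficients of square integrable vector fields -/

theorem memLp_comp (f : L2) (i : Fin 3) : MemLp (fun x => ((f x i : ℝ) : ℂ)) 2 volume :=
  ((Lp.memLp f).eval_piLp i).ofReal

theorem coeff_neg (f : L2) (k : Freq) (i : Fin 3) : coeff f (-k) i = conj (coeff f k i) := by
  have h := cf_conj (fun x => ((f x i : ℝ) : ℂ)) (-k)
  simp only [Complex.conj_ofReal, neg_neg] at h
  rw [coeff_eq_cf, coeff_eq_cf, h]

theorem coeff_sub (f g : L2) : coeff (f - g) = coeff f - coeff g := by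
  ext k i
  rw [Pi.sub_apply, Pi.sub_apply, coeff_eq_cf, coeff_eq_cf, coeff_eq_cf,
    ← cf_sub ((memLp_comp f i).integrable (by norm_num)) ((memLp_comp g i).integrable (by norm_num))]
  refine cf_congr_ae ?_ k
  filter_upwards [Lp.coeFn_sub f g] with x hx
  rw [hx, Pi.sub_apply]
  simp

theorem sobN_zero_coeff (f : L2) : sobN 0 (coeff f) = ENNReal.ofReal vol⁻¹ * ‖f‖ₑ ^ 2 := by
  have h1 : ‖f‖ₑ ^ 2 = ∫⁻ x, ‖f x‖ₑ ^ 2 := by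
    rw [Lp.enorm_def, eLpNorm_eq_lintegral_rpow_enorm_toReal (by norm_num) (by norm_num),
      ← ENNReal.rpow_natCast, ← ENNReal.rpow_mul]
    norm_num
  have h2 : ∀ x, ‖f x‖ₑ ^ 2 = ∑ i, ‖((f x i : ℝ) : ℂ)‖ₑ ^ 2 := fun x => by
    have := EuclideanSpace.norm_sq_eq (f x)
    rw [← ofReal_norm, ← ENNReal.ofReal_pow (norm_nonneg _), this,
      ENNReal.ofReal_sum_of_nonneg fun i _ => sq_nonneg _]
    refine Finset.sum_congr rfl fun i _ => ?_
    rw [ENNReal.ofReal_pow (norm_nonneg _), ofReal_norm]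
    congr 1
    simp [enorm, nnnorm]
  rw [h1]
  simp only [h2]
  rw [lintegral_finsetSum' _ fun i _ => (memLp_comp f i).1.enorm.pow_const 2, Finset.mul_sum]
  simp only [← tsum_cf_enorm_sq (memLp_comp f _)]
  unfold sobN
  simp only [zpow_zero, ENNReal.coe_one, one_mul]
  exact Summable.tsum_finsetSum (fun i _ => ENNReal.summable)

/-- One term of Parseval's sum is bounded by the whole. Its use is to derive measurability in time
of each coefficient from that of the field. -/
theorem continuous_coeff (k : Freq) (i : Fin 3) : Continuous fun f : L2 => coeff f k i := by
  refine LipschitzWith.continuous (K := NNReal.sqrt (Real.toNNReal vol⁻¹)) fun f g => ?_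
  have h : ‖coeff (f - g) k i‖ₑ ^ 2 ≤ _ := enorm_sq_le_sobN le_rfl (coeff (f - g)) k i
  rw [sobN_zero_coeff, coeff_sub] at h
  rw [edist_eq_enorm_sub, edist_eq_enorm_sub]
  refine (ENNReal.pow_le_pow_left_iff two_ne_zero).1 (h.trans (le_of_eq ?_))
  rw [mul_pow, ← ENNReal.coe_pow, NNReal.sq_sqrt]
  rfl

theorem L2_ext_coeff {f g : L2} (h : ∀ k i, coeff f k i = coeff g k i) : f = g := by
  have h1 := sobN_zero_coeff (f - g)
  have h2 : coeff f = coeff g := by ext k i; exact h k i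
  rw [coeff_sub, h2, sub_self] at h1
  have h3 : ‖f - g‖ₑ ^ 2 = 0 := by
    rcases mul_eq_zero.1 (h1.symm.trans (by simp [sobN])) with h | h
    · exact absurd h (by simpa using vol_pos)
    · exact h
  rw [← sub_eq_zero]
  simpa using h3

theorem exists_coeff_eq {y : Coef} (hy : sobN 0 y < ⊤) (hs : ∀ k i, y (-k) i = conj (y k i)) :
    ∃ f : L2, ∀ k i, coeff f k i = y k i := by
  have h1 : ∀ i, ∑' k, ‖y k i‖ₑ ^ 2 < ⊤ := fun i => by
    refine lt_of_le_of_lt ?_ hy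
    unfold sobN
    gcongr with k
    rw [zpow_zero, ENNReal.coe_one, one_mul]
    exact Finset.single_le_sum (f := fun i => ‖y k i‖ₑ ^ 2) (fun _ _ => zero_le)
      (Finset.mem_univ i)
  choose ψ hψ hψc using fun i => exists_memLp_cf_eq (h1 i)
  -- Riesz–Fischer gives complex functions; taking the real part does not change the coefficients
  -- because of the conjugation symmetry of `y`.
  have hm : MemLp (fun x => (WithLp.toLp 2 fun i => (ψ i x).re : E3)) 2 (volume : Measure Torus) :=
    MemLp.of_eval_piLp fun i => (hψ i).re
  refine ⟨hm.toLp _, fun k i => ?_⟩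
  have e : (fun x => ((hm.toLp _ x i : ℝ) : ℂ)) =ᵐ[volume]
      fun x => (2 : ℂ)⁻¹ * (ψ i x + conj (ψ i x)) := by
    filter_upwards [hm.coeFn_toLp] with x hx
    rw [hx, Complex.add_conj]
    push_cast
    ring
  have hψi : MemLp (fun x => conj (ψ i x)) 2 volume := (hψ i).star
  rw [coeff_eq_cf, cf_congr_ae e, cf_const_mul, cf_add ((hψ i).integrable (by norm_num))
    (hψi.integrable (by norm_num)), cf_conj, hψc, hψc, hs, Complex.conj_conj]
  ring

/-! ### Smooth functions on the torus -/

/-- Smoothness on the torus means smoothness of the lift, and continuity descends through this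
quotient map. -/
theorem isOpenQuotientMap_proj : IsOpenQuotientMap proj :=
  IsOpenQuotientMap.piMap fun _ : Fin 3 => (QuotientAddGroup.isOpenQuotientMap_mk :
    IsOpenQuotientMap ((↑) : ℝ → AddCircle (2 * Real.pi)))

theorem proj_surjective : Function.Surjective proj := isOpenQuotientMap_proj.surjective

theorem proj_add_single (y : Fin 3 → ℝ) (j : Fin 3) (h : ℝ) :
    proj y + Pi.single j (h : AddCircle (2 * Real.pi)) = proj (y + h • Pi.single j 1) := by
  ext i
  by_cases hi : i = j
  · subst hi; simp [proj]
  · simp [proj, Pi.single_eq_of_ne hi]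

theorem continuous_of_contDiff_proj {F : Type*} [NormedAddCommGroup F] [NormedSpace ℝ F]
    {ψ : Torus → F} (h : ContDiff ℝ ∞ fun y => ψ (proj y)) :
    Continuous ψ :=
  isOpenQuotientMap_proj.isQuotientMap.continuous_iff.2 h.continuous

theorem hasDerivAt_proj_line {ψ : Torus → ℝ} (h : ContDiff ℝ ∞ fun y => ψ (proj y)) (j : Fin 3)
    (y : Fin 3 → ℝ) (s : ℝ) :
    HasDerivAt (fun h : ℝ => ψ (proj y + Pi.single j (h : AddCircle (2 * Real.pi))))
      (fderiv ℝ (fun y => ψ (proj y)) (y + s • Pi.single j 1) (Pi.single j 1)) s := by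
  simp only [proj_add_single]
  have h1 : HasFDerivAt (fun y => ψ (proj y)) (fderiv ℝ (fun y => ψ (proj y))
      (y + s • Pi.single j 1)) (y + s • Pi.single j 1) :=
    (h.differentiable (by simp) _).hasFDerivAt
  have h2 : HasDerivAt (fun s : ℝ => y + s • (Pi.single j 1 : Fin 3 → ℝ)) (Pi.single j 1) s := by
    simpa using ((hasDerivAt_id s).smul_const (Pi.single j 1 : Fin 3 → ℝ)).const_add y
  exact h1.comp_hasDerivAt s h2

theorem pderiv_proj {ψ : Torus → ℝ} (h : ContDiff ℝ ∞ fun y => ψ (proj y)) (j : Fin 3)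
    (y : Fin 3 → ℝ) :
    pderiv j ψ (proj y) = fderiv ℝ (fun y => ψ (proj y)) y (Pi.single j 1) := by
  have := (hasDerivAt_proj_line h j y 0).deriv
  rwa [zero_smul, add_zero] at this

theorem hasDerivAt_line {ψ : Torus → ℝ} (h : ContDiff ℝ ∞ fun y => ψ (proj y)) (j : Fin 3)
    (x : Torus) (s : ℝ) :
    HasDerivAt (fun h : ℝ => ψ (x + Pi.single j (h : AddCircle (2 * Real.pi))))
      (pderiv j ψ (x + Pi.single j (s : AddCircle (2 * Real.pi)))) s := by
  obtain ⟨y, rfl⟩ := proj_surjective x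
  rw [proj_add_single, pderiv_proj h]
  exact hasDerivAt_proj_line h j y s

theorem continuous_pderiv {ψ : Torus → ℝ} (h : ContDiff ℝ ∞ fun y => ψ (proj y)) (j : Fin 3) :
    Continuous (pderiv j ψ) := by
  refine isOpenQuotientMap_proj.isQuotientMap.continuous_iff.2 ?_
  have : pderiv j ψ ∘ proj = fun y => fderiv ℝ (fun y => ψ (proj y)) y (Pi.single j 1) :=
    funext fun y => pderiv_proj h j y
  rw [this]
  exact (h.continuous_fderiv (by simp)).clm_apply continuous_const

theorem Torus.memLp_of_continuous {F : Type*} [NormedAddCommGroup F] {ψ : Torus → F}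
    (h : Continuous ψ) (p : ℝ≥0∞) : MemLp ψ p volume :=
  h.memLp_of_hasCompactSupport (HasCompactSupport.of_compactSpace ψ)

theorem character_single_real (k : Freq) (j : Fin 3) (h : ℝ) :
    character k (Pi.single j (h : AddCircle (2 * Real.pi))) = Complex.exp (Complex.I * k j * h) := by
  unfold character
  rw [Finset.prod_eq_single j]
  · rw [Pi.single_eq_same, fourier_coe_apply]
    congr 1
    have : (Real.pi : ℂ) ≠ 0 := by exact_mod_cast Real.pi_ne_zero
    push_cast
    field_simp
  · intro i _ hi
    rw [Pi.single_eq_of_ne hi, fourier_eval_zero]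
  · simp

/-- Fourier coefficients of the partial derivative of a smooth function. -/
theorem cf_pderiv {ψ : Torus → ℝ} (h : ContDiff ℝ ∞ fun y => ψ (proj y)) (j : Fin 3) (k : Freq) :
    cf (fun x => (pderiv j ψ x : ℂ)) k = Complex.I * k j * cf (fun x => (ψ x : ℂ)) k := by
  have hcp := continuous_pderiv h j
  have hcψ : Continuous ψ := continuous_of_contDiff_proj h
  obtain ⟨C, hC⟩ := isCompact_univ.exists_bound_of_continuousOn hcp.continuousOn
  have hch := continuous_character (-k)
  let F : ℝ → Torus → ℂ := fun s x =>
    (ψ (x + Pi.single j (s : AddCircle (2 * Real.pi))) : ℂ) * character (-k) x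
  let F' : ℝ → Torus → ℂ := fun s x =>
    (pderiv j ψ (x + Pi.single j (s : AddCircle (2 * Real.pi))) : ℂ) * character (-k) x
  have hF : ∀ s, Continuous (F s) := fun s => (Complex.continuous_ofReal.comp
    (hcψ.comp (continuous_add_const _))).mul hch
  have hF' : ∀ s, Continuous (F' s) := fun s => (Complex.continuous_ofReal.comp
    (hcp.comp (continuous_add_const _))).mul hch
  have hb : ∀ s x, ‖F' s x‖ ≤ C := fun s x => by
    simp only [F']
    rw [norm_mul, norm_character, mul_one, Complex.norm_real]
    exact hC _ (mem_univ _)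
  have hder : ∀ s x, HasDerivAt (fun s => F s x) (F' s x) s := fun s x =>
    (HasDerivAt.ofReal_comp (hasDerivAt_line h j x s)).mul_const _
  have hd := hasDerivAt_integral_of_dominated_loc_of_deriv_le (μ := (volume : Measure Torus))
    (F := F) (F' := F') (x₀ := 0) (bound := fun _ => C) (s := univ) univ_mem
    (Eventually.of_forall fun s => (hF s).aestronglyMeasurable)
    ((Torus.memLp_of_continuous (hF 0) 1).integrable le_rfl)
    (hF' 0).aestronglyMeasurable
    (Eventually.of_forall fun x s _ => hb s x)
    (integrable_const _)
    (Eventually.of_forall fun x s _ => hder s x)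
  -- Translation by `s` in the direction `j` multiplies the coefficient by `exp (i k_j s)`.
  -- Differentiating both expressions at `s = 0` gives the formula without integration by parts.
  have hs : ∀ s : ℝ, ∫ x, (ψ (x + Pi.single j (s : AddCircle (2 * Real.pi))) : ℂ) * character (-k) x =
      Complex.exp (Complex.I * k j * s) * ∫ x, (ψ x : ℂ) * character (-k) x := fun s => by
    rw [← integral_const_mul, ← integral_add_right_eq_self (μ := (volume : Measure Torus))
      (fun x => Complex.exp (Complex.I * k j * s) * ((ψ x : ℂ) * character (-k) x))
      (Pi.single j (s : AddCircle (2 * Real.pi)))]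
    congr 1
    ext x
    have e1 : character (-k) (x + Pi.single j (s : AddCircle (2 * Real.pi))) =
        character (-k) x * character (-k) (Pi.single j (s : AddCircle (2 * Real.pi))) := by
      simp only [character, Pi.add_apply, fourier_apply, smul_add, AddCircle.toCircle_add,
        Circle.coe_mul, Finset.prod_mul_distrib]
    have e2 : Complex.exp (Complex.I * k j * s) * Complex.exp (-(Complex.I * k j * s)) = 1 := by
      rw [← Complex.exp_add, add_neg_cancel, Complex.exp_zero]
    rw [e1, character_single_real]
    simp only [Pi.neg_apply, Int.cast_neg, mul_neg, neg_mul]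
    linear_combination (-(ψ (x + Pi.single j (s : AddCircle (2 * Real.pi))) : ℂ) * character (-k) x) * e2
  have hd' := hd.2
  simp only [F, F', hs] at hd'
  have hE : HasDerivAt (fun s : ℝ => Complex.exp (Complex.I * k j * s)) (Complex.I * k j) 0 := by
    have h0 : HasDerivAt (fun s : ℝ => Complex.I * k j * (s : ℂ)) (Complex.I * k j * 1) 0 :=
      (HasDerivAt.ofReal_comp (hasDerivAt_id (0 : ℝ))).const_mul _
    simpa using h0.cexp
  have := hd'.unique (hE.mul_const _)
  simp only [AddCircle.coe_zero, Pi.single_zero, add_zero] at this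
  unfold cf
  rw [this]
  ring

theorem contDiff_character (k : Freq) : ContDiff ℝ ∞ fun y => character k (proj y) := by
  unfold character proj
  simp only [fourier_coe_apply]
  refine contDiff_prod fun j _ => ?_
  refine ContDiff.cexp ?_
  refine ContDiff.div_const (ContDiff.mul contDiff_const ?_) _
  exact Complex.ofRealCLM.contDiff.comp (contDiff_apply ℝ ℝ j)

theorem contDiff_character_re (k : Freq) : ContDiff ℝ ∞ fun y => (character k (proj y)).re :=
  Complex.reCLM.contDiff.comp (contDiff_character k)

theorem contDiff_character_im (k : Freq) : ContDiff ℝ ∞ fun y => (character k (proj y)).im :=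
  Complex.imCLM.contDiff.comp (contDiff_character k)

theorem hasDerivAt_character_line (k : Freq) (j : Fin 3) (x : Torus) :
    HasDerivAt (fun h : ℝ => character k (x + Pi.single j (h : AddCircle (2 * Real.pi))))
      (Complex.I * k j * character k x) 0 := by
  have e1 : ∀ h : ℝ, character k (x + Pi.single j (h : AddCircle (2 * Real.pi))) =
      character k x * Complex.exp (Complex.I * k j * h) := fun h => by
    rw [← character_single_real]
    simp only [character, Pi.add_apply, fourier_apply, smul_add, AddCircle.toCircle_add,
        Circle.coe_mul, Finset.prod_mul_distrib]
  simp only [e1]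
  have h0 : HasDerivAt (fun s : ℝ => Complex.I * k j * (s : ℂ)) (Complex.I * k j * 1) 0 :=
    (HasDerivAt.ofReal_comp (hasDerivAt_id (0 : ℝ))).const_mul _
  have := h0.cexp.const_mul (character k x)
  simpa [mul_comm] using this

theorem pderiv_character_re (k : Freq) (j : Fin 3) (x : Torus) :
    pderiv j (fun x => (character k x).re) x = (Complex.I * k j * character k x).re :=
  (Complex.reCLM.hasFDerivAt.comp_hasDerivAt (0 : ℝ) (hasDerivAt_character_line k j x)).deriv

theorem pderiv_character_im (k : Freq) (j : Fin 3) (x : Torus) :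
    pderiv j (fun x => (character k x).im) x = (Complex.I * k j * character k x).im :=
  (Complex.imCLM.hasFDerivAt.comp_hasDerivAt (0 : ℝ) (hasDerivAt_character_line k j x)).deriv

/-! ### Weak derivatives -/

theorem integral_smul_apply {ψ : Torus → ℝ} (h : Continuous ψ) (f : L2) (i : Fin 3) :
    (∫ x, ψ x • f x) i = ∫ x, ψ x * f x i := by
  have hi : ∀ i, Integrable (fun x => (ψ x • f x) i) (volume : Measure Torus) := fun i =>
    (Torus.memLp_of_continuous h 2).integrable_mul ((Lp.memLp f).eval_piLp i)
  exact eval_integral_piLp hi i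

theorem integral_character_mul (f : L2) (k : Freq) (i : Fin 3) :
    ((∫ x, (character (-k) x).re * f x i : ℝ) : ℂ) +
      Complex.I * ((∫ x, (character (-k) x).im * f x i : ℝ) : ℂ) = vol * coeff f k i := by
  have hc := continuous_character (-k)
  have h1 : Integrable (fun x => (character (-k) x).re * f x i) (volume : Measure Torus) :=
    (Torus.memLp_of_continuous (Complex.continuous_re.comp hc) 2).integrable_mul
      ((Lp.memLp f).eval_piLp i)
  have h2 : Integrable (fun x => (character (-k) x).im * f x i) (volume : Measure Torus) :=
    (Torus.memLp_of_continuous (Complex.continuous_im.comp hc) 2).integrable_mul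
      ((Lp.memLp f).eval_piLp i)
  rw [coeff_eq_cf, cf, ← mul_assoc, mul_inv_cancel₀ vol_ne_zero, one_mul, ← integral_complex_ofReal,
    ← integral_complex_ofReal, ← integral_const_mul, ← integral_add h1.ofReal (h2.ofReal.const_mul _)]
  congr 1
  ext x
  conv_rhs => rw [← Complex.re_add_im (character (-k) x)]
  push_cast
  ring

/-- The test functions of the definition are real, so the real and imaginary parts of a character
are tested separately and recombined. -/
theorem IsWeakPartial.coeff_eq {j : Fin 3} {f g : L2} (h : IsWeakPartial j f g) (k : Freq)
    (i : Fin 3) : coeff g k i = Complex.I * k j * coeff f k i := by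
  have hc := continuous_character (-k)
  have hcr : Continuous fun x => (character (-k) x).re := Complex.continuous_re.comp hc
  have hcm : Continuous fun x => (character (-k) x).im := Complex.continuous_im.comp hc
  have hr := congrArg (fun v : E3 => v i) (h (fun x => (character (-k) x).re) (contDiff_character_re (-k)))
  have hm := congrArg (fun v : E3 => v i) (h (fun x => (character (-k) x).im) (contDiff_character_im (-k)))
  simp only [PiLp.neg_apply] at hr hm
  rw [integral_smul_apply (continuous_pderiv (contDiff_character_re (-k)) j),
    integral_smul_apply hcr] at hr
  rw [integral_smul_apply (continuous_pderiv (contDiff_character_im (-k)) j),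
    integral_smul_apply hcm] at hm
  simp only [pderiv_character_re, pderiv_character_im] at hr hm
  have e1 : ∀ x, (Complex.I * ((-k) j : ℤ) * character (-k) x).re = (k j : ℝ) * (character (-k) x).im := by
    intro x
    simp [Complex.mul_re]
  have e2 : ∀ x, (Complex.I * ((-k) j : ℤ) * character (-k) x).im = -((k j : ℝ) * (character (-k) x).re) := by
    intro x
    simp [Complex.mul_im]
  simp only [e1, e2] at hr hm
  simp only [mul_assoc, neg_mul, integral_neg, integral_const_mul] at hr hm
  have hf := integral_character_mul f k i
  have hg := integral_character_mul g k i
  have hr' := congrArg (fun x : ℝ => (x : ℂ)) hr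
  have hm' := congrArg (fun x : ℝ => (x : ℂ)) hm
  push_cast at hr' hm'
  refine mul_left_cancel₀ vol_ne_zero ?_
  rw [← hg, mul_left_comm, ← hf]
  linear_combination hr' + Complex.I * hm' + (-(k j : ℂ) * ((∫ x, (character (-k) x).im * f x i : ℝ) : ℂ)) * Complex.I_sq

/-- Both sides of the weak identity are Parseval sums, and they agree term by term: the factor `i
k_j` may sit on either function, with a sign coming from `-k`. -/
theorem isWeakPartial_of_coeff {j : Fin 3} {f g : L2}
    (h : ∀ k i, coeff g k i = Complex.I * k j * coeff f k i) : IsWeakPartial j f g := by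
  intro ψ hψ
  have hc := continuous_of_contDiff_proj hψ
  have hp := continuous_pderiv hψ j
  ext i
  rw [PiLp.neg_apply, integral_smul_apply hp, integral_smul_apply hc]
  have m1 : MemLp (fun x => (ψ x : ℂ)) 2 volume :=
    Torus.memLp_of_continuous (Complex.continuous_ofReal.comp hc) 2
  have m2 : MemLp (fun x => (pderiv j ψ x : ℂ)) 2 volume :=
    Torus.memLp_of_continuous (Complex.continuous_ofReal.comp hp) 2
  have h1 := hasSum_cf_mul m2 (memLp_comp f i)
  have h2 := (hasSum_cf_mul m1 (memLp_comp g i)).neg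
  have e : (fun k => cf (fun x => (pderiv j ψ x : ℂ)) k * cf (fun x => ((f x i : ℝ) : ℂ)) (-k)) =
      fun k => -(cf (fun x => (ψ x : ℂ)) k * cf (fun x => ((g x i : ℝ) : ℂ)) (-k)) := by
    ext k
    rw [cf_pderiv hψ, ← coeff_eq_cf, ← coeff_eq_cf, h]
    simp only [Pi.neg_apply, Int.cast_neg]
    ring
  rw [e] at h1
  have h3 := h1.unique h2
  rw [← mul_neg] at h3
  have h4 := mul_left_cancel₀ (inv_ne_zero vol_ne_zero) h3
  simp only [← Complex.ofReal_mul, integral_complex_ofReal] at h4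
  exact_mod_cast h4

theorem freq_sq_le_jap (k : Freq) (j : Fin 3) :
    ‖Complex.I * (k j : ℂ)‖ₑ ^ 2 ≤ ((jap k ^ (2 : ℤ) : ℝ≥0) : ℝ≥0∞) := by
  rw [zpow_ofNat, ENNReal.coe_pow]
  gcongr
  rw [enorm_mul, enorm_eq_nnnorm, enorm_eq_nnnorm, ← ENNReal.coe_mul, ENNReal.coe_le_coe]
  have := natAbs_le_jap k j
  simp only [Complex.nnnorm_I, one_mul]
  refine le_trans (le_of_eq ?_) this
  ext
  simp [Nat.cast_natAbs, Int.norm_eq_abs]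

theorem sobN_partial_le (y : Coef) (j : Fin 3) :
    sobN 0 (fun k i => Complex.I * (k j : ℂ) * y k i) ≤ sobN 2 y := by
  unfold sobN
  refine ENNReal.tsum_le_tsum fun k => ?_
  rw [zpow_zero, ENNReal.coe_one, one_mul, Finset.mul_sum]
  refine Finset.sum_le_sum fun i _ => ?_
  rw [enorm_mul, mul_pow]
  gcongr
  exact freq_sq_le_jap k j

/-- For a field in `H¹` the candidate `i k_j f̂_k` is realised by Riesz–Fischer, so the default
value `0` of `weakPartial` never occurs; the arbitrary choice is harmless since coefficients
determine it. -/
theorem coeff_weakPartial {f : L2} (hf : sobN 2 (coeff f) < ⊤) (j : Fin 3) (k : Freq) (i : Fin 3) :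
    coeff (weakPartial j f) k i = Complex.I * k j * coeff f k i := by
  have hex : ∃ g, IsWeakPartial j f g := by
    obtain ⟨g, hg⟩ := exists_coeff_eq (y := fun k i => Complex.I * (k j : ℂ) * coeff f k i)
      ((sobN_partial_le _ j).trans_lt hf) (fun k i => by
        rw [coeff_neg]
        simp [map_mul])
    exact ⟨g, isWeakPartial_of_coeff hg⟩
  rw [weakPartial, dif_pos hex]
  exact hex.choose_spec.coeff_eq k i

/-! ### The transport term on the Fourier side -/

/-- The `m`-th term of the convolution defining the transport term. -/
def transportTerm (u w : Coef) (k : Freq) (i : Fin 3) (m : Freq) : ℂ :=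
  ∑ j, (u m j * (Complex.I * ((k - m) j : ℤ) * w (k - m) i) +
    w m j * (Complex.I * ((k - m) i : ℤ) * u (k - m) j))

/-- The Fourier coefficients of `(u·∇)w + (∇u)ᵀ w`. -/
def transport (u w : Coef) : Coef := fun k i => ∑' m, transportTerm u w k i m

/-- The constant of the estimate of the transport term. -/
def transportConst : ℝ≥0 := 108 * convConst

theorem enorm_freq_le_jap (k : Freq) (j : Fin 3) :
    ‖Complex.I * ((k j : ℤ) : ℂ)‖ₑ ≤ ((jap k : ℝ≥0) : ℝ≥0∞) := by
  have := freq_sq_le_jap k j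
  rw [zpow_ofNat, ENNReal.coe_pow] at this
  exact (ENNReal.pow_le_pow_left_iff two_ne_zero).1 this

/-- The `ℓ¹` norm of a coefficient vector. -/
def coefSum (y : Coef) (k : Freq) : ℝ≥0∞ := ∑ j, ‖y k j‖ₑ

theorem coefSum_sq_le (y : Coef) (k : Freq) : coefSum y k ^ 2 ≤ 3 * ∑ j, ‖y k j‖ₑ ^ 2 := by
  have h := sum_mul_sq_le Finset.univ (fun _ : Fin 3 => (1 : ℝ≥0∞)) (fun j => ‖y k j‖ₑ)
  simpa [coefSum] using h

theorem le_coefSum (y : Coef) (k : Freq) (i : Fin 3) : ‖y k i‖ₑ ≤ coefSum y k :=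
  Finset.single_le_sum (f := fun i => ‖y k i‖ₑ) (fun _ _ => zero_le) (Finset.mem_univ i)

theorem tsum_jap_sq_coefSum_le (y : Coef) :
    ∑' k, ((jap k ^ 2 : ℝ≥0) : ℝ≥0∞) * coefSum y k ^ 2 ≤ 3 * sobN 2 y := by
  rw [sobN, ← ENNReal.tsum_mul_left]
  refine ENNReal.tsum_le_tsum fun k => ?_
  rw [mul_left_comm, zpow_ofNat]
  gcongr
  exact coefSum_sq_le y k

theorem enorm_transportTerm_le (u w : Coef) (k : Freq) (i : Fin 3) (m : Freq) :
    ‖transportTerm u w k i m‖ₑ ≤ coefSum u m * (jap (k - m) * coefSum w (k - m)) +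
      coefSum w m * (jap (k - m) * coefSum u (k - m)) := by
  unfold transportTerm
  refine (enorm_sum_le _ _).trans ?_
  calc ∑ j, ‖u m j * (Complex.I * ((k - m) j : ℤ) * w (k - m) i) +
        w m j * (Complex.I * ((k - m) i : ℤ) * u (k - m) j)‖ₑ
      ≤ ∑ j, (‖u m j‖ₑ * (jap (k - m) * coefSum w (k - m)) +
          ‖w m j‖ₑ * (jap (k - m) * coefSum u (k - m))) := by
        refine Finset.sum_le_sum fun j _ => (enorm_add_le _ _).trans ?_
        rw [enorm_mul, enorm_mul (w m j), enorm_mul _ (w (k - m) i), enorm_mul _ (u (k - m) j)]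
        gcongr
        · exact enorm_freq_le_jap _ _
        · exact le_coefSum _ _ _
        · exact enorm_freq_le_jap _ _
        · exact le_coefSum _ _ _
    _ = _ := by rw [Finset.sum_add_distrib, ← Finset.sum_mul, ← Finset.sum_mul]; rfl

theorem tsum_conv_coefSum_le (u w : Coef) :
    ∑' k, ((jap k)⁻¹ : ℝ≥0) * (∑' m, coefSum u m * (jap (k - m) * coefSum w (k - m))) ^ 2 ≤
      9 * convConst * (sobN 2 u * sobN 2 w) := by
  refine (tsum_conv_le (coefSum u) (fun n => jap n * coefSum w n)).trans ?_
  simp only [mul_pow, ← ENNReal.coe_pow]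
  calc (convConst : ℝ≥0∞) * ((∑' m, ((jap m ^ 2 : ℝ≥0) : ℝ≥0∞) * coefSum u m ^ 2) *
        ∑' m, ((jap m ^ 2 : ℝ≥0) : ℝ≥0∞) * coefSum w m ^ 2)
      ≤ convConst * ((3 * sobN 2 u) * (3 * sobN 2 w)) := by
        gcongr <;> exact tsum_jap_sq_coefSum_le _
    _ = _ := by ring

/-- Each component is dominated by two convolutions, one for each product, with the undifferentiated
field as the `H¹` factor and the differentiated one as the `L²` factor. The constant is `3`
components times `2 · (9 + 9)`, each `9` being the loss from `ℓ¹` to `ℓ²` in both factors. -/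
theorem sobN_transport_le (u w : Coef) :
    sobN (-1) (transport u w) ≤ transportConst * (sobN 2 u * sobN 2 w) := by
  let P : Freq → ℝ≥0∞ := fun k => ∑' m, coefSum u m * (jap (k - m) * coefSum w (k - m))
  let Q : Freq → ℝ≥0∞ := fun k => ∑' m, coefSum w m * (jap (k - m) * coefSum u (k - m))
  have h1 : ∀ k i, ‖transport u w k i‖ₑ ^ 2 ≤ 2 * (P k ^ 2 + Q k ^ 2) := fun k i => by
    refine le_trans ?_ (add_sq_le _ _)
    gcongr
    rw [← ENNReal.tsum_add]
    exact enorm_tsum_le_tsum_enorm.trans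
      (ENNReal.tsum_le_tsum fun m => enorm_transportTerm_le u w k i m)
  calc sobN (-1) (transport u w)
      ≤ ∑' k, (((jap k)⁻¹ : ℝ≥0) : ℝ≥0∞) * ∑ i : Fin 3, 2 * (P k ^ 2 + Q k ^ 2) := by
        unfold sobN
        refine ENNReal.tsum_le_tsum fun k => ?_
        rw [zpow_neg_one]
        exact mul_le_mul_right (Finset.sum_le_sum fun i _ => h1 k i) _
    _ = 6 * (∑' k, (((jap k)⁻¹ : ℝ≥0) : ℝ≥0∞) * P k ^ 2 +
          ∑' k, (((jap k)⁻¹ : ℝ≥0) : ℝ≥0∞) * Q k ^ 2) := by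
        rw [← ENNReal.tsum_add, ← ENNReal.tsum_mul_left]
        refine tsum_congr fun k => ?_
        simp only [Finset.sum_const, Finset.card_univ, Fintype.card_fin, nsmul_eq_mul]
        push_cast
        ring
    _ ≤ 6 * (9 * convConst * (sobN 2 u * sobN 2 w) + 9 * convConst * (sobN 2 w * sobN 2 u)) := by
        gcongr <;> exact tsum_conv_coefSum_le _ _
    _ = _ := by
        rw [transportConst]
        push_cast
        ring

/-- A finite weighted sum over `k` forces the absolute convolution to be finite at every single `k`.
This is what makes the unconditional sum defining `transport` additive. -/
theorem summable_transportTerm {u w : Coef} (hu : sobN 2 u < ⊤) (hw : sobN 2 w < ⊤) (k : Freq)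
    (i : Fin 3) : Summable (transportTerm u w k i) := by
  have key : ∀ u w : Coef, sobN 2 u < ⊤ → sobN 2 w < ⊤ →
      ∑' m, coefSum u m * (jap (k - m) * coefSum w (k - m)) < ⊤ := fun u w hu hw => by
    have h := (ENNReal.le_tsum k).trans (tsum_conv_coefSum_le u w)
    have h2 : 9 * (convConst : ℝ≥0∞) * (sobN 2 u * sobN 2 w) < ⊤ :=
      ENNReal.mul_lt_top (ENNReal.mul_lt_top (by norm_num) ENNReal.coe_lt_top)
        (ENNReal.mul_lt_top hu hw)
    have h3 := h.trans_lt h2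
    by_contra hc
    rw [not_lt_top_iff.1 hc] at h3
    simp [ENNReal.mul_top, jap_ne_zero k] at h3
  refine Summable.of_enorm (ne_of_lt ?_)
  refine (ENNReal.tsum_le_tsum fun m => enorm_transportTerm_le u w k i m).trans_lt ?_
  rw [ENNReal.tsum_add]
  exact ENNReal.add_lt_top.2 ⟨key u w hu hw, key w u hw hu⟩

theorem transport_add {u v w : Coef} (hu : sobN 2 u < ⊤) (hv : sobN 2 v < ⊤) (hw : sobN 2 w < ⊤) :
    transport u (v + w) = transport u v + transport u w := by
  ext k i
  rw [Pi.add_apply, Pi.add_apply, transport, transport, transport,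
    ← (summable_transportTerm hu hv k i).tsum_add (summable_transportTerm hu hw k i)]
  refine tsum_congr fun m => ?_
  unfold transportTerm
  rw [← Finset.sum_add_distrib]
  refine Finset.sum_congr rfl fun j _ => ?_
  simp only [Pi.add_apply]
  ring

theorem transport_smul (c : ℂ) (u w : Coef) : transport u (c • w) = c • transport u w := by
  ext k i
  rw [Pi.smul_apply, Pi.smul_apply, transport, transport, smul_eq_mul, ← tsum_mul_left]
  refine tsum_congr fun m => ?_
  unfold transportTerm
  rw [Finset.mul_sum]
  refine Finset.sum_congr rfl fun j _ => ?_
  simp only [Pi.smul_apply, smul_eq_mul]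
  ring

theorem sobN_smul (n : ℤ) (c : ℂ) (y : Coef) : sobN n (c • y) = ‖c‖ₑ ^ 2 * sobN n y := by
  unfold sobN
  rw [← ENNReal.tsum_mul_left]
  refine tsum_congr fun k => ?_
  rw [mul_left_comm, Finset.mul_sum _ _ (‖c‖ₑ ^ 2)]
  congr 1
  refine Finset.sum_congr rfl fun i _ => ?_
  rw [Pi.smul_apply, Pi.smul_apply, smul_eq_mul, enorm_mul, mul_pow]

theorem transport_sub {u v w : Coef} (hu : sobN 2 u < ⊤) (hv : sobN 2 v < ⊤) (hw : sobN 2 w < ⊤) :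
    transport u (v - w) = transport u v - transport u w := by
  have e : v - w = v + (-1 : ℂ) • w := by simp [sub_eq_add_neg]
  rw [e, transport_add hu hv (by rw [sobN_smul]; simpa using hw), transport_smul]
  simp [sub_eq_add_neg]

/-- The coefficients of the complex conjugate vector field. -/
def reflect (y : Coef) : Coef := fun k i => conj (y (-k) i)

theorem sobN_reflect (n : ℤ) (y : Coef) : sobN n (reflect y) = sobN n y := by
  unfold sobN reflect
  rw [← (Equiv.neg Freq).tsum_eq (fun k => ((jap k ^ n : ℝ≥0) : ℝ≥0∞) * ∑ i, ‖y k i‖ₑ ^ 2)]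
  refine tsum_congr fun k => ?_
  simp only [Equiv.neg_apply, jap_neg]
  congr 1
  refine Finset.sum_congr rfl fun i _ => ?_
  congr 1
  simp [enorm, nnnorm]

theorem reflect_coeff (f : L2) : reflect (coeff f) = coeff f := by
  ext k i
  rw [reflect, coeff_neg, Complex.conj_conj]

/-- The bilinear differential expression has real coefficients, so it commutes with complex
conjugation; on coefficients, substitute `m ↦ -m`. -/
theorem transport_reflect (u w : Coef) :
    transport (reflect u) (reflect w) = reflect (transport u w) := by
  ext k i
  rw [transport, reflect, transport, Complex.conj_tsum, ← (Equiv.neg Freq).tsum_eq]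
  refine tsum_congr fun m => ?_
  have e : k - -m = -(-k - m) := by abel
  simp only [transportTerm, reflect, Equiv.neg_apply, map_sum, map_add, map_mul, Complex.conj_I, e,
    neg_neg]
  refine Finset.sum_congr rfl fun j _ => ?_
  simp
  ring

/-! ### Trilinear Parseval identities -/

/-- The product `ab` is only integrable, so Parseval does not apply to `ab` against `ψ`. Absolute
summability of the double series allows summing it in another order, which is Parseval for `b`
against `aψ`, both square integrable. -/
theorem hasSum_trilinear {a b ψ : Torus → ℂ} (ha : MemLp a 2 volume) (hb : MemLp b 2 volume)
    (hψ : Continuous ψ)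
    (hs : ∑' k, ‖cf ψ (-k)‖ₑ * ∑' m, ‖cf a m‖ₑ * ‖cf b (k - m)‖ₑ < ⊤) :
    HasSum (fun k => cf (fun x => a x * b x) k * cf ψ (-k))
      ((vol : ℂ)⁻¹ * ∫ x, a x * b x * ψ x) := by
  obtain ⟨F, hFd⟩ : ∃ F : Freq × Freq → ℂ,
      ∀ k m, F (k, m) = cf a m * cf b (k - m) * cf ψ (-k) := 
    ⟨fun p => cf a p.2 * cf b (p.1 - p.2) * cf ψ (-p.1), fun _ _ => rfl⟩
  have hF : Summable F := by
    refine Summable.of_enorm (ne_of_lt ?_)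
    rw [ENNReal.tsum_prod']
    refine lt_of_le_of_lt (le_of_eq (tsum_congr fun k => ?_)) hs
    rw [← ENNReal.tsum_mul_left]
    refine tsum_congr fun m => ?_
    rw [hFd, enorm_mul, enorm_mul, mul_comm]
  have hψ2 : MemLp ψ 2 volume := Torus.memLp_of_continuous hψ 2
  obtain ⟨C, hC⟩ := isCompact_univ.exists_bound_of_continuousOn hψ.continuousOn
  have haψ : MemLp (fun x => a x * ψ x) 2 volume :=
    memLp_mul_of_bound ha hψ.aestronglyMeasurable fun x => hC x (mem_univ x)
  have h1 : HasSum (fun k => cf (fun x => a x * b x) k * cf ψ (-k)) (∑' p, F p) :=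
    hF.hasSum.prod_fiberwise fun k => by
      simp only [hFd]
      exact (hasSum_cf_conv ha hb k).mul_right _
  let e : Freq × Freq ≃ Freq × Freq :=
    { toFun := fun p => (p.1 + p.2, p.2)
      invFun := fun p => (p.1 - p.2, p.2)
      left_inv := fun p => by simp
      right_inv := fun p => by simp }
  -- Reindexing by `n = k - m` fixes the frequency of `b`, and the inner sum becomes the convolution
  -- for `aψ` at `-n`.
  have h2 : HasSum (fun n => cf b n * cf (fun x => a x * ψ x) (-n)) (∑' p, F p) := by
    refine (e.hasSum_iff.2 hF.hasSum).prod_fiberwise fun n => ?_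
    have := (hasSum_cf_conv ha hψ2 (-n)).mul_left (cf b n)
    refine this.congr_fun fun m => ?_
    rw [Function.comp_apply, show e (n, m) = (n + m, m) from rfl, hFd, add_sub_cancel_right, neg_add']
    ring
  have h3 : ∫ x, a x * b x * ψ x = ∫ x, b x * (a x * ψ x) := by
    congr 1
    ext x
    ring
  rw [h3, ← h2.unique (hasSum_cf_mul hb haψ)]
  exact h1

/-- Duality of `H^{1/2}` with `H^{-1/2}`: the test function takes the weight `⟨k⟩^{1/2}` and the
convolution estimate bounds the rest. -/
theorem tsum_trilinear_lt_top {a b c : Freq → ℂ}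
    (ha : ∑' m, ((jap m ^ 2 : ℝ≥0) : ℝ≥0∞) * ‖a m‖ₑ ^ 2 < ⊤) (hb : ∑' m, ‖b m‖ₑ ^ 2 < ⊤)
    (hc : ∑' m, ((jap m : ℝ≥0) : ℝ≥0∞) * ‖c m‖ₑ ^ 2 < ⊤) :
    ∑' k, ‖c (-k)‖ₑ * ∑' m, ‖a m‖ₑ * ‖b (k - m)‖ₑ < ⊤ := by
  let s : Freq → ℝ≥0 := fun k => NNReal.sqrt (jap k)
  have hs0 : ∀ k, s k ≠ 0 := fun k => by simp [s, jap_ne_zero k]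
  have h := tsum_mul_sq_le (fun k => (s k : ℝ≥0∞) * ‖c (-k)‖ₑ)
    (fun k => (((s k)⁻¹ : ℝ≥0) : ℝ≥0∞) * ∑' m, ‖a m‖ₑ * ‖b (k - m)‖ₑ)
  have e1 : ∀ k, (s k : ℝ≥0∞) * ‖c (-k)‖ₑ * ((((s k)⁻¹ : ℝ≥0) : ℝ≥0∞) *
      ∑' m, ‖a m‖ₑ * ‖b (k - m)‖ₑ) = ‖c (-k)‖ₑ * ∑' m, ‖a m‖ₑ * ‖b (k - m)‖ₑ := fun k => by
    rw [mul_mul_mul_comm, ← mul_assoc, ← ENNReal.coe_mul, mul_inv_cancel₀ (hs0 k), ENNReal.coe_one, one_mul]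
  simp only [e1, mul_pow, ← ENNReal.coe_pow, inv_pow, s, NNReal.sq_sqrt] at h
  rw [← (Equiv.neg Freq).tsum_eq] at hc
  simp only [Equiv.neg_apply, jap_neg] at hc
  have h2 := h.trans_lt (ENNReal.mul_lt_top hc ((tsum_conv_le _ _).trans_lt
    (ENNReal.mul_lt_top ENNReal.coe_lt_top (ENNReal.mul_lt_top ha hb))))
  by_contra hcon
  rw [not_lt_top_iff.1 hcon] at h2
  simp at h2

theorem tsum_component_le (n : ℤ) (y : Coef) (i : Fin 3) :
    ∑' k, ((jap k ^ n : ℝ≥0) : ℝ≥0∞) * ‖y k i‖ₑ ^ 2 ≤ sobN n y := by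
  unfold sobN
  gcongr with k
  exact Finset.single_le_sum (f := fun i => ‖y k i‖ₑ ^ 2) (fun _ _ => zero_le)
    (Finset.mem_univ i)

/-- Parseval's identity for the transport term against a complex test function. -/
theorem hasSum_transport {u w : L2} (hu : sobN 2 (coeff u) < ⊤) (hw : sobN 2 (coeff w) < ⊤)
    (i : Fin 3) {ψ : Torus → ℂ} (hψ : Continuous ψ)
    (hψ1 : ∑' k, ((jap k : ℝ≥0) : ℝ≥0∞) * ‖cf ψ k‖ₑ ^ 2 < ⊤) :
    HasSum (fun k => transport (coeff u) (coeff w) k i * cf ψ (-k))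
      ((vol : ℂ)⁻¹ * ∫ x, ((∑ j, (u x j * weakPartial j w x i + weakPartial i u x j * w x j) : ℝ) : ℂ)
        * ψ x) := by
  obtain ⟨C, hC⟩ := isCompact_univ.exists_bound_of_continuousOn hψ.continuousOn
  -- One product of a component with a weak derivative: its Parseval identity, its convolution
  -- formula and its integrability. Both products in the transport term are instances.
  have key : ∀ (v z : L2) (j l l' : Fin 3), sobN 2 (coeff v) < ⊤ → sobN 2 (coeff z) < ⊤ →
      HasSum (fun k => cf (fun x => ((v x j : ℝ) : ℂ) * ((weakPartial l z x l' : ℝ) : ℂ)) k * cf ψ (-k))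
      ((vol : ℂ)⁻¹ * ∫ x, ((v x j : ℝ) : ℂ) * ((weakPartial l z x l' : ℝ) : ℂ) * ψ x) ∧
      (∀ k, HasSum (fun m => coeff v m j * (Complex.I * ((k - m) l : ℤ) * coeff z (k - m) l'))
        (cf (fun x => ((v x j : ℝ) : ℂ) * ((weakPartial l z x l' : ℝ) : ℂ)) k)) ∧
      Integrable (fun x => ((v x j : ℝ) : ℂ) * ((weakPartial l z x l' : ℝ) : ℂ) * ψ x) := by
    intro v z j l l' hv hz
    have m1 := memLp_comp v j
    have m2 := memLp_comp (weakPartial l z) l'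
    refine ⟨hasSum_trilinear m1 m2 hψ (tsum_trilinear_lt_top ?_ ?_ hψ1), fun k => ?_, ?_⟩
    · refine lt_of_le_of_lt ?_ hv
      exact tsum_component_le 2 (coeff v) j
    · refine lt_of_le_of_lt ?_ hz
      refine le_trans ?_ (sobN_partial_le (coeff z) l)
      refine le_trans (le_of_eq (tsum_congr fun m => ?_)) (tsum_component_le 0 _ l')
      rw [← coeff_eq_cf, coeff_weakPartial hz]
      simp
    · refine (hasSum_cf_conv m1 m2 k).congr_fun fun m => ?_
      rw [← coeff_eq_cf, ← coeff_eq_cf, coeff_weakPartial hz]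
    · exact (m1.integrable_mul m2).mul_bdd (c := C) hψ.aestronglyMeasurable
        (Eventually.of_forall fun x => hC x (mem_univ x))
  have h1 : HasSum (fun k => ∑ j,
      (cf (fun x => ((u x j : ℝ) : ℂ) * ((weakPartial j w x i : ℝ) : ℂ)) k * cf ψ (-k) +
        cf (fun x => ((w x j : ℝ) : ℂ) * ((weakPartial i u x j : ℝ) : ℂ)) k * cf ψ (-k)))
      (∑ j, ((vol : ℂ)⁻¹ * (∫ x, ((u x j : ℝ) : ℂ) * ((weakPartial j w x i : ℝ) : ℂ) * ψ x) +
        (vol : ℂ)⁻¹ * ∫ x, ((w x j : ℝ) : ℂ) * ((weakPartial i u x j : ℝ) : ℂ) * ψ x)) :=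
    hasSum_sum fun j _ => (key u w j j i hu hw).1.add (key w u j i j hw hu).1
  convert! h1 using 1
  · ext k
    have h2 : HasSum (transportTerm (coeff u) (coeff w) k i) (∑ j,
        (cf (fun x => ((u x j : ℝ) : ℂ) * ((weakPartial j w x i : ℝ) : ℂ)) k +
        cf (fun x => ((w x j : ℝ) : ℂ) * ((weakPartial i u x j : ℝ) : ℂ)) k)) :=
      hasSum_sum fun j _ => ((key u w j j i hu hw).2.1 k).add ((key w u j i j hw hu).2.1 k)
    rw [transport, h2.tsum_eq, Finset.sum_mul]
    simp only [add_mul]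
  · simp only [← mul_add]
    rw [← Finset.mul_sum]
    congr 1
    have h3 : ∀ j, (∫ x, ((u x j : ℝ) : ℂ) * ((weakPartial j w x i : ℝ) : ℂ) * ψ x) +
        ∫ x, ((w x j : ℝ) : ℂ) * ((weakPartial i u x j : ℝ) : ℂ) * ψ x =
        ∫ x, (((u x j : ℝ) : ℂ) * ((weakPartial j w x i : ℝ) : ℂ) * ψ x +
          ((w x j : ℝ) : ℂ) * ((weakPartial i u x j : ℝ) : ℂ) * ψ x) := fun j =>
      (integral_add (key u w j j i hu hw).2.2 (key w u j i j hw hu).2.2).symm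
    simp only [h3]
    have h4 : ∀ j, Integrable (fun x =>
        ((u x j : ℝ) : ℂ) * ((weakPartial j w x i : ℝ) : ℂ) * ψ x +
          ((w x j : ℝ) : ℂ) * ((weakPartial i u x j : ℝ) : ℂ) * ψ x) := fun j =>
      (key u w j j i hu hw).2.2.add (key w u j i j hw hu).2.2
    rw [← integral_finsetSum _ fun j _ => h4 j]
    congr 1
    ext x
    push_cast
    rw [Finset.sum_mul]
    refine Finset.sum_congr rfl fun j _ => ?_
    ring

/-! ### The energy inequality for coefficient families -/

/-- `Y` solves `Y' = -|k|² Y - F`, `Y(0) = y₀` on `[0,T]`, with `F ∈ L²(0,T;H^{-1/2})`. -/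
structure IsModeSol (T : ℝ) (y₀ : Coef) (Y F : ℝ → Coef) : Prop where
  deriv : ∀ k i, HasACDeriv T (fun t => Y t k i)
    (fun t => -((((jap k : ℝ) ^ 2 - 1 : ℝ)) : ℂ) * Y t k i - F t k i)
  init : ∀ k i, Y 0 k i = y₀ k i
  meas : ∀ k i, AEStronglyMeasurable (fun t => F t k i) (volume.restrict (Ioc 0 T))
  fin : ∫⁻ t in Ioc 0 T, sobN (-1) (F t) < ⊤

theorem aemeasurable_sobN {μ : Measure ℝ} {Y : ℝ → Coef} (n : ℤ)
    (h : ∀ k i, AEStronglyMeasurable (fun t => Y t k i) μ) :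
    AEMeasurable (fun t => sobN n (Y t)) μ :=
  AEMeasurable.tsum fun k => (Finset.aemeasurable_fun_sum _ fun i _ =>
    (h k i).enorm.pow_const 2).const_mul _

/-- Tonelli: the passage between time integrals of Sobolev norms and sums of the estimates for
single modes. -/
theorem lintegral_mul_sobN {μ : Measure ℝ} {Y : ℝ → Coef} {c : ℝ → ℝ≥0∞} (hc : AEMeasurable c μ)
    (n : ℤ) (h : ∀ k i, AEStronglyMeasurable (fun t => Y t k i) μ) :
    ∫⁻ t, c t * sobN n (Y t) ∂μ =
      ∑' k, ((jap k ^ n : ℝ≥0) : ℝ≥0∞) * ∑ i, ∫⁻ t, c t * ‖Y t k i‖ₑ ^ 2 ∂μ := by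
  have hm : ∀ k i, AEMeasurable (fun t => c t * ‖Y t k i‖ₑ ^ 2) μ := fun k i =>
    hc.mul ((h k i).enorm.pow_const 2)
  have e : ∀ t, c t * sobN n (Y t) =
      ∑' k, ((jap k ^ n : ℝ≥0) : ℝ≥0∞) * ∑ i, c t * ‖Y t k i‖ₑ ^ 2 := fun t => by
    rw [sobN, ← ENNReal.tsum_mul_left]
    refine tsum_congr fun k => ?_
    rw [mul_left_comm, Finset.mul_sum _ _ (c t)]
  simp only [e]
  rw [lintegral_tsum fun k => (Finset.aemeasurable_fun_sum _ fun i _ => hm k i).const_mul _]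
  refine tsum_congr fun k => ?_
  rw [lintegral_const_mul'' _ (Finset.aemeasurable_fun_sum _ fun i _ => hm k i),
    lintegral_finsetSum' _ fun i _ => hm k i]

theorem lintegral_mode_lt_top {T : ℝ} {F : ℝ → Coef}
    (hm : ∀ k i, AEStronglyMeasurable (fun t => F t k i) (volume.restrict (Ioc 0 T)))
    (hf : ∫⁻ t in Ioc 0 T, sobN (-1) (F t) < ⊤) (k : Freq) (i : Fin 3) :
    ∫⁻ t in Ioc 0 T, ‖F t k i‖ₑ ^ 2 < ⊤ := by
  have h := lintegral_mul_sobN (c := fun _ => 1) aemeasurable_const (-1) hm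
  simp only [one_mul] at h
  rw [h] at hf
  have h1 := (ENNReal.le_tsum k).trans_lt hf
  have h2 : ∑ i, ∫⁻ t in Ioc 0 T, ‖F t k i‖ₑ ^ 2 < ⊤ := by
    by_contra hcon
    rw [not_lt_top_iff.1 hcon, ENNReal.mul_top (by simp [jap_ne_zero k])] at h1
    exact lt_irrefl _ h1
  exact (Finset.single_le_sum (f := fun i => ∫⁻ t in Ioc 0 T, ‖F t k i‖ₑ ^ 2)
    (fun _ _ => zero_le) (Finset.mem_univ i)).trans_lt h2

/-- The exponential weight `exp (-∫₀ᵗ (γ + 2))`. -/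
def expWeight (γ : ℝ → ℝ) (t : ℝ) : ℝ≥0∞ :=
  ENNReal.ofReal (Real.exp (-∫ s in (0 : ℝ)..t, (γ s + 2)))

theorem expWeight_ne_zero (γ : ℝ → ℝ) (t : ℝ) : expWeight γ t ≠ 0 := by
  simp [expWeight, Real.exp_pos]

theorem expWeight_ne_top (γ : ℝ → ℝ) (t : ℝ) : expWeight γ t ≠ ⊤ := ENNReal.ofReal_ne_top

theorem expWeight_le_one {γ : ℝ → ℝ} (h0 : ∀ t, 0 ≤ γ t) {t : ℝ} (ht : 0 ≤ t) :
    expWeight γ t ≤ 1 := by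
  rw [expWeight, ← ENNReal.ofReal_one]
  refine ENNReal.ofReal_le_ofReal (Real.exp_le_one_iff.2 (neg_nonpos.2 ?_))
  exact intervalIntegral.integral_nonneg ht fun s _ => by linarith [h0 s]

theorem expWeight_anti {γ : ℝ → ℝ} {T : ℝ} (h0 : ∀ t, 0 ≤ γ t)
    (hγ : IntervalIntegrable γ volume 0 T) {t : ℝ} (ht : t ∈ Icc 0 T) :
    expWeight γ T ≤ expWeight γ t := by
  have hi : IntervalIntegrable (fun s => γ s + 2) volume 0 T := hγ.add (by simp)
  refine ENNReal.ofReal_le_ofReal (Real.exp_le_exp.2 (neg_le_neg ?_))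
  have hT : 0 ≤ T := ht.1.trans ht.2
  have h1 : IntervalIntegrable (fun s => γ s + 2) volume 0 t := hi.mono_set
    (uIcc_subset_uIcc (by simp) (by rwa [uIcc_of_le hT]))
  have h2 : IntervalIntegrable (fun s => γ s + 2) volume t T := hi.mono_set
    (uIcc_subset_uIcc (by rwa [uIcc_of_le hT]) (by simp))
  rw [← intervalIntegral.integral_add_adjacent_intervals h1 h2]
  have := intervalIntegral.integral_nonneg (μ := volume) (f := fun s => γ s + 2) ht.2
    fun s _ => by linarith [h0 s]
  linarith

theorem aemeasurable_expWeight {γ : ℝ → ℝ} {T : ℝ} (hT : 0 ≤ T)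
    (hγ : IntervalIntegrable γ volume 0 T) :
    AEMeasurable (expWeight γ) (volume.restrict (Ioc 0 T)) := by
  have hi : IntervalIntegrable (fun s => γ s + 2) volume 0 T := hγ.add (by simp)
  have hc : ContinuousOn (fun t => ∫ s in (0 : ℝ)..t, (γ s + 2)) (Ioc 0 T) := by
    have := (HasACDeriv.of_integral hi 0).continuousOn hT
    simp only [zero_add] at this
    exact this.mono Ioc_subset_Icc_self
  exact ((Real.continuous_exp.comp_continuousOn hc.neg).aemeasurable measurableSet_Ioc).ennreal_ofReal

namespace IsModeSol

variable {T : ℝ} {y₀ z₀ : Coef} {Y F Z H : ℝ → Coef}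

theorem aestronglyMeasurable (h : IsModeSol T y₀ Y F) (hT : 0 ≤ T) (k : Freq) (i : Fin 3) :
    AEStronglyMeasurable (fun t => Y t k i) (volume.restrict (Ioc 0 T)) :=
  (((h.deriv k i).continuousOn hT).mono Ioc_subset_Icc_self).aestronglyMeasurable measurableSet_Ioc

theorem mono (h : IsModeSol T y₀ Y F) {t : ℝ} (ht : t ∈ Icc 0 T) : IsModeSol t y₀ Y F where
  deriv k i := (h.deriv k i).mono (by rwa [uIcc_of_le (ht.1.trans ht.2)])
  init := h.init
  meas k i := (h.meas k i).mono_measure (Measure.restrict_mono (Ioc_subset_Ioc_right ht.2) le_rfl)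
  fin := (lintegral_mono_set (Ioc_subset_Ioc_right ht.2)).trans_lt h.fin

theorem sub (h : IsModeSol T y₀ Y F) (h' : IsModeSol T z₀ Z H) :
    IsModeSol T (y₀ - z₀) (fun t => Y t - Z t) (fun t => F t - H t) where
  deriv k i := ((h.deriv k i).sub (h'.deriv k i)).congr_deriv (Eventually.of_forall fun t _ => by
    simp only [Pi.sub_apply]; ring)
  init k i := by simp [h.init, h'.init]
  meas k i := (h.meas k i).sub (h'.meas k i)
  fin := by
    refine (lintegral_mono fun t => sobN_sub_le (-1) (F t) (H t)).trans_lt ?_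
    have hm : AEMeasurable (fun t => sobN (-1) (F t) + sobN (-1) (H t)) (volume.restrict (Ioc 0 T)) :=
      (aemeasurable_sobN _ h.meas).add (aemeasurable_sobN _ h'.meas)
    rw [lintegral_const_mul'' _ hm, lintegral_add_left' (aemeasurable_sobN _ h.meas)]
    exact ENNReal.mul_lt_top (by norm_num) (ENNReal.add_lt_top.2 ⟨h.fin, h'.fin⟩)

theorem exists_of_forcing (hT : 0 ≤ T) (y₀ : Coef) {F : ℝ → Coef}
    (hm : ∀ k i, AEStronglyMeasurable (fun t => F t k i) (volume.restrict (Ioc 0 T)))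
    (hf : ∫⁻ t in Ioc 0 T, sobN (-1) (F t) < ⊤) : ∃ Y, IsModeSol T y₀ Y F := by
  refine ⟨fun t k i => modeSol ((jap k : ℝ) ^ 2 - 1) (y₀ k i) (fun t => F t k i) t, fun k i => ?_,
    fun k i => modeSol_zero _ _ _, hm, hf⟩
  exact hasACDeriv_modeSol _ _
    (intervalIntegrable_of_lintegral_sq hT (hm k i) (lintegral_mode_lt_top hm hf k i)).1

/-- Apply `mode_energy` with `J = ⟨k⟩`, multiply by `⟨k⟩` and sum: the dissipation `⟨k⟩²` becomes
`⟨k⟩³` and the forcing factor `⟨k⟩⁻²` becomes `⟨k⟩⁻¹`. -/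
theorem energy (h : IsModeSol T y₀ Y F) (hT : 0 ≤ T) {γ : ℝ → ℝ} (h0 : ∀ t, 0 ≤ γ t)
    (hγ : IntervalIntegrable γ volume 0 T) :
    expWeight γ T * sobN 1 (Y T) + ∫⁻ t in Ioc 0 T, expWeight γ t *
        (ENNReal.ofReal (γ t) * sobN 1 (Y t) + sobN 3 (Y t)) ≤
      sobN 1 y₀ + ∫⁻ t in Ioc 0 T, expWeight γ t * sobN (-1) (F t) := by
  have hw := aemeasurable_expWeight hT hγ
  have hγm : AEMeasurable (fun t => ENNReal.ofReal (γ t)) (volume.restrict (Ioc 0 T)) :=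
    ((intervalIntegrable_iff_integrableOn_Ioc_of_le hT).1 hγ).1.aemeasurable.ennreal_ofReal
  have hYm := h.aestronglyMeasurable hT
  have e1 : ∫⁻ t in Ioc 0 T, expWeight γ t *
      (ENNReal.ofReal (γ t) * sobN 1 (Y t) + sobN 3 (Y t)) =
      ∑' k, ((jap k ^ (1 : ℤ) : ℝ≥0) : ℝ≥0∞) * ∑ i, ∫⁻ t in Ioc 0 T, expWeight γ t *
        ((ENNReal.ofReal (γ t) + ENNReal.ofReal ((jap k : ℝ) ^ 2)) * ‖Y t k i‖ₑ ^ 2) := by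
    have hwγ : AEMeasurable (fun t => expWeight γ t * ENNReal.ofReal (γ t))
      (volume.restrict (Ioc 0 T)) := hw.mul hγm
    have hwY : AEMeasurable (fun t => expWeight γ t * ENNReal.ofReal (γ t) * sobN 1 (Y t))
      (volume.restrict (Ioc 0 T)) := hwγ.mul (aemeasurable_sobN 1 hYm)
    simp only [mul_add, ← mul_assoc]
    rw [lintegral_add_left' hwY, lintegral_mul_sobN hwγ 1 hYm, lintegral_mul_sobN hw 3 hYm, ← ENNReal.tsum_add]
    refine tsum_congr fun k => ?_
    have e3 : ((jap k ^ (3 : ℤ) : ℝ≥0) : ℝ≥0∞) =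
        ((jap k ^ (1 : ℤ) : ℝ≥0) : ℝ≥0∞) * ENNReal.ofReal ((jap k : ℝ) ^ 2) := by
      rw [← NNReal.coe_pow, ENNReal.ofReal_coe_nnreal, ← ENNReal.coe_mul, zpow_one, zpow_ofNat]
      congr 1
      ring
    rw [e3, mul_assoc, ← mul_add, Finset.mul_sum, ← Finset.sum_add_distrib]
    congr 1
    refine Finset.sum_congr rfl fun i _ => ?_
    have hm : AEMeasurable (fun t => ‖Y t k i‖ₑ ^ 2) (volume.restrict (Ioc 0 T)) :=
      (hYm k i).enorm.pow_const 2
    have hwm : AEMeasurable (fun t => expWeight γ t * ‖Y t k i‖ₑ ^ 2) (volume.restrict (Ioc 0 T)) :=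
      hw.mul hm
    have hwγm : AEMeasurable (fun t => expWeight γ t * ENNReal.ofReal (γ t) * ‖Y t k i‖ₑ ^ 2)
      (volume.restrict (Ioc 0 T)) := hwγ.mul hm
    rw [← lintegral_const_mul'' _ hwm, ← lintegral_add_left' hwγm]
    refine lintegral_congr fun t => ?_
    ring
  rw [e1, lintegral_mul_sobN hw (-1) h.meas]
  unfold sobN
  rw [← ENNReal.tsum_mul_left, ← ENNReal.tsum_add, ← ENNReal.tsum_add]
  refine ENNReal.tsum_le_tsum fun k => ?_
  have e4 : ((jap k ^ (-1 : ℤ) : ℝ≥0) : ℝ≥0∞) =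
      ((jap k ^ (1 : ℤ) : ℝ≥0) : ℝ≥0∞) * ENNReal.ofReal ((jap k : ℝ) ^ 2)⁻¹ := by
    rw [← NNReal.coe_pow, ← NNReal.coe_inv, ENNReal.ofReal_coe_nnreal, ← ENNReal.coe_mul, zpow_one,
      zpow_neg_one]
    congr 1
    have := jap_ne_zero k
    field_simp
  rw [e4, mul_left_comm, mul_assoc, ← mul_add, ← mul_add, Finset.mul_sum _ _ (expWeight γ T),
    Finset.mul_sum _ _ (ENNReal.ofReal ((jap k : ℝ) ^ 2)⁻¹), ← Finset.sum_add_distrib,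
    ← Finset.sum_add_distrib]
  refine mul_le_mul_right (Finset.sum_le_sum fun i _ => ?_) _
  have hwm : AEMeasurable (fun t => expWeight γ t * ‖F t k i‖ₑ ^ 2) (volume.restrict (Ioc 0 T)) :=
    hw.mul ((h.meas k i).enorm.pow_const 2)
  have hE := mode_energy hT (NNReal.coe_pos.2 (jap_pos k)) (h.deriv k i) hγ h0 (h.meas k i)
    (lintegral_mode_lt_top h.meas h.fin k i)
  rw [h.init] at hE
  rw [← lintegral_const_mul'' _ hwm]
  refine hE.trans (le_of_eq ?_)
  congr 1
  refine lintegral_congr fun t => ?_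
  unfold expWeight
  ring

end IsModeSol

/-! ### The contraction estimate -/

theorem two_mul_le_add_sq_ennreal (x y : ℝ≥0∞) : 2 * (x * y) ≤ x ^ 2 + y ^ 2 := by
  have key : ∀ x y : ℝ≥0∞, x ≤ y → 2 * (x * y) ≤ x ^ 2 + y ^ 2 := fun x y hxy => by
    obtain ⟨d, rfl⟩ := exists_add_of_le hxy
    calc 2 * (x * (x + d)) ≤ 2 * (x * (x + d)) + d ^ 2 := le_self_add
      _ = _ := by ring
  rcases le_total x y with h | h
  · exact key x y h
  · rw [mul_comm x, add_comm]; exact key y x h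

/-- Young's inequality in each mode: `2a⟨k⟩ ≤ a² + ⟨k⟩²`, multiplied by `⟨k⟩`. -/
theorem two_mul_sobN_two_le (a : ℝ≥0∞) (y : Coef) :
    2 * (a * sobN 2 y) ≤ a ^ 2 * sobN 1 y + sobN 3 y := by
  unfold sobN
  simp only [← ENNReal.tsum_mul_left]
  rw [← ENNReal.tsum_add]
  refine ENNReal.tsum_le_tsum fun k => ?_
  have h := two_mul_le_add_sq_ennreal a (jap k)
  rw [zpow_one, zpow_ofNat, zpow_ofNat]
  push_cast
  calc 2 * (a * ((jap k : ℝ≥0∞) ^ 2 * ∑ i, ‖y k i‖ₑ ^ 2))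
      = (2 * (a * jap k)) * (jap k * ∑ i, ‖y k i‖ₑ ^ 2) := by ring
    _ ≤ (a ^ 2 + (jap k : ℝ≥0∞) ^ 2) * (jap k * ∑ i, ‖y k i‖ₑ ^ 2) := by gcongr
    _ = _ := by ring

/-- The rate used in the exponential weight. -/
def growth (U : ℝ → Coef) (t : ℝ) : ℝ := (2 * transportConst * (sobN 2 (U t)).toReal) ^ 2

theorem growth_nonneg (U : ℝ → Coef) (t : ℝ) : 0 ≤ growth U t := sq_nonneg _

/-- `growth` is chosen so that Young's inequality applies with `a = 2 · transportConst · sobN 2 (U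
t)`. The factor `4` concerns squared norms and becomes the contraction factor `1/2`. -/
theorem four_mul_transport_le {U : ℝ → Coef} {t : ℝ} (hU : sobN 2 (U t) < ⊤) (y : Coef) :
    4 * sobN (-1) (transport (U t) y) ≤ ENNReal.ofReal (growth U t) * sobN 1 y + sobN 3 y := by
  have h := two_mul_sobN_two_le (2 * transportConst * sobN 2 (U t)) y
  have e : ENNReal.ofReal (growth U t) = (2 * transportConst * sobN 2 (U t)) ^ 2 := by
    rw [growth, ENNReal.ofReal_pow (by positivity), ENNReal.ofReal_mul (by positivity),
      ENNReal.ofReal_toReal hU.ne, ENNReal.ofReal_mul (by positivity), ENNReal.ofReal_coe_nnreal]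
    simp
  rw [e]
  refine le_trans ?_ h
  calc 4 * sobN (-1) (transport (U t) y) ≤ 4 * (transportConst * (sobN 2 (U t) * sobN 2 y)) := by
        gcongr; exact sobN_transport_le _ _
    _ = _ := by ring

/-- A velocity field in `L⁴(0,T;H¹)`, through its Fourier coefficients. -/
structure IsVelocity (T : ℝ) (U : ℝ → Coef) : Prop where
  meas : ∀ k i, AEStronglyMeasurable (fun t => U t k i) (volume.restrict (Ioc 0 T))
  fin : ∫⁻ t in Ioc 0 T, sobN 2 (U t) ^ 2 < ⊤

namespace IsVelocity

variable {T : ℝ} {U : ℝ → Coef}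

theorem mono (h : IsVelocity T U) {t : ℝ} (ht : t ≤ T) : IsVelocity t U where
  meas k i := (h.meas k i).mono_measure (Measure.restrict_mono (Ioc_subset_Ioc_right ht) le_rfl)
  fin := (lintegral_mono_set (Ioc_subset_Ioc_right ht)).trans_lt h.fin

theorem ae_fin (h : IsVelocity T U) : ∀ᵐ t ∂(volume.restrict (Ioc 0 T)), sobN 2 (U t) < ⊤ := by
  filter_upwards [ae_lt_top' ((aemeasurable_sobN 2 h.meas).pow_const 2) h.fin.ne] with t ht
  by_contra hc
  rw [not_lt_top_iff.1 hc] at ht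
  simp at ht

theorem intervalIntegrable_growth (h : IsVelocity T U) (hT : 0 ≤ T) :
    IntervalIntegrable (growth U) volume 0 T := by
  rw [intervalIntegrable_iff_integrableOn_Ioc_of_le hT]
  have hm : AEMeasurable (growth U) (volume.restrict (Ioc 0 T)) :=
    (((aemeasurable_sobN 2 h.meas).ennreal_toReal).const_mul _).pow_const 2
  refine ⟨hm.aestronglyMeasurable, ?_⟩
  rw [hasFiniteIntegral_iff_ofReal (Eventually.of_forall (growth_nonneg U))]
  have e : ∀ᵐ t ∂(volume.restrict (Ioc 0 T)), ENNReal.ofReal (growth U t) =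
      (2 * transportConst) ^ 2 * sobN 2 (U t) ^ 2 := by
    filter_upwards [h.ae_fin] with t ht
    rw [growth, ENNReal.ofReal_pow (by positivity), ENNReal.ofReal_mul (by positivity),
      ENNReal.ofReal_toReal ht.ne, ENNReal.ofReal_mul (by positivity), ENNReal.ofReal_coe_nnreal,
      mul_pow]
    simp
  rw [lintegral_congr_ae e, lintegral_const_mul'' _ ((aemeasurable_sobN 2 h.meas).pow_const 2)]
  refine ENNReal.mul_lt_top ?_ h.fin
  exact ENNReal.pow_lt_top (ENNReal.mul_lt_top (by norm_num) ENNReal.coe_lt_top)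

end IsVelocity

namespace IsModeSol

variable {T : ℝ} {y₀ : Coef} {U Y F : ℝ → Coef}

theorem lintegral_weighted_lt_top (h : IsModeSol T y₀ Y F) {γ : ℝ → ℝ} (h0 : ∀ t, 0 ≤ γ t) :
    ∫⁻ t in Ioc 0 T, expWeight γ t * sobN (-1) (F t) < ⊤ := by
  refine lt_of_le_of_lt (setLIntegral_mono' measurableSet_Ioc fun t ht => ?_) h.fin
  calc _ ≤ 1 * sobN (-1) (F t) := by gcongr; exact expWeight_le_one h0 ht.1.le
    _ = _ := one_mul _

/-- The energy inequality with zero rate; the weight is then removed by bounding it below by its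
value at the final time. -/
theorem ae_sobN_three_lt_top (h : IsModeSol T y₀ Y F) (hT : 0 ≤ T) (hy : sobN 1 y₀ < ⊤) :
    ∫⁻ t in Ioc 0 T, sobN 3 (Y t) < ⊤ := by
  have hE := h.energy hT (γ := fun _ => 0) (fun _ => le_rfl) (by simp)
  have h1 := le_add_self.trans hE
  simp only [ENNReal.ofReal_zero, zero_mul, zero_add] at h1
  have h2 := h1.trans_lt (ENNReal.add_lt_top.2
    ⟨hy, h.lintegral_weighted_lt_top (γ := fun _ => 0) (fun _ => le_rfl)⟩)
  have h3 : expWeight (fun _ => 0) T * ∫⁻ t in Ioc 0 T, sobN 3 (Y t) < ⊤ := by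
    rw [← lintegral_const_mul'' _ (aemeasurable_sobN 3 (h.aestronglyMeasurable hT))]
    refine lt_of_le_of_lt (setLIntegral_mono' measurableSet_Ioc fun t ht => ?_) h2
    gcongr
    exact expWeight_anti (fun _ => le_rfl) (by simp) ⟨ht.1.le, ht.2⟩
  by_contra hc
  rw [not_lt_top_iff.1 hc, ENNReal.mul_top (expWeight_ne_zero _ _)] at h3
  exact lt_irrefl _ h3

theorem ae_sobN_two_lt_top (h : IsModeSol T y₀ Y F) (hT : 0 ≤ T) (hy : sobN 1 y₀ < ⊤) :
    ∀ᵐ t ∂(volume.restrict (Ioc 0 T)), sobN 2 (Y t) < ⊤ := by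
  filter_upwards [ae_lt_top' (aemeasurable_sobN 3 (h.aestronglyMeasurable hT))
    (h.ae_sobN_three_lt_top hT hy).ne] with t ht
  exact (sobN_mono (by norm_num) _).trans_lt ht

/-- The central estimate: with the rate `growth U`, the left side of the energy inequality dominates
the transport term. It serves the self-map property, the contraction and uniqueness. -/
theorem four_mul_lintegral_transport_le (h : IsModeSol T y₀ Y F) (hT : 0 ≤ T)
    (hU : IsVelocity T U) :
    4 * ∫⁻ t in Ioc 0 T, expWeight (growth U) t * sobN (-1) (transport (U t) (Y t)) ≤
      sobN 1 y₀ + ∫⁻ t in Ioc 0 T, expWeight (growth U) t * sobN (-1) (F t) := by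
  refine le_trans ?_ (le_add_self.trans (h.energy hT (growth_nonneg U) (hU.intervalIntegrable_growth hT)))
  rw [← lintegral_const_mul' _ _ (by norm_num)]
  refine lintegral_mono_ae ?_
  filter_upwards [hU.ae_fin] with t ht
  rw [mul_left_comm]
  gcongr
  exact four_mul_transport_le ht _

end IsModeSol

/-- The transport coefficient is the almost everywhere limit of its finite partial sums, which are
measurable in time. -/
theorem aestronglyMeasurable_transport {μ : Measure ℝ} {U Y : ℝ → Coef}
    (hU : ∀ k i, AEStronglyMeasurable (fun t => U t k i) μ)
    (hY : ∀ k i, AEStronglyMeasurable (fun t => Y t k i) μ)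
    (hUf : ∀ᵐ t ∂μ, sobN 2 (U t) < ⊤) (hYf : ∀ᵐ t ∂μ, sobN 2 (Y t) < ⊤) (k : Freq) (i : Fin 3) :
    AEStronglyMeasurable (fun t => transport (U t) (Y t) k i) μ := by
  refine aestronglyMeasurable_of_tendsto_ae (atTop : Filter (Finset Freq))
    (f := fun s t => ∑ m ∈ s, transportTerm (U t) (Y t) k i m) (fun s => ?_) ?_
  · refine Finset.aestronglyMeasurable_fun_sum _ fun m _ => ?_
    refine Finset.aestronglyMeasurable_fun_sum _ fun j _ => ?_
    exact ((hU m j).mul ((hY (k - m) i).const_mul _)).add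
      ((hY m j).mul ((hU (k - m) j).const_mul _))
  · filter_upwards [hUf, hYf] with t h1 h2
    exact (summable_transportTerm h1 h2 k i).hasSum

/-! ### Existence of a solution of the mode system -/

/-- The Hilbert space of rescaled forcings. -/
abbrev ForcingSpace (T : ℝ) : Type :=
  lp (fun _ : Freq × Fin 3 => Lp ℂ 2 (volume.restrict (Ioc 0 T))) 2

/-- The factor between a forcing and its rescaled version. -/
def forcingScale (γ : ℝ → ℝ) (k : Freq) (t : ℝ) : ℝ :=
  Real.sqrt (jap k) * Real.exp ((∫ s in (0 : ℝ)..t, (γ s + 2)) / 2)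

theorem forcingScale_pos (γ : ℝ → ℝ) (k : Freq) (t : ℝ) : 0 < forcingScale γ k t := by
  have := jap_pos k
  unfold forcingScale
  positivity

/-- The scale undoes both `⟨k⟩^{-1/2}` and the square root of the time weight, so the weighted
`L²(0,T;H^{-1/2})` space is isometric to a plain `ℓ²` sum of `L²` spaces, whose completeness is
available for the fixed point. -/
theorem enorm_forcingScale_sq (γ : ℝ → ℝ) (k : Freq) (t : ℝ) (z : ℂ) :
    ((jap k ^ (-1 : ℤ) : ℝ≥0) : ℝ≥0∞) * (expWeight γ t * ‖(forcingScale γ k t : ℂ) * z‖ₑ ^ 2) =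
      ‖z‖ₑ ^ 2 := by
  have h1 : ‖(forcingScale γ k t : ℂ)‖ₑ ^ 2 =
      ENNReal.ofReal (jap k * Real.exp (∫ s in (0 : ℝ)..t, (γ s + 2))) := by
    rw [← ofReal_norm, Complex.norm_real, Real.norm_of_nonneg (forcingScale_pos γ k t).le,
      ← ENNReal.ofReal_pow (forcingScale_pos γ k t).le, forcingScale, mul_pow,
      Real.sq_sqrt (NNReal.coe_nonneg _), ← Real.exp_nat_mul]
    congr 3
    push_cast
    ring
  have h2 : ((jap k ^ (-1 : ℤ) : ℝ≥0) : ℝ≥0∞) = ENNReal.ofReal ((jap k : ℝ)⁻¹) := by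
    rw [zpow_neg_one, ← NNReal.coe_inv, ENNReal.ofReal_coe_nnreal]
  have h3 : (0 : ℝ) < jap k := NNReal.coe_pos.2 (jap_pos k)
  rw [enorm_mul, mul_pow, h1, h2, expWeight, ← mul_assoc, ← mul_assoc,
    ← ENNReal.ofReal_mul (by positivity), ← ENNReal.ofReal_mul (by positivity)]
  have h4 : (jap k : ℝ)⁻¹ * Real.exp (-∫ s in (0 : ℝ)..t, (γ s + 2)) *
      (jap k * Real.exp (∫ s in (0 : ℝ)..t, (γ s + 2))) = 1 := by
    rw [Real.exp_neg]
    have := Real.exp_pos (∫ s in (0 : ℝ)..t, (γ s + 2))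
    field_simp
  rw [h4, ENNReal.ofReal_one, one_mul]

theorem Lp_enorm_sq {α : Type*} [MeasurableSpace α] {μ : Measure α} (f : Lp ℂ 2 μ) :
    ‖f‖ₑ ^ 2 = ∫⁻ t, ‖f t‖ₑ ^ 2 ∂μ := by
  rw [Lp.enorm_def, eLpNorm_eq_lintegral_rpow_enorm_toReal (by norm_num) (by norm_num),
    ← ENNReal.rpow_natCast, ← ENNReal.rpow_mul]
  norm_num

theorem ForcingSpace.enorm_sq {T : ℝ} (h : ForcingSpace T) :
    ‖h‖ₑ ^ 2 = ∑' p, ∫⁻ t in Ioc 0 T, ‖h p t‖ₑ ^ 2 := by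
  have h1 := lp.hasSum_norm (p := 2) (by norm_num) h
  simp only [ENNReal.toReal_ofNat, Real.rpow_ofNat] at h1
  simp only [← Lp_enorm_sq]
  have hn : ∀ x : ℝ, 0 ≤ x → ENNReal.ofReal x ^ 2 = ENNReal.ofReal (x ^ 2) := fun x hx =>
    (ENNReal.ofReal_pow hx 2).symm
  simp only [← ofReal_norm, hn _ (norm_nonneg _)]
  rw [← ENNReal.ofReal_tsum_of_nonneg (fun p => by positivity) h1.summable, h1.tsum_eq]

/-- `h` is the rescaled version of the forcing `F`. -/
def IsRescaled (T : ℝ) (γ : ℝ → ℝ) (h : ForcingSpace T) (F : ℝ → Coef) : Prop :=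
  ∀ k i, ∀ᵐ t ∂(volume.restrict (Ioc 0 T)), F t k i = (forcingScale γ k t : ℂ) * h (k, i) t

theorem aestronglyMeasurable_forcingScale {T : ℝ} (hT : 0 ≤ T) {γ : ℝ → ℝ}
    (hγ : IntervalIntegrable γ volume 0 T) (k : Freq) :
    AEStronglyMeasurable (fun t => (forcingScale γ k t : ℂ)) (volume.restrict (Ioc 0 T)) := by
  have hi : IntervalIntegrable (fun s => γ s + 2) volume 0 T := hγ.add (by simp)
  have hc : ContinuousOn (fun t => ∫ s in (0 : ℝ)..t, (γ s + 2)) (Ioc 0 T) := by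
    have := (HasACDeriv.of_integral hi 0).continuousOn hT
    simp only [zero_add] at this
    exact this.mono Ioc_subset_Icc_self
  exact (Complex.continuous_ofReal.comp_continuousOn (continuousOn_const.mul
    (Real.continuous_exp.comp_continuousOn (hc.div_const 2)))).aestronglyMeasurable measurableSet_Ioc

namespace IsRescaled

variable {T : ℝ} {γ : ℝ → ℝ} {h h' : ForcingSpace T} {F F' : ℝ → Coef}

theorem meas (H : IsRescaled T γ h F) (hT : 0 ≤ T) (hγ : IntervalIntegrable γ volume 0 T)
    (k : Freq) (i : Fin 3) :
    AEStronglyMeasurable (fun t => F t k i) (volume.restrict (Ioc 0 T)) :=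
  ((aestronglyMeasurable_forcingScale hT hγ k).mul (Lp.aestronglyMeasurable (h (k, i)))).congr
    ((H k i).mono fun _ ht => ht.symm)

theorem lintegral_eq (H : IsRescaled T γ h F) (hT : 0 ≤ T) (hγ : IntervalIntegrable γ volume 0 T) :
    ∫⁻ t in Ioc 0 T, expWeight γ t * sobN (-1) (F t) = ‖h‖ₑ ^ 2 := by
  have hm := H.meas hT hγ
  have hw := aemeasurable_expWeight hT hγ
  rw [lintegral_mul_sobN hw (-1) hm, ForcingSpace.enorm_sq, ENNReal.tsum_prod']
  refine tsum_congr fun k => ?_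
  rw [tsum_fintype, Finset.mul_sum]
  refine Finset.sum_congr rfl fun i _ => ?_
  have hwm : AEMeasurable (fun t => expWeight γ t * ‖F t k i‖ₑ ^ 2) (volume.restrict (Ioc 0 T)) :=
    hw.mul ((hm k i).enorm.pow_const 2)
  rw [← lintegral_const_mul'' _ hwm]
  refine lintegral_congr_ae ?_
  filter_upwards [H k i] with t ht
  rw [ht, enorm_forcingScale_sq]

theorem fin (H : IsRescaled T γ h F) (hT : 0 ≤ T) (h0 : ∀ t, 0 ≤ γ t)
    (hγ : IntervalIntegrable γ volume 0 T) : ∫⁻ t in Ioc 0 T, sobN (-1) (F t) < ⊤ := by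
  have h1 : expWeight γ T * ∫⁻ t in Ioc 0 T, sobN (-1) (F t) < ⊤ := by
    rw [← lintegral_const_mul'' _ (aemeasurable_sobN (-1) (H.meas hT hγ))]
    refine lt_of_le_of_lt (b := ‖h‖ₑ ^ 2) ?_ (ENNReal.pow_lt_top enorm_lt_top)
    rw [← H.lintegral_eq hT hγ]
    refine setLIntegral_mono' measurableSet_Ioc fun t ht => ?_
    gcongr
    exact expWeight_anti h0 hγ ⟨ht.1.le, ht.2⟩
  by_contra hc
  rw [not_lt_top_iff.1 hc, ENNReal.mul_top (expWeight_ne_zero _ _)] at h1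
  exact lt_irrefl _ h1

theorem sub (H : IsRescaled T γ h F) (H' : IsRescaled T γ h' F') :
    IsRescaled T γ (h - h') (fun t => F t - F' t) := fun k i => by
  filter_upwards [H k i, H' k i, Lp.coeFn_sub (h (k, i)) (h' (k, i))] with t h1 h2 h3
  rw [lp.coeFn_sub, Pi.sub_apply, Pi.sub_apply, Pi.sub_apply, h1, h2, h3, Pi.sub_apply]
  ring

theorem exists_of_forcing (hT : 0 ≤ T) (hγ : IntervalIntegrable γ volume 0 T)
    (hm : ∀ k i, AEStronglyMeasurable (fun t => F t k i) (volume.restrict (Ioc 0 T)))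
    (hf : ∫⁻ t in Ioc 0 T, expWeight γ t * sobN (-1) (F t) < ⊤) :
    ∃ h : ForcingSpace T, IsRescaled T γ h F := by
  have hsc := fun k => aestronglyMeasurable_forcingScale hT hγ k
  have hw := aemeasurable_expWeight hT hγ
  let q : Freq × Fin 3 → ℝ → ℂ := fun p t => (forcingScale γ p.1 t : ℂ)⁻¹ * F t p.1 p.2
  have hq : ∀ p t, (forcingScale γ p.1 t : ℂ) * q p t = F t p.1 p.2 := fun p t => by
    have : (forcingScale γ p.1 t : ℂ) ≠ 0 := by exact_mod_cast (forcingScale_pos γ p.1 t).ne'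
    simp only [q]
    field_simp
  have hqm : ∀ p, AEStronglyMeasurable (q p) (volume.restrict (Ioc 0 T)) := fun p =>
    (hsc p.1).inv₀.mul (hm p.1 p.2)
  have hs : ∑' p, ∫⁻ t in Ioc 0 T, ‖q p t‖ₑ ^ 2 < ⊤ := by
    refine lt_of_le_of_lt (le_of_eq ?_) hf
    rw [lintegral_mul_sobN hw (-1) hm, ENNReal.tsum_prod']
    refine tsum_congr fun k => ?_
    rw [tsum_fintype, Finset.mul_sum]
    refine Finset.sum_congr rfl fun i _ => ?_
    have hwm : AEMeasurable (fun t => expWeight γ t * ‖F t k i‖ₑ ^ 2) (volume.restrict (Ioc 0 T)) :=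
      hw.mul ((hm k i).enorm.pow_const 2)
    rw [← lintegral_const_mul'' _ hwm]
    refine lintegral_congr fun t => ?_
    rw [← hq (k, i) t, enorm_forcingScale_sq]
  have hL : ∀ p, MemLp (q p) 2 (volume.restrict (Ioc 0 T)) := fun p => by
    refine ⟨hqm p, ?_⟩
    rw [eLpNorm_lt_top_iff_lintegral_rpow_enorm_lt_top (by norm_num) (by norm_num)]
    simpa using (ENNReal.le_tsum p).trans_lt hs
  have hn : ∀ p, ‖(hL p).toLp‖ₑ ^ 2 = ∫⁻ t in Ioc 0 T, ‖q p t‖ₑ ^ 2 := fun p => by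
    rw [Lp_enorm_sq]
    refine lintegral_congr_ae ?_
    filter_upwards [(hL p).coeFn_toLp] with t ht
    rw [ht]
  have hM : Memℓp (fun p => (hL p).toLp) 2 := by
    rw [memℓp_gen_iff (by norm_num)]
    simp only [← hn] at hs
    have := ENNReal.summable_toReal hs.ne
    simpa using this
  refine ⟨⟨_, hM⟩, fun k i => ?_⟩
  filter_upwards [(hL (k, i)).coeFn_toLp] with t ht
  rw [← hq (k, i) t, ← ht]

end IsRescaled

/-- The fixed point is sought among forcings rather than solutions: each forcing `h` determines `Y
h` by explicit integration, and `Φ h` is the rescaled transport term of `Y h`. -/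
theorem exists_isModeSol_transport {T : ℝ} (hT : 0 ≤ T) {U : ℝ → Coef} (hU : IsVelocity T U)
    {y₀ : Coef} (hy : sobN 1 y₀ < ⊤) :
    ∃ Y F : ℝ → Coef, IsModeSol T y₀ Y F ∧
      ∀ᵐ t ∂(volume.restrict (Ioc 0 T)), F t = transport (U t) (Y t) := by
  set γ := growth U with hγdef
  have h0 := growth_nonneg U
  have hγ := hU.intervalIntegrable_growth hT
  let F : ForcingSpace T → ℝ → Coef := fun h t k i => (forcingScale γ k t : ℂ) * h (k, i) t
  have hF : ∀ h, IsRescaled T γ h (F h) := fun h k i => Eventually.of_forall fun t => rfl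
  choose Y hY using fun h => IsModeSol.exists_of_forcing hT y₀ ((hF h).meas hT hγ)
    ((hF h).fin hT h0 hγ)
  have hYf := fun h => (hY h).ae_sobN_two_lt_top hT hy
  have hex : ∀ h, ∃ h' : ForcingSpace T, IsRescaled T γ h' (fun t => transport (U t) (Y h t)) :=
    fun h => by
      refine IsRescaled.exists_of_forcing hT hγ (aestronglyMeasurable_transport hU.meas
        ((hY h).aestronglyMeasurable hT) hU.ae_fin (hYf h)) ?_
      have h1 := (hY h).four_mul_lintegral_transport_le hT hU
      have h2 := h1.trans_lt (ENNReal.add_lt_top.2 ⟨hy, (hY h).lintegral_weighted_lt_top h0⟩)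
      by_contra hc
      rw [not_lt_top_iff.1 hc] at h2
      simp at h2
  choose Φ hΦ using hex
  -- The difference of two solutions has zero initial data and the difference of the forcings as its
  -- forcing, so the central estimate gives `4‖Φ h - Φ h'‖² ≤ ‖h - h'‖²`.
  have hcontr : ContractingWith (1 / 2) Φ := by
    refine ⟨by norm_num [← NNReal.coe_lt_coe], fun h h' => ?_⟩
    have hd := (hY h).sub (hY h')
    have h1 := hd.four_mul_lintegral_transport_le hT hU
    have e1 : ∫⁻ t in Ioc 0 T, expWeight γ t * sobN (-1) (transport (U t) (Y h t - Y h' t)) =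
        ‖Φ h - Φ h'‖ₑ ^ 2 := by
      rw [← ((hΦ h).sub (hΦ h')).lintegral_eq hT hγ]
      refine lintegral_congr_ae ?_
      filter_upwards [hU.ae_fin, hYf h, hYf h'] with t ht ht1 ht2
      rw [transport_sub ht ht1 ht2]
    rw [e1, ((hF h).sub (hF h')).lintegral_eq hT hγ] at h1
    have e0 : sobN 1 (y₀ - y₀) = 0 := by simp [sobN]
    rw [e0, zero_add, show (4 : ℝ≥0∞) = 2 ^ 2 by norm_num, ← mul_pow,
      ENNReal.pow_le_pow_left_iff two_ne_zero] at h1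
    rw [edist_eq_enorm_sub, edist_eq_enorm_sub]
    have e2 : ((1 / 2 : ℝ≥0) : ℝ≥0∞) = 2⁻¹ := by
      rw [one_div, ENNReal.coe_inv two_ne_zero]; rfl
    rw [e2, ← ENNReal.div_eq_inv_mul, ENNReal.le_div_iff_mul_le (by simp) (by simp), mul_comm]
    exact h1
  have : Nonempty (ForcingSpace T) := ⟨0⟩
  let h := ContractingWith.fixedPoint Φ hcontr
  have hfix : Φ h = h := hcontr.fixedPoint_isFixedPt
  refine ⟨Y h, F h, hY h, ?_⟩
  -- There are countably many pairs `(k, i)`, so the exceptional null sets can be merged before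
  -- comparing whole families.
  have hall : ∀ᵐ t ∂(volume.restrict (Ioc 0 T)), ∀ k i, transport (U t) (Y h t) k i =
      (forcingScale γ k t : ℂ) * Φ h (k, i) t := by
    rw [ae_all_iff]
    intro k
    rw [ae_all_iff]
    exact fun i => hΦ h k i
  filter_upwards [hall] with t ht
  ext k i
  rw [ht k i, hfix]

/-! ### Uniqueness for the mode system. -/

/-- With zero data the central estimate reads `4I ≤ I` for the weighted forcing integral `I`, which
is finite; hence `I = 0`, and the energy inequality leaves nothing for the state at time `T`. -/
theorem IsModeSol.eq_zero_of_transport {T : ℝ} (hT : 0 ≤ T) {U : ℝ → Coef} (hU : IsVelocity T U)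
    {Y F : ℝ → Coef} (h : IsModeSol T 0 Y F)
    (hF : ∀ᵐ t ∂(volume.restrict (Ioc 0 T)), F t = transport (U t) (Y t)) : Y T = 0 := by
  have h0 := growth_nonneg U
  have hγ := hU.intervalIntegrable_growth hT
  have h1 := h.four_mul_lintegral_transport_le hT hU
  have e : ∫⁻ t in Ioc 0 T, expWeight (growth U) t * sobN (-1) (transport (U t) (Y t)) =
      ∫⁻ t in Ioc 0 T, expWeight (growth U) t * sobN (-1) (F t) := by
    refine lintegral_congr_ae ?_
    filter_upwards [hF] with t ht
    rw [ht]
  have z0 : sobN 1 (0 : Coef) = 0 := by simp [sobN]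
  rw [e, z0, zero_add] at h1
  have h2 := h.lintegral_weighted_lt_top h0
  have h3 : ∫⁻ t in Ioc 0 T, expWeight (growth U) t * sobN (-1) (F t) = 0 := by
    by_contra hne
    have h4 : 1 * ∫⁻ t in Ioc 0 T, expWeight (growth U) t * sobN (-1) (F t) <
        4 * ∫⁻ t in Ioc 0 T, expWeight (growth U) t * sobN (-1) (F t) :=
      (ENNReal.mul_lt_mul_iff_left hne h2.ne).2 (by norm_num)
    rw [one_mul] at h4
    exact absurd h1 (not_le.2 h4)
  have h5 := le_self_add.trans (h.energy hT h0 hγ)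
  rw [h3, z0, zero_add, nonpos_iff_eq_zero, mul_eq_zero, or_iff_right (expWeight_ne_zero _ _)] at h5
  ext k i
  have h6 := enorm_sq_le_sobN (n := 1) (by norm_num) (Y T) k i
  rw [h5] at h6
  simpa using h6

/-! ### Fields in `L^∞(0,T;H^{1/2}) ∩ L²(0,T;H^{3/2})` -/

theorem restrict_Ioo_eq_Ioc (T : ℝ) :
    (volume : Measure ℝ).restrict (Ioo 0 T) = volume.restrict (Ioc 0 T) :=
  Measure.restrict_congr_set Ioo_ae_eq_Ioc

theorem MemLpH.aestronglyMeasurable_coeff {p : ℝ≥0∞} {T s : ℝ} {u : ℝ → L2} (hu : MemLpH p T s u)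
    (k : Freq) (i : Fin 3) :
    AEStronglyMeasurable (fun t => coeff (u t) k i) (volume.restrict (Ioc 0 T)) := by
  rw [← restrict_Ioo_eq_Ioc]
  exact (continuous_coeff k i).comp_aestronglyMeasurable hu.1

theorem MemLpH.exists_bound {T : ℝ} {u : ℝ → L2} (hu : MemLpH ⊤ T (1 / 2) u) :
    ∃ C : ℝ≥0∞, C < ⊤ ∧ ∀ᵐ t ∂(volume.restrict (Ioc 0 T)), sobN 1 (coeff (u t)) ≤ C := by
  have h := hu.2.2
  rw [eLpNorm_exponent_top, restrict_Ioo_eq_Ioc] at h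
  refine ⟨_, ENNReal.pow_lt_top (n := 2) h, ?_⟩
  filter_upwards [ae_le_eLpNormEssSup (f := fun t => hNorm (1 / 2) (u t))
    (μ := volume.restrict (Ioc 0 T))] with t ht
  refine (sobN_one_le (u t)).trans ?_
  gcongr
  simpa using ht

theorem MemLpH.lintegral_sobN_three {T : ℝ} {u : ℝ → L2} (hu : MemLpH 2 T (3 / 2) u) :
    ∫⁻ t in Ioc 0 T, sobN 3 (coeff (u t)) < ⊤ := by
  have h := hu.2.2
  rw [eLpNorm_lt_top_iff_lintegral_rpow_enorm_lt_top (by norm_num) (by norm_num),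
    restrict_Ioo_eq_Ioc] at h
  simp only [ENNReal.toReal_ofNat, ENNReal.rpow_ofNat, enorm_eq_self] at h
  refine (lintegral_mono fun t => sobN_three_le (u t)).trans_lt ?_
  rw [lintegral_const_mul' _ _ (by norm_num)]
  exact ENNReal.mul_lt_top (by norm_num) h

/-- Interpolation: `‖u‖⁴_{H¹} ≤ ‖u‖²_{H^{1/2}} ‖u‖²_{H^{3/2}}`, with the first factor bounded and
the second integrable in time. -/
theorem isVelocity_of_memLpH {T : ℝ} {u : ℝ → L2} (hu : MemLpH ⊤ T (1 / 2) u)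
    (hu' : MemLpH 2 T (3 / 2) u) : IsVelocity T fun t => coeff (u t) := by
  refine ⟨hu.aestronglyMeasurable_coeff, ?_⟩
  obtain ⟨C, hC, hb⟩ := hu.exists_bound
  calc ∫⁻ t in Ioc 0 T, sobN 2 (coeff (u t)) ^ 2
      ≤ ∫⁻ t in Ioc 0 T, C * sobN 3 (coeff (u t)) := by
        refine lintegral_mono_ae ?_
        filter_upwards [hb] with t ht
        refine (sobN_two_sq_le _).trans ?_
        gcongr
    _ = C * ∫⁻ t in Ioc 0 T, sobN 3 (coeff (u t)) := lintegral_const_mul' _ _ hC.ne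
    _ < ⊤ := ENNReal.mul_lt_top hC hu'.lintegral_sobN_three

/-! ### Reality and time regularity of the solution of the mode system -/

theorem HasACDeriv.conj {T : ℝ} {f f' : ℝ → ℂ} (h : HasACDeriv T f f') :
    HasACDeriv T (fun t => conj (f t)) (fun t => conj (f' t)) :=
  ⟨h.ac.of_dist_le fun x _ y _ => by rw [dist_eq_norm, dist_eq_norm, ← map_sub, RCLike.norm_conj],
    by
      filter_upwards [h.ae_deriv] with x hx hT
      exact (Complex.conjCLE.toContinuousLinearMap.hasFDerivAt.comp_hasDerivAt x (hx hT))⟩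

namespace IsModeSol

variable {T : ℝ} {y₀ : Coef} {U Y F : ℝ → Coef}

theorem reflect (h : IsModeSol T y₀ Y F) :
    IsModeSol T (reflect y₀) (fun t => Magnetization.reflect (Y t))
      (fun t => Magnetization.reflect (F t)) where
  deriv k i := (h.deriv (-k) i).conj.congr_deriv (Eventually.of_forall fun t _ => by
    simp only [Magnetization.reflect, map_sub, map_mul, map_neg, Complex.conj_ofReal, jap_neg])
  init k i := by simp [Magnetization.reflect, h.init]
  meas k i := Complex.continuous_conj.comp_aestronglyMeasurable (h.meas (-k) i)
  fin := by simpa only [sobN_reflect] using h.fin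

/-- For a real velocity and real data, the conjugate solves the same system; the difference vanishes
by uniqueness on `[0,t]`. Hence the coefficients belong to a real field. -/
theorem reflect_eq (h : IsModeSol T y₀ Y F) (hT : 0 ≤ T) (hy : sobN 1 y₀ < ⊤)
    (hU : IsVelocity T U) (hUr : ∀ t, Magnetization.reflect (U t) = U t)
    (hyr : Magnetization.reflect y₀ = y₀)
    (hF : ∀ᵐ t ∂(volume.restrict (Ioc 0 T)), F t = transport (U t) (Y t)) {t : ℝ}
    (ht : t ∈ Icc 0 T) : Magnetization.reflect (Y t) = Y t := by
  have hd := h.reflect.sub h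
  rw [hyr, sub_self] at hd
  have hF' : ∀ᵐ t ∂(volume.restrict (Ioc 0 T)), Magnetization.reflect (F t) - F t =
      transport (U t) (Magnetization.reflect (Y t) - Y t) := by
    filter_upwards [hF, hU.ae_fin, h.ae_sobN_two_lt_top hT hy] with t h1 h2 h3
    rw [transport_sub h2 (by rwa [sobN_reflect]) h3, h1, ← transport_reflect, hUr]
  have := (hd.mono ht).eq_zero_of_transport ht.1 (hU.mono ht.2)
    (ae_restrict_of_ae_restrict_of_subset (Ioc_subset_Ioc_right ht.2) hF')
  exact sub_eq_zero.1 this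

/-- A time independent majorant of the squared coefficients. -/
def majorant (T : ℝ) (y₀ : Coef) (F : ℝ → Coef) (k : Freq) (i : Fin 3) : ℝ≥0∞ :=
  (expWeight (fun _ => 0) T)⁻¹ * (‖y₀ k i‖ₑ ^ 2 +
    ((jap k ^ (-2 : ℤ) : ℝ≥0) : ℝ≥0∞) * ∫⁻ t in Ioc 0 T, ‖F t k i‖ₑ ^ 2)

/-- The mode energy inequality on `[0,t]` with `g = 0`, keeping only the endpoint term and enlarging
the forcing integral to `[0,T]`. -/
theorem enorm_sq_le_majorant (h : IsModeSol T y₀ Y F) {t : ℝ} (ht : t ∈ Icc 0 T) (k : Freq)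
    (i : Fin 3) : ‖Y t k i‖ₑ ^ 2 ≤ majorant T y₀ F k i := by
  have ht' := h.mono ht
  have hE := mode_energy ht.1 (NNReal.coe_pos.2 (jap_pos k)) (ht'.deriv k i) (g := fun _ => 0)
    (by simp) (fun _ => le_rfl) (ht'.meas k i) (lintegral_mode_lt_top ht'.meas ht'.fin k i)
  have h1 := le_self_add.trans hE
  rw [majorant, ← ENNReal.div_eq_inv_mul,
    ENNReal.le_div_iff_mul_le (Or.inl (expWeight_ne_zero _ _)) (Or.inl (expWeight_ne_top _ _)),
    mul_comm]
  calc expWeight (fun _ => 0) T * ‖Y t k i‖ₑ ^ 2 ≤ expWeight (fun _ => 0) t * ‖Y t k i‖ₑ ^ 2 := by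
        gcongr
        exact expWeight_anti (fun _ => le_rfl) (by simp) ht
    _ ≤ _ := h1
    _ ≤ _ := by
      rw [h.init]
      have e : ((jap k ^ (-2 : ℤ) : ℝ≥0) : ℝ≥0∞) = ENNReal.ofReal ((jap k : ℝ) ^ 2)⁻¹ := by
        rw [← NNReal.coe_pow, ← NNReal.coe_inv, ENNReal.ofReal_coe_nnreal, zpow_neg, zpow_ofNat]
      rw [e, ← lintegral_const_mul' _ _ ENNReal.ofReal_ne_top]
      refine add_le_add le_rfl ((lintegral_mono_set (Ioc_subset_Ioc_right ht.2)).trans ?_)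
      refine setLIntegral_mono' measurableSet_Ioc fun s hs => ?_
      calc _ ≤ 1 * (ENNReal.ofReal ((jap k : ℝ) ^ 2)⁻¹ * ‖F s k i‖ₑ ^ 2) := by
            gcongr
            exact expWeight_le_one (γ := fun _ => 0) (fun _ => le_rfl) hs.1.le
        _ = _ := one_mul _

/-- The weight `⟨k⟩` turns `⟨k⟩⁻²` into `⟨k⟩⁻¹`, so the sum is a multiple of the initial `H^{1/2}`
norm plus the `L²(0,T;H^{-1/2})` norm of the forcing, both squared. -/
theorem tsum_majorant_lt_top (h : IsModeSol T y₀ Y F) (hy : sobN 1 y₀ < ⊤) :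
    ∑' k, ((jap k ^ (1 : ℤ) : ℝ≥0) : ℝ≥0∞) * ∑ i, majorant T y₀ F k i < ⊤ := by
  have h1 := lintegral_mul_sobN (c := fun _ => 1) aemeasurable_const (-1) h.meas
  simp only [one_mul] at h1
  have e : ∀ k, ((jap k ^ (1 : ℤ) : ℝ≥0) : ℝ≥0∞) * ∑ i, majorant T y₀ F k i =
      (expWeight (fun _ => 0) T)⁻¹ * (((jap k ^ (1 : ℤ) : ℝ≥0) : ℝ≥0∞) * ∑ i, ‖y₀ k i‖ₑ ^ 2 +
        ((jap k ^ (-1 : ℤ) : ℝ≥0) : ℝ≥0∞) * ∑ i, ∫⁻ t in Ioc 0 T, ‖F t k i‖ₑ ^ 2) := fun k => by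
    have e1 : ((jap k ^ (-1 : ℤ) : ℝ≥0) : ℝ≥0∞) =
        ((jap k ^ (1 : ℤ) : ℝ≥0) : ℝ≥0∞) * ((jap k ^ (-2 : ℤ) : ℝ≥0) : ℝ≥0∞) := by
      rw [← ENNReal.coe_mul, ← zpow_add₀ (jap_ne_zero k)]
      norm_num
    simp only [majorant]
    rw [e1, ← Finset.mul_sum, Finset.sum_add_distrib, ← Finset.mul_sum]
    ring
  simp only [e]
  rw [ENNReal.tsum_mul_left, ENNReal.tsum_add, ← h1]
  exact ENNReal.mul_lt_top (ENNReal.inv_lt_top.2 (pos_iff_ne_zero.2 (expWeight_ne_zero _ _)))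
    (ENNReal.add_lt_top.2 ⟨hy, h.fin⟩)

theorem sobN_one_le (h : IsModeSol T y₀ Y F) {t : ℝ} (ht : t ∈ Icc 0 T) :
    sobN 1 (Y t) ≤ ∑' k, ((jap k ^ (1 : ℤ) : ℝ≥0) : ℝ≥0∞) * ∑ i, majorant T y₀ F k i := by
  unfold sobN
  gcongr with k i
  exact h.enorm_sq_le_majorant ht k i

/-- Each mode is continuous in time, and the summable majorant allows dominated convergence over the
frequencies. -/
theorem tendsto_sobN_sub (h : IsModeSol T y₀ Y F) (hy : sobN 1 y₀ < ⊤) {t₀ : ℝ}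
    (ht₀ : t₀ ∈ Icc 0 T) :
    Tendsto (fun t => sobN 1 (Y t - Y t₀)) (𝓝[Icc 0 T] t₀) (𝓝 0) := by
  have hT : 0 ≤ T := ht₀.1.trans ht₀.2
  let _ : MeasurableSpace Freq := ⊤
  have key := tendsto_lintegral_filter_of_dominated_convergence (μ := (Measure.count : Measure Freq))
    (l := 𝓝[Icc 0 T] t₀)
    (F := fun t k => ((jap k ^ (1 : ℤ) : ℝ≥0) : ℝ≥0∞) * ∑ i, ‖(Y t - Y t₀) k i‖ₑ ^ 2) (f := fun _ => 0)
    -- The factor `4` comes from `|a - b|² ≤ 2(|a|² + |b|²)` with both squares below the majorant.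
    (fun k => 4 * (((jap k ^ (1 : ℤ) : ℝ≥0) : ℝ≥0∞) * ∑ i, majorant T y₀ F k i))
    (Eventually.of_forall fun t => measurable_from_top) ?_ ?_ ?_
  · simpa only [lintegral_count' measurable_from_top, tsum_zero] using! key
  · filter_upwards [self_mem_nhdsWithin] with t ht
    refine Eventually.of_forall fun k => ?_
    rw [mul_left_comm, Finset.mul_sum _ _ (4 : ℝ≥0∞)]
    refine mul_le_mul_right (Finset.sum_le_sum fun i _ => ?_) _
    calc ‖(Y t - Y t₀) k i‖ₑ ^ 2 ≤ (‖Y t k i‖ₑ + ‖Y t₀ k i‖ₑ) ^ 2 := by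
          gcongr; exact enorm_sub_le
      _ ≤ 2 * (‖Y t k i‖ₑ ^ 2 + ‖Y t₀ k i‖ₑ ^ 2) := add_sq_le _ _
      _ ≤ 2 * (majorant T y₀ F k i + majorant T y₀ F k i) := by
        gcongr
        · exact h.enorm_sq_le_majorant ht k i
        · exact h.enorm_sq_le_majorant ht₀ k i
      _ = _ := by ring
  · rw [lintegral_count' measurable_from_top, ENNReal.tsum_mul_left]
    exact (ENNReal.mul_lt_top (by norm_num) (h.tsum_majorant_lt_top hy)).ne
  · refine Eventually.of_forall fun k => ?_
    have h1 : ∀ i, Tendsto (fun t => ‖(Y t - Y t₀) k i‖ₑ ^ 2) (𝓝[Icc 0 T] t₀) (𝓝 0) := fun i => by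
      have h2 : Tendsto (fun t => Y t k i - Y t₀ k i) (𝓝[Icc 0 T] t₀) (𝓝 (Y t₀ k i - Y t₀ k i)) :=
        ((h.deriv k i).continuousOn hT t₀ ht₀).sub tendsto_const_nhds
      have h3 := ((ENNReal.continuous_pow 2).tendsto _).comp h2.enorm
      simpa [Function.comp_def] using h3
    have h4 := ENNReal.Tendsto.const_mul (a := ((jap k ^ (1 : ℤ) : ℝ≥0) : ℝ≥0∞))
      (tendsto_finsetSum Finset.univ fun i _ => h1 i) (Or.inr ENNReal.coe_ne_top)
    simpa using h4

end IsModeSol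

/-! ### Assembling the vector field -/

theorem memH_half_iff {f : L2} : MemH (1 / 2) f ↔ sobN 1 (coeff f) < ⊤ := by
  constructor
  · intro h
    exact (sobN_one_le f).trans_lt (ENNReal.pow_lt_top h)
  · intro h
    have h1 := (hNorm_half_sq_le f).trans_lt (ENNReal.mul_lt_top (by norm_num) h)
    by_contra hc
    rw [MemH, not_lt_top_iff] at hc
    rw [hc] at h1
    simp at h1

theorem continuousIntoH_of_coeff {T : ℝ} {y₀ : Coef} {Y F : ℝ → Coef} (h : IsModeSol T y₀ Y F)
    (hy : sobN 1 y₀ < ⊤) {w : ℝ → L2} (hw : ∀ t ∈ Icc 0 T, coeff (w t) = Y t) :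
    ContinuousIntoH T (1 / 2) w := by
  refine ⟨fun t ht => memH_half_iff.2 ?_, fun t₀ ht₀ => ?_⟩
  · rw [hw t ⟨ht.1, ht.2.le⟩]
    exact (h.sobN_one_le ⟨ht.1, ht.2.le⟩).trans_lt (h.tsum_majorant_lt_top hy)
  · have ht₀' : t₀ ∈ Icc 0 T := ⟨ht₀.1, ht₀.2.le⟩
    have h1 := (h.tendsto_sobN_sub hy ht₀').mono_left (nhdsWithin_mono _ Ico_subset_Icc_self)
    have h2 : Tendsto (fun t => (2 * sobN 1 (Y t - Y t₀)) ^ (1 / 2 : ℝ)) (𝓝[Ico 0 T] t₀) (𝓝 0) := by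
      have := (ENNReal.Tendsto.const_mul (a := 2) h1 (Or.inr (by norm_num))).ennrpow_const (1 / 2 : ℝ)
      simpa using this
    refine tendsto_of_tendsto_of_tendsto_of_le_of_le' tendsto_const_nhds h2
      (Eventually.of_forall fun _ => zero_le) ?_
    filter_upwards [self_mem_nhdsWithin] with t ht
    have h3 := hNorm_half_sq_le (w t - w t₀)
    rw [coeff_sub, hw t ⟨ht.1, ht.2.le⟩, hw t₀ ht₀'] at h3
    calc hNorm (1 / 2) (w t - w t₀) = (hNorm (1 / 2) (w t - w t₀) ^ 2) ^ (1 / 2 : ℝ) := by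
          rw [← ENNReal.rpow_natCast, ← ENNReal.rpow_mul]; norm_num
      _ ≤ _ := by gcongr

/-- Continuity into `L²` provides the strong measurability required by `MemLpH`. -/
theorem continuousOn_of_coeff {T : ℝ} {y₀ : Coef} {Y F : ℝ → Coef} (h : IsModeSol T y₀ Y F)
    (hy : sobN 1 y₀ < ⊤) {w : ℝ → L2} (hw : ∀ t ∈ Icc 0 T, coeff (w t) = Y t) :
    ContinuousOn w (Icc 0 T) := by
  intro t₀ ht₀
  have hv : (ENNReal.ofReal vol⁻¹) ≠ 0 := by simpa using vol_pos
  have h1 := h.tendsto_sobN_sub hy ht₀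
  have h2 : Tendsto (fun t => ((ENNReal.ofReal vol⁻¹)⁻¹ * sobN 1 (Y t - Y t₀)) ^ (1 / 2 : ℝ))
      (𝓝[Icc 0 T] t₀) (𝓝 0) := by
    have := (ENNReal.Tendsto.const_mul (a := (ENNReal.ofReal vol⁻¹)⁻¹) h1
      (Or.inr (ENNReal.inv_ne_top.2 hv))).ennrpow_const (1 / 2 : ℝ)
    simpa using this
  rw [ContinuousWithinAt, tendsto_iff_edist_tendsto_0]
  refine tendsto_of_tendsto_of_tendsto_of_le_of_le' tendsto_const_nhds h2
    (Eventually.of_forall fun _ => zero_le) ?_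
  filter_upwards [self_mem_nhdsWithin] with t ht
  have h3 := (sobN_zero_coeff (w t - w t₀)).ge.trans (sobN_mono (by norm_num : (0 : ℤ) ≤ 1) _)
  rw [coeff_sub, hw t ht, hw t₀ ht₀] at h3
  rw [edist_eq_enorm_sub]
  calc ‖w t - w t₀‖ₑ = (‖w t - w t₀‖ₑ ^ 2) ^ (1 / 2 : ℝ) := by
        rw [← ENNReal.rpow_natCast, ← ENNReal.rpow_mul]; norm_num
    _ ≤ _ := by
      gcongr
      rw [mul_comm _ (sobN _ _), ← ENNReal.div_eq_inv_mul.trans (mul_comm _ _),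
        ENNReal.le_div_iff_mul_le (Or.inl hv) (Or.inl ENNReal.ofReal_ne_top), mul_comm]
      exact h3

theorem memLpH_of_coeff {T : ℝ} (hT : 0 ≤ T) {y₀ : Coef} {Y F : ℝ → Coef} (h : IsModeSol T y₀ Y F)
    (hy : sobN 1 y₀ < ⊤) {w : ℝ → L2} (hw : ∀ t ∈ Icc 0 T, coeff (w t) = Y t) :
    MemLpH ⊤ T (1 / 2) w ∧ MemLpH 2 T (3 / 2) w := by
  have hm : AEStronglyMeasurable w (volume.restrict (Ioo 0 T)) :=
    ((continuousOn_of_coeff h hy hw).mono Ioo_subset_Icc_self).aestronglyMeasurable measurableSet_Ioo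
  have hIoo : ∀ᵐ t ∂(volume.restrict (Ioo 0 T)), t ∈ Ioo 0 T := ae_restrict_mem measurableSet_Ioo
  have hM := h.tsum_majorant_lt_top hy
  set M := ∑' k, ((jap k ^ (1 : ℤ) : ℝ≥0) : ℝ≥0∞) * ∑ i, IsModeSol.majorant T y₀ F k i with hMdef
  have h3 := h.ae_sobN_three_lt_top hT hy
  rw [← restrict_Ioo_eq_Ioc] at h3
  have h3' : ∫⁻ t in Ioo 0 T, hNorm (3 / 2) (w t) ^ 2 < ⊤ := by
    refine lt_of_le_of_lt (b := ∫⁻ t in Ioo 0 T, 2 * sobN 3 (Y t)) (lintegral_mono_ae ?_) ?_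
    · filter_upwards [hIoo] with t ht
      rw [← hw t ⟨ht.1.le, ht.2.le⟩]
      exact hNorm_three_half_sq_le _
    · rw [lintegral_const_mul' _ _ (by norm_num)]
      exact ENNReal.mul_lt_top (by norm_num) h3
  refine ⟨⟨hm, ?_, ?_⟩, ⟨hm, ?_, ?_⟩⟩
  · filter_upwards [hIoo] with t ht
    rw [memH_half_iff, hw t ⟨ht.1.le, ht.2.le⟩]
    exact (h.sobN_one_le ⟨ht.1.le, ht.2.le⟩).trans_lt hM
  · rw [eLpNorm_exponent_top]
    refine lt_of_le_of_lt (b := (2 * M) ^ (1 / 2 : ℝ)) (eLpNormEssSup_le_of_ae_enorm_bound ?_)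
      (ENNReal.rpow_lt_top_of_nonneg (by norm_num) (ENNReal.mul_lt_top (by norm_num) hM).ne)
    filter_upwards [hIoo] with t ht
    have ht' : t ∈ Icc 0 T := ⟨ht.1.le, ht.2.le⟩
    have h4 := hNorm_half_sq_le (w t)
    rw [hw t ht'] at h4
    rw [enorm_eq_self]
    calc hNorm (1 / 2) (w t) = (hNorm (1 / 2) (w t) ^ 2) ^ (1 / 2 : ℝ) := by
          rw [← ENNReal.rpow_natCast, ← ENNReal.rpow_mul]; norm_num
      _ ≤ (2 * M) ^ (1 / 2 : ℝ) := by
        gcongr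
        refine h4.trans ?_
        gcongr
        exact h.sobN_one_le ht'
  · have hmY : AEMeasurable (fun t => sobN 3 (Y t)) (volume.restrict (Ioo 0 T)) := by
      rw [restrict_Ioo_eq_Ioc]
      exact aemeasurable_sobN 3 (h.aestronglyMeasurable hT)
    filter_upwards [hIoo, ae_lt_top' hmY h3.ne] with t ht h5
    have h6 := hNorm_three_half_sq_le (w t)
    rw [hw t ⟨ht.1.le, ht.2.le⟩] at h6
    have h7 := h6.trans_lt (ENNReal.mul_lt_top (by norm_num) h5)
    by_contra hc
    rw [MemH, not_lt_top_iff] at hc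
    rw [hc] at h7
    simp at h7
  · rw [eLpNorm_lt_top_iff_lintegral_rpow_enorm_lt_top (by norm_num) (by norm_num)]
    simpa using h3'

/-! ### Smooth functions of time and space -/

/-- Joint smoothness of a time dependent function on the torus. -/
def SmoothFamily (g : ℝ → Torus → ℝ) : Prop :=
  ContDiff ℝ ∞ fun p : ℝ × (Fin 3 → ℝ) => g p.1 (proj p.2)

namespace SmoothFamily

variable {g : ℝ → Torus → ℝ}

theorem contDiff_slice (hg : SmoothFamily g) (s : ℝ) : ContDiff ℝ ∞ fun y => g s (proj y) :=
  ContDiff.comp (g := fun p : ℝ × (Fin 3 → ℝ) => g p.1 (proj p.2)) hg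
    (contDiff_const.prodMk contDiff_id)

theorem continuous (hg : SmoothFamily g) : Continuous (Function.uncurry g) := by
  have hq : IsOpenQuotientMap (Prod.map (id : ℝ → ℝ) proj) :=
    IsOpenQuotientMap.id.prodMap isOpenQuotientMap_proj
  exact hq.isQuotientMap.continuous_iff.2 (ContDiff.continuous hg)

theorem continuous_slice (hg : SmoothFamily g) (s : ℝ) : Continuous (g s) :=
  hg.continuous.comp (Continuous.prodMk_right s)

theorem memLp (hg : SmoothFamily g) (s : ℝ) (p : ℝ≥0∞) :
    MemLp (fun x => (g s x : ℂ)) p volume :=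
  Torus.memLp_of_continuous (Complex.continuous_ofReal.comp (hg.continuous_slice s)) p

theorem exists_bound (hg : SmoothFamily g) (a b : ℝ) :
    ∃ C : ℝ, ∀ s ∈ Icc a b, ∀ x, |g s x| ≤ C := by
  obtain ⟨C, hC⟩ := (isCompact_Icc.prod (isCompact_univ : IsCompact (univ : Set Torus))
    ).exists_bound_of_continuousOn (s := Icc a b ×ˢ univ) hg.continuous.continuousOn
  exact ⟨C, fun s hs x => hC (s, x) ⟨hs, mem_univ _⟩⟩

theorem hasDerivAt_proj (hg : SmoothFamily g) (s : ℝ) (y : Fin 3 → ℝ) :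
    HasDerivAt (fun r => g r (proj y))
      (fderiv ℝ (fun p : ℝ × (Fin 3 → ℝ) => g p.1 (proj p.2)) (s, y) (1, 0)) s := by
  have h1 : HasFDerivAt (fun p : ℝ × (Fin 3 → ℝ) => g p.1 (proj p.2)) _ (s, y) :=
    (ContDiff.differentiable hg (by simp) (s, y)).hasFDerivAt
  have h2 : HasDerivAt (fun r : ℝ => (r, y)) ((1 : ℝ), (0 : Fin 3 → ℝ)) s :=
    (hasDerivAt_id s).prodMk (hasDerivAt_const s y)
  exact h1.comp_hasDerivAt s h2

theorem hasDerivAt (hg : SmoothFamily g) (s : ℝ) (x : Torus) :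
    HasDerivAt (fun r => g r x) (deriv (fun r => g r x) s) s := by
  obtain ⟨y, rfl⟩ := proj_surjective x
  exact (hg.hasDerivAt_proj s y).differentiableAt.hasDerivAt

theorem fderiv_apply (hg : SmoothFamily g) (v : ℝ × (Fin 3 → ℝ)) : ContDiff ℝ ∞ fun p =>
    fderiv ℝ (fun p : ℝ × (Fin 3 → ℝ) => g p.1 (proj p.2)) p v :=
  (ContDiff.fderiv_right hg (by simp)).clm_apply contDiff_const

theorem timeDeriv (hg : SmoothFamily g) : SmoothFamily fun s x => deriv (fun r => g r x) s := by
  unfold SmoothFamily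
  simp only [fun s y => (hg.hasDerivAt_proj s y).deriv]
  exact hg.fderiv_apply (1, 0)

theorem pderiv (hg : SmoothFamily g) (j : Fin 3) : SmoothFamily fun s => pderiv j (g s) := by
  have e : ∀ s y, Magnetization.pderiv j (g s) (proj y) =
      fderiv ℝ (fun p : ℝ × (Fin 3 → ℝ) => g p.1 (proj p.2)) (s, y) (0, Pi.single j 1) := by
    intro s y
    rw [pderiv_proj (hg.contDiff_slice s)]
    have h1 : HasFDerivAt (fun p : ℝ × (Fin 3 → ℝ) => g p.1 (proj p.2)) _ (s, y) :=
      (ContDiff.differentiable hg (by simp) (s, y)).hasFDerivAt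
    have h2 : HasFDerivAt (fun z : Fin 3 → ℝ => (s, z)) _ y :=
      hasFDerivAt_prodMk_right (𝕜 := ℝ) s y
    have h3 : HasFDerivAt (fun z => g s (proj z)) _ y := h1.comp y h2
    rw [h3.fderiv]
    rfl
  unfold SmoothFamily
  simp only [e]
  exact hg.fderiv_apply (0, Pi.single j 1)

theorem hasDerivAt_cf (hg : SmoothFamily g) (k : Freq) (s : ℝ) :
    HasDerivAt (fun s => cf (fun x => (g s x : ℂ)) k)
      (cf (fun x => ((deriv (fun r => g r x) s : ℝ) : ℂ)) k) s := by
  obtain ⟨C, hC⟩ := hg.timeDeriv.exists_bound (s - 1) (s + 1)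
  have hch := continuous_character (-k)
  have hF : ∀ r, Continuous fun x => (g r x : ℂ) * character (-k) x := fun r =>
    (Complex.continuous_ofReal.comp (hg.continuous_slice r)).mul hch
  have hF' : ∀ r, Continuous fun x => ((deriv (fun r => g r x) r : ℝ) : ℂ) * character (-k) x := fun r =>
    (Complex.continuous_ofReal.comp (hg.timeDeriv.continuous_slice r)).mul hch
  have hd := hasDerivAt_integral_of_dominated_loc_of_deriv_le (μ := (volume : Measure Torus))
    (F := fun r x => (g r x : ℂ) * character (-k) x)
    (F' := fun r x => ((deriv (fun r => g r x) r : ℝ) : ℂ) * character (-k) x)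
    (x₀ := s) (bound := fun _ => C) (s := Icc (s - 1) (s + 1))
    (Icc_mem_nhds (by linarith) (by linarith))
    (Eventually.of_forall fun r => (hF r).aestronglyMeasurable)
    ((Torus.memLp_of_continuous (hF s) 1).integrable le_rfl)
    (hF' s).aestronglyMeasurable
    (Eventually.of_forall fun x r hr => by
      rw [norm_mul, norm_character, mul_one, Complex.norm_real]
      exact hC r hr x)
    (integrable_const _)
    (Eventually.of_forall fun x r _ => (HasDerivAt.ofReal_comp (hg.hasDerivAt r x)).mul_const _)
  exact hd.2.const_mul _

theorem continuous_cf (hg : SmoothFamily g) (k : Freq) :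
    Continuous fun s => cf (fun x => (g s x : ℂ)) k :=
  continuous_iff_continuousAt.2 fun s => (hg.hasDerivAt_cf k s).continuousAt

/-- A bound on a compact set of times in sup norm becomes, through Parseval, a bound on the
coefficients uniform in time. -/
theorem exists_tsum_cf_bound (hg : SmoothFamily g) (a b : ℝ) :
    ∃ C : ℝ≥0∞, C < ⊤ ∧ ∀ s ∈ Icc a b, ∑' k, ‖cf (fun x => (g s x : ℂ)) k‖ₑ ^ 2 ≤ C := by
  obtain ⟨C, hC⟩ := hg.exists_bound a b
  refine ⟨ENNReal.ofReal vol⁻¹ * (ENNReal.ofReal C ^ 2 * volume (univ : Set Torus)),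
    ENNReal.mul_lt_top ENNReal.ofReal_lt_top (ENNReal.mul_lt_top (ENNReal.pow_lt_top
      ENNReal.ofReal_lt_top) (measure_lt_top _ _)), fun s hs => ?_⟩
  rw [tsum_cf_enorm_sq (hg.memLp s 2), ← lintegral_const]
  gcongr with x
  rw [← ofReal_norm, Complex.norm_real]
  exact ENNReal.ofReal_le_ofReal (hC s hs x)

end SmoothFamily

/-! ### Duality pairings of coefficients and the weak form of the mode system. -/

/-- The coefficients against which a vector field is paired. -/
def testCoef (ψ : Torus → E3) : Coef := fun k i => cf (fun x => ((ψ x i : ℝ) : ℂ)) (-k)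

/-- `y ↦ ∑ₖ yₖ·zₖ`, the pairing of coefficients. -/
def bil (y z : Coef) : ℂ := ∑' k, ∑ i, y k i * z k i

/-- The coefficients of `-Δ`. -/
def lap (y : Coef) : Coef := fun k i => ((((jap k : ℝ) ^ 2 - 1 : ℝ)) : ℂ) * y k i

/-- Young's inequality after moving the weight `⟨k⟩^{n/2}` from one factor to the other: duality of
opposite Sobolev orders. -/
theorem tsum_enorm_mul_le (n : ℤ) (y z : Coef) :
    ∑' k, ∑ i, ‖y k i * z k i‖ₑ ≤ sobN (-n) y + sobN n z := by
  unfold sobN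
  rw [← ENNReal.tsum_add]
  refine ENNReal.tsum_le_tsum fun k => ?_
  rw [Finset.mul_sum, Finset.mul_sum, ← Finset.sum_add_distrib]
  refine Finset.sum_le_sum fun i _ => ?_
  have hj : jap k ^ n ≠ 0 := zpow_ne_zero _ (jap_ne_zero k)
  set c : ℝ≥0 := NNReal.sqrt (jap k ^ n) with hc
  have hc2 : c ^ 2 = jap k ^ n := NNReal.sq_sqrt _
  have hc0 : c ≠ 0 := by simpa [hc] using hj
  have h := two_mul_le_add_sq_ennreal (((c⁻¹ : ℝ≥0) : ℝ≥0∞) * ‖y k i‖ₑ) ((c : ℝ≥0∞) * ‖z k i‖ₑ)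
  have e : ((c⁻¹ : ℝ≥0) : ℝ≥0∞) * ‖y k i‖ₑ * ((c : ℝ≥0∞) * ‖z k i‖ₑ) = ‖y k i * z k i‖ₑ := by
    rw [mul_mul_mul_comm, ← ENNReal.coe_mul, inv_mul_cancel₀ hc0, ENNReal.coe_one, one_mul,
      enorm_mul]
  rw [e, mul_pow, mul_pow, ← ENNReal.coe_pow, ← ENNReal.coe_pow, inv_pow, hc2, ← zpow_neg] at h
  exact le_trans (by rw [two_mul]; exact le_self_add) h

/-- Duality makes the double expression absolutely summable and integrable, so sum over modes and
time integral may be exchanged. -/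
theorem hasSum_integral_bil {t : ℝ} (ht : 0 ≤ t) {a b : ℝ → Coef} (n : ℤ)
    (ha : ∀ k i, AEStronglyMeasurable (fun s => a s k i) (volume.restrict (Ioc 0 t)))
    (hb : ∀ k i, AEStronglyMeasurable (fun s => b s k i) (volume.restrict (Ioc 0 t)))
    (ha' : ∫⁻ s in Ioc 0 t, sobN (-n) (a s) < ⊤) (hb' : ∫⁻ s in Ioc 0 t, sobN n (b s) < ⊤) :
    (∀ k i, IntervalIntegrable (fun s => a s k i * b s k i) volume 0 t) ∧
      HasSum (fun k => ∑ i, ∫ s in (0 : ℝ)..t, a s k i * b s k i)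
        (∫ s in (0 : ℝ)..t, bil (a s) (b s)) := by
  have hm : ∀ k i, AEStronglyMeasurable (fun s => a s k i * b s k i) (volume.restrict (Ioc 0 t)) :=
    fun k i => (ha k i).mul (hb k i)
  have hfin : ∑' k, ∑ i, ∫⁻ s in Ioc 0 t, ‖a s k i * b s k i‖ₑ < ⊤ := by
    calc ∑' k, ∑ i, ∫⁻ s in Ioc 0 t, ‖a s k i * b s k i‖ₑ
        = ∫⁻ s in Ioc 0 t, ∑' k, ∑ i, ‖a s k i * b s k i‖ₑ := by
          rw [lintegral_tsum fun k => Finset.aemeasurable_fun_sum _ fun i _ => (hm k i).enorm]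
          exact tsum_congr fun k => (lintegral_finsetSum' _ fun i _ => (hm k i).enorm).symm
      _ ≤ ∫⁻ s in Ioc 0 t, (sobN (-n) (a s) + sobN n (b s)) := by
          gcongr with s
          exact tsum_enorm_mul_le n _ _
      _ < ⊤ := by
          rw [lintegral_add_left' (aemeasurable_sobN _ ha)]
          exact ENNReal.add_lt_top.2 ⟨ha', hb'⟩
  have hint : ∀ k i, Integrable (fun s => a s k i * b s k i) (volume.restrict (Ioc 0 t)) :=
    fun k i => ⟨hm k i, lt_of_le_of_lt (Finset.single_le_sum
      (f := fun i => ∫⁻ s in Ioc 0 t, ‖a s k i * b s k i‖ₑ) (fun _ _ => zero_le)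
      (Finset.mem_univ i)) ((ENNReal.le_tsum k).trans_lt hfin)⟩
  refine ⟨fun k i => (intervalIntegrable_iff_integrableOn_Ioc_of_le ht).2 (hint k i), ?_⟩
  simp only [intervalIntegral.integral_of_le ht]
  have hint' : ∀ k, Integrable (fun s => ∑ i, a s k i * b s k i) (volume.restrict (Ioc 0 t)) :=
    fun k => integrable_finsetSum _ fun i _ => hint k i
  have hs : Summable fun k => ∫ s in Ioc 0 t, ‖∑ i, a s k i * b s k i‖ := by
    have h1 : ∑' k, ∫⁻ s in Ioc 0 t, ‖∑ i, a s k i * b s k i‖ₑ < ⊤ := by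
      refine lt_of_le_of_lt (ENNReal.tsum_le_tsum fun k => ?_) hfin
      rw [← lintegral_finsetSum' _ fun i _ => (hm k i).enorm]
      exact lintegral_mono fun s => enorm_sum_le _ _
    have h2 := ENNReal.summable_toReal h1.ne
    refine h2.congr fun k => ?_
    rw [integral_norm_eq_lintegral_enorm (hint' k).1]
  have h := hasSum_integral_of_summable_integral_norm hint' hs
  simpa only [integral_finsetSum _ fun i _ => hint _ i, bil] using h

theorem aestronglyMeasurable_lap {μ : Measure ℝ} {Y : ℝ → Coef}
    (h : ∀ k i, AEStronglyMeasurable (fun s => Y s k i) μ) (k : Freq) (i : Fin 3) :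
    AEStronglyMeasurable (fun s => lap (Y s) k i) μ :=
  (h k i).const_mul _

theorem sobN_lap_le (n : ℤ) (y : Coef) : sobN n (lap y) ≤ sobN (n + 4) y := by
  unfold sobN lap
  refine ENNReal.tsum_le_tsum fun k => ?_
  rw [zpow_add₀ (jap_ne_zero k), ENNReal.coe_mul, mul_assoc]
  gcongr
  rw [Finset.mul_sum]
  refine Finset.sum_le_sum fun i _ => ?_
  rw [enorm_mul, mul_pow]
  gcongr
  have h1 : (1 : ℝ) ≤ jap k := by exact_mod_cast one_le_jap k
  rw [← ofReal_norm, Complex.norm_real, Real.norm_of_nonneg (by nlinarith),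
    ← ENNReal.ofReal_pow (by nlinarith), ← ENNReal.ofReal_coe_nnreal]
  refine ENNReal.ofReal_le_ofReal ?_
  rw [zpow_ofNat, NNReal.coe_pow, show (jap k : ℝ) ^ 4 = ((jap k : ℝ) ^ 2) ^ 2 by ring]
  exact pow_le_pow_left₀ (by nlinarith) (by linarith) 2

/-- The weak formulation in terms of Fourier coefficients. -/
theorem IsModeSol.weak_form {T : ℝ} {y₀ : Coef} {Y F Φ Φ' : ℝ → Coef} (h : IsModeSol T y₀ Y F)
    (hT : 0 ≤ T) (hy : sobN 1 y₀ < ⊤)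
    (hd : ∀ k i s, HasDerivAt (fun s => Φ s k i) (Φ' s k i) s)
    (hc : ∀ k i, Continuous fun s => Φ' s k i) {C : ℝ≥0∞} (hC : C < ⊤)
    (hΦ : ∀ s ∈ Icc 0 T, sobN 2 (Φ s) ≤ C) (hΦ' : ∀ s ∈ Icc 0 T, sobN 0 (Φ' s) ≤ C) :
    bil (Y T) (Φ T) + ∫ s in (0 : ℝ)..T, bil (F s) (Φ s) =
      bil y₀ (Φ 0) + (∫ s in (0 : ℝ)..T, bil (Y s) (Φ' s)) -
        ∫ s in (0 : ℝ)..T, bil (lap (Y s)) (Φ s) := by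
  have hYm := h.aestronglyMeasurable hT
  have hΦc : ∀ k i, Continuous fun s => Φ s k i := fun k i =>
    continuous_iff_continuousAt.2 fun s => (hd k i s).continuousAt
  have hconst : ∀ {f : ℝ → ℝ≥0∞}, (∀ s ∈ Icc 0 T, f s ≤ C) → ∫⁻ s in Ioc 0 T, f s < ⊤ := by
    intro f hf
    refine lt_of_le_of_lt (setLIntegral_mono' measurableSet_Ioc fun s hs =>
      hf s (Ioc_subset_Icc_self hs)) ?_
    rw [lintegral_const]
    exact ENNReal.mul_lt_top hC (measure_lt_top _ _)
  have h3 := h.ae_sobN_three_lt_top hT hy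
  have hlow : ∀ {n : ℤ}, n ≤ 2 → ∫⁻ s in Ioc 0 T, sobN n (Φ s) < ⊤ := fun hn =>
    hconst fun s hs => (sobN_mono hn _).trans (hΦ s hs)
  -- Each of the three pairings uses its own duality: `n = 1` for the forcing, `n = 0` for the time
  -- derivative, and `n = 2` for the Laplacian, which costs four powers of `⟨k⟩`.
  obtain ⟨i1, s1⟩ := hasSum_integral_bil hT 1 h.meas (fun k i => (hΦc k i).aestronglyMeasurable)
    h.fin (hlow (by norm_num))
  obtain ⟨i2, s2⟩ := hasSum_integral_bil hT 0 hYm (fun k i => (hc k i).aestronglyMeasurable)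
    ((lintegral_mono fun s => sobN_mono (by norm_num) _).trans_lt h3) (hconst hΦ')
  obtain ⟨i3, s3⟩ := hasSum_integral_bil hT 2 (aestronglyMeasurable_lap hYm)
    (fun k i => (hΦc k i).aestronglyMeasurable)
    ((lintegral_mono fun s => (sobN_lap_le _ _).trans (sobN_mono (by norm_num) _)).trans_lt h3)
    (hlow le_rfl)
  have hbil : ∀ y z : Coef, sobN 0 y < ⊤ → sobN 0 z < ⊤ →
      HasSum (fun k => ∑ i, y k i * z k i) (bil y z) := fun y z hy hz => by
    refine Summable.hasSum (Summable.of_enorm ?_)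
    refine ne_of_lt (lt_of_le_of_lt (ENNReal.tsum_le_tsum fun k => enorm_sum_le _ _) ?_)
    exact (tsum_enorm_mul_le 0 y z).trans_lt (ENNReal.add_lt_top.2 ⟨by simpa using hy, hz⟩)
  have hΦ0 : ∀ s ∈ Icc 0 T, sobN 0 (Φ s) < ⊤ := fun s hs =>
    ((sobN_mono (by norm_num) _).trans (hΦ s hs)).trans_lt hC
  have hT' : T ∈ Icc 0 T := ⟨hT, le_rfl⟩
  have s4 := hbil (Y T) (Φ T)
    ((sobN_mono (by norm_num) _).trans_lt ((h.sobN_one_le hT').trans_lt (h.tsum_majorant_lt_top hy)))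
    (hΦ0 T hT')
  have s5 := hbil y₀ (Φ 0) ((sobN_mono (by norm_num) _).trans_lt hy) (hΦ0 0 ⟨le_rfl, hT⟩)
  -- The weak identity for a single mode is the product rule for `Y Φ` integrated over `[0,T]`;
  -- summation over the modes then gives the claim.
  have key : ∀ k i, Y T k i * Φ T k i + (∫ s in (0 : ℝ)..T, F s k i * Φ s k i) =
      y₀ k i * Φ 0 k i + (∫ s in (0 : ℝ)..T, Y s k i * Φ' s k i) -
        ∫ s in (0 : ℝ)..T, lap (Y s) k i * Φ s k i := fun k i => by
    have hm := (h.deriv k i).mul (HasACDeriv.of_hasDerivAt (T := T) (hd k i) (hc k i))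
    have e : (fun t => (-((((jap k : ℝ) ^ 2 - 1 : ℝ)) : ℂ) * Y t k i - F t k i) * Φ t k i +
        Y t k i * Φ' t k i) = fun t => Y t k i * Φ' t k i - lap (Y t) k i * Φ t k i -
          F t k i * Φ t k i := by
      ext t
      simp only [lap]
      ring
    rw [e] at hm
    have := hm.eq_add_integral (((i2 k i).sub (i3 k i)).sub (i1 k i)) (t := T) (by simp)
    rw [intervalIntegral.integral_sub ((i2 k i).sub (i3 k i)) (i1 k i),
      intervalIntegral.integral_sub (i2 k i) (i3 k i), h.init] at this
    rw [this]
    ring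
  refine (s4.add s1).unique ?_
  convert! (s5.add s2).sub s3 using 2 with k
  simp only [← Finset.sum_add_distrib, ← Finset.sum_sub_distrib, key]

/-! ### The pairings in terms of Fourier coefficients -/

theorem pairing_eq_bil (f : L2) {ψ : Torus → E3} (hψ : ∀ i, Continuous fun x => ψ x i) :
    (pairing f ψ : ℂ) = vol * bil (coeff f) (testCoef ψ) := by
  have m : ∀ i, MemLp (fun x => ((ψ x i : ℝ) : ℂ)) 2 volume := fun i =>
    Torus.memLp_of_continuous (Complex.continuous_ofReal.comp (hψ i)) 2
  have h := hasSum_sum (s := Finset.univ) fun i _ => hasSum_cf_mul (memLp_comp f i) (m i)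
  rw [← Finset.mul_sum] at h
  have h1 : bil (coeff f) (testCoef ψ) = _ := h.tsum_eq
  rw [h1, ← mul_assoc, mul_inv_cancel₀ vol_ne_zero, one_mul, pairing, integral_finsetSum,
    Complex.ofReal_sum]
  · simp only [← integral_complex_ofReal, Complex.ofReal_mul]
  · intro i _
    exact ((Lp.memLp f).eval_piLp i).integrable_mul (Torus.memLp_of_continuous (hψ i) 2)

theorem gradPairing_eq_bil {f : L2} (hf : sobN 2 (coeff f) < ⊤) {ψ : Torus → E3}
    (hψ : ∀ i, ContDiff ℝ ∞ fun y => ψ (proj y) i) :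
    (gradPairing f ψ : ℂ) = vol * bil (lap (coeff f)) (testCoef ψ) := by
  have hc : ∀ i j, Continuous (pderiv j fun x => ψ x i) := fun i j => continuous_pderiv (hψ i) j
  have m : ∀ i j, MemLp (fun x => ((pderiv j (fun x => ψ x i) x : ℝ) : ℂ)) 2 volume := fun i j =>
    Torus.memLp_of_continuous (Complex.continuous_ofReal.comp (hc i j)) 2
  have h := hasSum_sum (s := Finset.univ) fun i _ => hasSum_sum (s := Finset.univ) fun j _ =>
    hasSum_cf_mul (memLp_comp (weakPartial j f) i) (m i j)
  simp only [← Finset.mul_sum] at h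
  have e : ∀ k i, ∑ j, cf (fun x => ((weakPartial j f x i : ℝ) : ℂ)) k *
      cf (fun x => ((pderiv j (fun x => ψ x i) x : ℝ) : ℂ)) (-k) =
      lap (coeff f) k i * testCoef ψ k i := fun k i => by
    have e1 : ∀ j, cf (fun x => ((weakPartial j f x i : ℝ) : ℂ)) k *
        cf (fun x => ((pderiv j (fun x => ψ x i) x : ℝ) : ℂ)) (-k) =
        (k j : ℂ) ^ 2 * (coeff f k i * testCoef ψ k i) := fun j => by
      rw [cf_pderiv (hψ i), ← coeff_eq_cf, coeff_weakPartial hf, testCoef, Pi.neg_apply,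
        Int.cast_neg]
      linear_combination (-(k j : ℂ) ^ 2 * (coeff f k i * cf (fun x => ((ψ x i : ℝ) : ℂ)) (-k))) *
        Complex.I_sq
    simp only [e1]
    rw [← Finset.sum_mul, lap, jap_sq_real]
    push_cast
    ring
  simp only [e] at h
  have h1 : bil (lap (coeff f)) (testCoef ψ) = _ := h.tsum_eq
  have hi : ∀ i j, Integrable (fun x => weakPartial j f x i * pderiv j (fun x => ψ x i) x)
      (volume : Measure Torus) := fun i j =>
    ((Lp.memLp (weakPartial j f)).eval_piLp i).integrable_mul (Torus.memLp_of_continuous (hc i j) 2)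
  rw [h1, ← mul_assoc, mul_inv_cancel₀ vol_ne_zero, one_mul, gradPairing, integral_finsetSum,
    Complex.ofReal_sum]
  · refine Finset.sum_congr rfl fun i _ => ?_
    rw [integral_finsetSum _ fun j _ => hi i j, Complex.ofReal_sum]
    simp only [← integral_complex_ofReal, Complex.ofReal_mul]
  · exact fun i _ => integrable_finsetSum _ fun j _ => hi i j

theorem tsum_jap_cf_le (ψ : Torus → E3) (i : Fin 3) :
    ∑' k, ((jap k : ℝ≥0) : ℝ≥0∞) * ‖cf (fun x => ((ψ x i : ℝ) : ℂ)) k‖ₑ ^ 2 ≤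
      sobN 2 (testCoef ψ) := by
  refine le_trans ?_ (sobN_mono (m := 1) (by norm_num) _)
  rw [← (Equiv.neg Freq).tsum_eq]
  unfold sobN
  refine ENNReal.tsum_le_tsum fun k => ?_
  rw [Equiv.neg_apply, jap_neg, zpow_one]
  gcongr
  exact Finset.single_le_sum (f := fun i => ‖testCoef ψ k i‖ₑ ^ 2) (fun _ _ => zero_le)
    (Finset.mem_univ i)

/-- The density of the transport term. -/
def transportDensity (u w : L2) (i : Fin 3) (x : Torus) : ℝ :=
  ∑ j, (u x j * weakPartial j w x i + weakPartial i u x j * w x j)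

theorem integrable_transportDensity (u w : L2) (i : Fin 3) :
    Integrable (transportDensity u w i) (volume : Measure Torus) :=
  integrable_finsetSum _ fun j _ =>
    (((Lp.memLp u).eval_piLp j).integrable_mul ((Lp.memLp (weakPartial j w)).eval_piLp i)).add
      (((Lp.memLp (weakPartial i u)).eval_piLp j).integrable_mul ((Lp.memLp w).eval_piLp j))

theorem transportPairing_eq_bil {u w : L2} (hu : sobN 2 (coeff u) < ⊤) (hw : sobN 2 (coeff w) < ⊤)
    {ψ : Torus → E3} (hψ : ∀ i, Continuous fun x => ψ x i) (hψ1 : sobN 2 (testCoef ψ) < ⊤) :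
    (transportPairing u w ψ : ℂ) = vol * bil (transport (coeff u) (coeff w)) (testCoef ψ) := by
  have h := hasSum_sum (s := Finset.univ) fun i _ => hasSum_transport hu hw i
    (Complex.continuous_ofReal.comp (hψ i)) ((tsum_jap_cf_le ψ i).trans_lt hψ1)
  rw [← Finset.mul_sum] at h
  have h1 : bil (transport (coeff u) (coeff w)) (testCoef ψ) = _ := h.tsum_eq
  rw [h1, ← mul_assoc, mul_inv_cancel₀ vol_ne_zero, one_mul, transportPairing, integral_finsetSum,
    Complex.ofReal_sum]
  · simp only [← integral_complex_ofReal, Complex.ofReal_mul, Function.comp_apply]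
  · intro i _
    obtain ⟨C, hC⟩ := isCompact_univ.exists_bound_of_continuousOn (hψ i).continuousOn
    exact (integrable_transportDensity u w i).mul_bdd (c := C) (hψ i).aestronglyMeasurable
      (Eventually.of_forall fun x => hC x (mem_univ x))

/-- Since `⟨k⟩² = 1 + ∑ k_j²`, the squared `H¹` norm is a sum of `L²` coefficient norms of the
function and its partial derivatives, to which the uniform bounds apply. -/
theorem sobN_two_testCoef {ψ : Torus → E3} (hψ : ∀ i, ContDiff ℝ ∞ fun y => ψ (proj y) i) :
    sobN 2 (testCoef ψ) = ∑ i, (∑' k, ‖cf (fun x => ((ψ x i : ℝ) : ℂ)) k‖ₑ ^ 2 +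
      ∑ j, ∑' k, ‖cf (fun x => ((pderiv j (fun x => ψ x i) x : ℝ) : ℂ)) k‖ₑ ^ 2) := by
  have e : ∀ k, ((jap k ^ (2 : ℤ) : ℝ≥0) : ℝ≥0∞) = 1 + ∑ j, ‖(k j : ℂ)‖ₑ ^ 2 := fun k => by
    have h : ∀ j, ‖(k j : ℂ)‖ₑ ^ 2 = ENNReal.ofReal ((k j : ℝ) ^ 2) := fun j => by
      rw [← ofReal_norm, Complex.norm_intCast, ← ENNReal.ofReal_pow (abs_nonneg _), sq_abs]
    simp only [h]
    rw [← ENNReal.ofReal_sum_of_nonneg fun _ _ => sq_nonneg _, ← ENNReal.ofReal_one,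
      ← ENNReal.ofReal_add zero_le_one (Finset.sum_nonneg fun _ _ => sq_nonneg _), ← jap_sq_real,
      ← ENNReal.ofReal_coe_nnreal, zpow_ofNat, NNReal.coe_pow]
  rw [sobN, ← (Equiv.neg Freq).tsum_eq]
  simp only [← Summable.tsum_finsetSum fun _ _ => ENNReal.summable, ← ENNReal.tsum_add]
  refine tsum_congr fun k => ?_
  rw [Equiv.neg_apply, jap_neg, e, Finset.mul_sum]
  refine Finset.sum_congr rfl fun i _ => ?_
  rw [add_mul, one_mul, testCoef, neg_neg, Finset.sum_mul]
  congr 1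
  refine Finset.sum_congr rfl fun j _ => ?_
  rw [cf_pderiv (hψ i), enorm_mul, enorm_mul, mul_pow, mul_pow]
  simp [enorm_eq_nnnorm]

theorem sobN_zero_testCoef (ψ : Torus → E3) :
    sobN 0 (testCoef ψ) = ∑ i, ∑' k, ‖cf (fun x => ((ψ x i : ℝ) : ℂ)) k‖ₑ ^ 2 := by
  rw [sobN, ← (Equiv.neg Freq).tsum_eq, ← Summable.tsum_finsetSum fun _ _ => ENNReal.summable]
  refine tsum_congr fun k => ?_
  simp [testCoef]

/-! ### Test functions -/

namespace IsTest

variable {T : ℝ} {φ : ℝ → Torus → E3}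

theorem smoothFamily (h : IsTest T φ) (i : Fin 3) : SmoothFamily fun s x => φ s x i :=
  (EuclideanSpace.proj (𝕜 := ℝ) i).contDiff.comp h.1

theorem deriv_apply (h : IsTest T φ) (s : ℝ) (x : Torus) (i : Fin 3) :
    (deriv (fun r => φ r x) s) i = deriv (fun r => φ r x i) s := by
  have h1 : DifferentiableAt ℝ (fun r => φ r x) s := by
    obtain ⟨y, rfl⟩ := proj_surjective x
    exact (ContDiff.comp (g := fun p : ℝ × (Fin 3 → ℝ) => φ p.1 (proj p.2)) h.1
      (contDiff_id.prodMk contDiff_const)).differentiable (by simp) s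
  exact ((EuclideanSpace.proj (𝕜 := ℝ) i).hasFDerivAt.comp_hasDerivAt s h1.hasDerivAt).deriv.symm

theorem exists_bound (h : IsTest T φ) (a b : ℝ) : ∃ C : ℝ≥0∞, C < ⊤ ∧
    (∀ s ∈ Icc a b, sobN 2 (testCoef (φ s)) ≤ C) ∧
    ∀ s ∈ Icc a b, sobN 0 (testCoef fun x => deriv (fun r => φ r x) s) ≤ C := by
  choose A hA hA' using fun i => (h.smoothFamily i).exists_tsum_cf_bound a b
  choose B hB hB' using fun i j => ((h.smoothFamily i).pderiv j).exists_tsum_cf_bound a b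
  choose D hD hD' using fun i => (h.smoothFamily i).timeDeriv.exists_tsum_cf_bound a b
  refine ⟨∑ i, (A i + ∑ j, B i j) + ∑ i, D i, ?_, fun s hs => ?_, fun s hs => ?_⟩
  · simp [ENNReal.add_lt_top, ENNReal.sum_lt_top, hA, hB, hD]
  · rw [sobN_two_testCoef fun i => (h.smoothFamily i).contDiff_slice s]
    refine le_trans ?_ le_self_add
    gcongr with i _ j _
    · exact hA' i s hs
    · exact hB' i j s hs
  · rw [sobN_zero_testCoef]
    refine le_trans ?_ le_add_self
    gcongr with i _
    simp only [h.deriv_apply]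
    exact hD' i s hs

end IsTest

/-! ### Existence -/

theorem isStrongSolution_of_isModeSol {T : ℝ} (hT : 0 < T) {u w : ℝ → L2} {w₀ : L2} {Y F : ℝ → Coef}
    (hu : IsVelocity T fun t => coeff (u t)) (h : IsModeSol T (coeff w₀) Y F)
    (hF : ∀ᵐ t ∂(volume.restrict (Ioc 0 T)), F t = transport (coeff (u t)) (Y t))
    (hw₀ : sobN 1 (coeff w₀) < ⊤) (hw : ∀ t ∈ Icc 0 T, coeff (w t) = Y t) :
    IsStrongSolution T u w₀ w := by
  obtain ⟨h1, h2⟩ := memLpH_of_coeff hT.le h hw₀ hw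
  refine ⟨h1, h2, fun φ hφ t ht => ?_⟩
  have htT : t ∈ Icc 0 T := ⟨ht.1, ht.2.le⟩
  have hs : ∀ s i, ContDiff ℝ ∞ fun y => φ s (proj y) i := fun s i =>
    (hφ.smoothFamily i).contDiff_slice s
  have hc : ∀ s i, Continuous fun x => φ s x i := fun s i => (hφ.smoothFamily i).continuous_slice s
  have hc' : ∀ s i, Continuous fun x => (deriv (fun r => φ r x) s) i := fun s i => by
    simp only [hφ.deriv_apply]
    exact (hφ.smoothFamily i).timeDeriv.continuous_slice s
  obtain ⟨C, hC, hb, hb'⟩ := hφ.exists_bound 0 t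
  have key := (h.mono htT).weak_form (Φ := fun s => testCoef (φ s))
    (Φ' := fun s => testCoef fun x => deriv (fun r => φ r x) s) ht.1 hw₀
    (fun k i s => by
      simp only [testCoef, hφ.deriv_apply]
      exact (hφ.smoothFamily i).hasDerivAt_cf (-k) s)
    (fun k i => by
      simp only [testCoef, hφ.deriv_apply]
      exact (hφ.smoothFamily i).timeDeriv.continuous_cf (-k)) hC hb hb'
  have hsub : volume.restrict (Ioc 0 t) ≤ volume.restrict (Ioc 0 T) :=
    Measure.restrict_mono (Ioc_subset_Ioc_right ht.2.le) le_rfl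
  have hmem : ∀ᵐ s ∂(volume.restrict (Ioc 0 t)), s ∈ Ioc 0 t := ae_restrict_mem measurableSet_Ioc
  have hY2 := ae_mono hsub (h.ae_sobN_two_lt_top hT.le hw₀)
  have hU2 := ae_mono hsub hu.ae_fin
  have cast : ∀ (f : ℝ → ℝ) (g : ℝ → ℂ), (∀ᵐ s ∂(volume.restrict (Ioc 0 t)), (f s : ℂ) = vol * g s) →
      ((∫ s in (0 : ℝ)..t, f s : ℝ) : ℂ) = vol * ∫ s in (0 : ℝ)..t, g s := fun f g hfg => by
    rw [← intervalIntegral.integral_ofReal, ← intervalIntegral.integral_const_mul,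
      intervalIntegral.integral_of_le ht.1, intervalIntegral.integral_of_le ht.1]
    exact integral_congr_ae hfg
  have e1 := cast (fun s => transportPairing (u s) (w s) (φ s))
    (fun s => bil (F s) (testCoef (φ s))) (by
      filter_upwards [hmem, hY2, hU2, ae_mono hsub hF] with s hst hY hU hFs
      have hcw := hw s ⟨hst.1.le, hst.2.trans ht.2.le⟩
      rw [transportPairing_eq_bil hU (by rwa [hcw]) (hc s)
        ((hb s (Ioc_subset_Icc_self hst)).trans_lt hC), hFs, hcw])
  have e2 := cast (fun s => pairing (w s) fun x => deriv (fun r => φ r x) s)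
    (fun s => bil (Y s) (testCoef fun x => deriv (fun r => φ r x) s)) (by
      filter_upwards [hmem] with s hst
      rw [pairing_eq_bil _ (hc' s), hw s ⟨hst.1.le, hst.2.trans ht.2.le⟩])
  have e3 := cast (fun s => gradPairing (w s) (φ s))
    (fun s => bil (lap (Y s)) (testCoef (φ s))) (by
      filter_upwards [hmem, hY2] with s hst hY
      have hcw := hw s ⟨hst.1.le, hst.2.trans ht.2.le⟩
      rw [gradPairing_eq_bil (by rwa [hcw]) (hs s), hcw])
  -- The formulation is real while the coefficient pairings are complex; the identity is proved in
  -- `ℂ`, where it is `vol` times the weak form of the modes.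
  apply Complex.ofReal_injective
  push_cast
  rw [e1, e2, e3, pairing_eq_bil _ (hc t), pairing_eq_bil _ (hc 0), hw t htT]
  linear_combination (vol : ℂ) * key

theorem exists_isStrongSolution {T : ℝ} (hT : 0 < T) {u : ℝ → L2}
    (hu : IsVelocity T fun t => coeff (u t)) {w₀ : L2} (hw₀ : sobN 1 (coeff w₀) < ⊤) :
    ∃ w : ℝ → L2, IsStrongSolution T u w₀ w ∧ ContinuousIntoH T (1 / 2) w := by
  obtain ⟨Y, F, h, hF⟩ := exists_isModeSol_transport hT.le hu hw₀
  have hex : ∀ t, ∃ f : L2, t ∈ Icc 0 T → coeff f = Y t := fun t => by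
    by_cases ht : t ∈ Icc 0 T
    · have hr := h.reflect_eq hT.le hw₀ hu (fun t => reflect_coeff _) (reflect_coeff _) hF ht
      obtain ⟨f, hf⟩ := exists_coeff_eq (y := Y t) ((sobN_mono (by norm_num) _).trans_lt
        ((h.sobN_one_le ht).trans_lt (h.tsum_majorant_lt_top hw₀))) (fun k i => by
          have := congrFun (congrFun hr (-k)) i
          simpa [reflect] using this.symm)
      exact ⟨f, fun _ => by ext k i; exact hf k i⟩
    -- Outside `[0,T]` the field has no prescribed coefficients, and any value will do.
    · exact ⟨0, fun h => absurd h ht⟩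
  choose w hw using hex
  exact ⟨w, isStrongSolution_of_isModeSol hT hu h hF hw₀ hw, continuousIntoH_of_coeff h hw₀ hw⟩

/-! ### Testing with characters -/

/-- The field whose `i`-th component is a real part of a character, in the sense of `L`. -/
def characterField (L : ℂ →L[ℝ] ℝ) (k : Freq) (i : Fin 3) (x : Torus) : E3 :=
  EuclideanSpace.single i (L (character (-k) x))

theorem integral_mul_clm (L : ℂ →L[ℝ] ℝ) {r : Torus → ℝ} (hr : Integrable r) {c : Torus → ℂ}
    (hc : Continuous c) : ∫ x, r x * L (c x) = L (∫ x, (r x : ℂ) * c x) := by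
  obtain ⟨C, hC⟩ := isCompact_univ.exists_bound_of_continuousOn hc.continuousOn
  have hi : Integrable (fun x => (r x : ℂ) * c x) := hr.ofReal.mul_bdd (c := C)
    hc.aestronglyMeasurable (Eventually.of_forall fun x => hC x (mem_univ x))
  rw [← L.integral_comp_comm hi]
  congr 1
  ext x
  rw [← Complex.real_smul, map_smul, smul_eq_mul]

theorem integrable_comp (f : L2) (i : Fin 3) : Integrable (fun x => f x i) (volume : Measure Torus) :=
  ((Lp.memLp f).eval_piLp i).integrable (by norm_num)

theorem integral_mul_character (f : L2) (k : Freq) (i : Fin 3) :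
    ∫ x, ((f x i : ℝ) : ℂ) * character (-k) x = vol * coeff f k i := by
  rw [coeff_eq_cf, cf, ← mul_assoc, mul_inv_cancel₀ vol_ne_zero, one_mul]

theorem pairing_characterField (L : ℂ →L[ℝ] ℝ) (f : L2) (k : Freq) (i : Fin 3) :
    pairing f (characterField L k i) = L (vol * coeff f k i) := by
  rw [← integral_mul_character, ← integral_mul_clm L (integrable_comp f i) (continuous_character _)]
  simp [pairing, characterField]

theorem pderiv_clm_character (L : ℂ →L[ℝ] ℝ) (k : Freq) (j : Fin 3) (x : Torus) :
    pderiv j (fun x => L (character k x)) x = L (Complex.I * k j * character k x) :=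
  (L.hasFDerivAt.comp_hasDerivAt (0 : ℝ) (hasDerivAt_character_line k j x)).deriv

theorem gradPairing_characterField (L : ℂ →L[ℝ] ℝ) {f : L2} (hf : sobN 2 (coeff f) < ⊤) (k : Freq)
    (i : Fin 3) : gradPairing f (characterField L k i) = L (vol * lap (coeff f) k i) := by
  have e : ∀ x, ∑ i', ∑ j, weakPartial j f x i' * pderiv j (fun y => characterField L k i y i') x =
      ∑ j, weakPartial j f x i * L (Complex.I * ((-k) j : ℤ) * character (-k) x) := fun x => by
    rw [Finset.sum_eq_single i]
    · simp only [characterField, PiLp.single_apply, if_true, pderiv_clm_character]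
    · intro i' _ hi
      simp [characterField, hi, pderiv]
    · simp
  have hc : ∀ j, Continuous fun x => Complex.I * ((-k) j : ℤ) * character (-k) x := fun j =>
    continuous_const.mul (continuous_character _)
  rw [gradPairing]
  simp only [e]
  rw [integral_finsetSum]
  · simp only [fun j => integral_mul_clm L (integrable_comp (weakPartial j f) i) (hc j)]
    rw [← map_sum]
    congr 1
    have e1 : ∀ j, ∫ x, ((weakPartial j f x i : ℝ) : ℂ) *
        (Complex.I * ((-k) j : ℤ) * character (-k) x) = (k j : ℂ) ^ 2 * (vol * coeff f k i) :=
      fun j => by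
      have e2 : ∀ x, ((weakPartial j f x i : ℝ) : ℂ) * (Complex.I * ((-k) j : ℤ) * character (-k) x) =
          Complex.I * ((-k) j : ℤ) * (((weakPartial j f x i : ℝ) : ℂ) * character (-k) x) :=
        fun x => by ring
      simp only [e2]
      rw [integral_const_mul, integral_mul_character, coeff_weakPartial hf, Pi.neg_apply,
        Int.cast_neg]
      linear_combination (-(k j : ℂ) ^ 2 * (vol * coeff f k i)) * Complex.I_sq
    simp only [e1]
    rw [← Finset.sum_mul, lap, jap_sq_real]
    push_cast
    ring
  · intro j _
    exact ((Lp.memLp (weakPartial j f)).eval_piLp i).integrable_mul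
      (Torus.memLp_of_continuous (L.continuous.comp (hc j)) 2)

theorem transportPairing_characterField (L : ℂ →L[ℝ] ℝ) {u w : L2} (hu : sobN 2 (coeff u) < ⊤)
    (hw : sobN 2 (coeff w) < ⊤) (k : Freq) (i : Fin 3) :
    transportPairing u w (characterField L k i) =
      L (vol * transport (coeff u) (coeff w) k i) := by
  -- A character has a single nonzero coefficient, so the regularity condition is trivial and the
  -- Parseval sum collapses to one term.
  have hψ1 : ∑' m, ((jap m : ℝ≥0) : ℝ≥0∞) * ‖cf (character (-k)) m‖ₑ ^ 2 < ⊤ := by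
    rw [tsum_eq_single (-k) fun m hm => by simp [cf_character, hm]]
    simp [cf_character]
  have h := hasSum_transport hu hw i (continuous_character (-k)) hψ1
  have h1 := h.unique (hasSum_single k fun m hm => by simp [cf_character, hm])
  rw [cf_character, if_pos rfl, mul_one, inv_mul_eq_iff_eq_mul₀ vol_ne_zero] at h1
  rw [← h1]
  refine Eq.trans ?_ (integral_mul_clm L (integrable_transportDensity u w i)
    (continuous_character (-k)))
  simp [transportPairing, transportDensity, characterField]

/-- The time factor is `1` up to `t₁` and `0` from `t₂` on, so a stationary field becomes an
admissible test function without being altered before `t₁`. -/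
theorem isTest_characterField {T t₁ t₂ : ℝ} (h₁ : t₁ < t₂) (h₂ : t₂ < T) (L : ℂ →L[ℝ] ℝ) (k : Freq)
    (i : Fin 3) : IsTest T fun s x =>
      Real.smoothTransition ((t₂ - s) / (t₂ - t₁)) • characterField L k i x := by
  refine ⟨ContDiff.fun_smul ?_ ?_, t₂, h₂, fun s hs x => ?_⟩
  · exact Real.smoothTransition.contDiff.comp ((contDiff_const.sub contDiff_fst).div_const _)
  · refine ContDiff.comp (g := fun y => characterField L k i (proj y)) ?_ contDiff_snd
    rw [contDiff_euclidean]
    intro i'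
    simp only [characterField, PiLp.single_apply]
    split_ifs
    · exact L.contDiff.comp (contDiff_character (-k))
    · exact contDiff_const
  · beta_reduce
    rw [Real.smoothTransition.zero_of_nonpos, zero_smul]
    exact div_nonpos_of_nonpos_of_nonneg (by linarith) (by linarith)

/-! ### Uniqueness -/

section

variable {T : ℝ} {u v : ℝ → L2} {w₀ : L2}

theorem lintegral_transport_lt_top {U V : ℝ → Coef} (hU : IsVelocity T U) (hV : IsVelocity T V) :
    ∫⁻ t in Ioc 0 T, sobN (-1) (transport (U t) (V t)) < ⊤ := by
  calc ∫⁻ t in Ioc 0 T, sobN (-1) (transport (U t) (V t))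
      ≤ ∫⁻ t in Ioc 0 T, transportConst * (sobN 2 (U t) ^ 2 + sobN 2 (V t) ^ 2) := by
        gcongr with t
        refine (sobN_transport_le _ _).trans ?_
        gcongr
        exact le_trans (by rw [two_mul]; exact le_self_add)
          (two_mul_le_add_sq_ennreal (sobN 2 (U t)) (sobN 2 (V t)))
    _ < ⊤ := by
        rw [lintegral_const_mul' _ _ ENNReal.coe_ne_top,
          lintegral_add_left' ((aemeasurable_sobN 2 hU.meas).pow_const 2)]
        exact ENNReal.mul_lt_top ENNReal.coe_lt_top (ENNReal.add_lt_top.2 ⟨hU.fin, hV.fin⟩)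

theorem MemLpH.intervalIntegrable_coeff (hT : 0 ≤ T) (hv : MemLpH 2 T (3 / 2) v) (k : Freq)
    (i : Fin 3) : IntervalIntegrable (fun s => coeff (v s) k i) volume 0 T :=
  (intervalIntegrable_of_lintegral_sq hT (hv.aestronglyMeasurable_coeff k i)
    ((lintegral_mono fun s => enorm_sq_le_sobN (by norm_num) _ k i).trans_lt
      hv.lintegral_sobN_three)).1

/-- Testing with a character isolates one coefficient. The cutoff is constant near `[0,t]`, so the
term with the time derivative disappears and the integrated mode equation remains, valid at every `t
< T`. -/
theorem IsStrongSolution.coeff_eq (hu : IsVelocity T fun t => coeff (u t))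
    (hv : IsStrongSolution T u w₀ v) {t : ℝ} (ht : t ∈ Ico 0 T) (k : Freq) (i : Fin 3) :
    coeff (v t) k i = coeff w₀ k i + ∫ s in (0 : ℝ)..t,
      (-((((jap k : ℝ) ^ 2 - 1 : ℝ)) : ℂ) * coeff (v s) k i -
        transport (coeff (u s)) (coeff (v s)) k i) := by
  have hT : 0 ≤ T := ht.1.trans ht.2.le
  have hV := isVelocity_of_memLpH hv.1 hv.2.1
  have htT : uIcc 0 t ⊆ uIcc 0 T := uIcc_subset_uIcc (by simp) (by
    rw [uIcc_of_le hT]; exact ⟨ht.1, ht.2.le⟩)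
  have hi1 : IntervalIntegrable (fun s => lap (coeff (v s)) k i) volume 0 t :=
    ((hv.2.1.intervalIntegrable_coeff hT k i).const_mul _).mono_set htT
  have hmeas := aestronglyMeasurable_transport hu.meas hV.meas hu.ae_fin hV.ae_fin
  have hi2 : IntervalIntegrable (fun s => transport (coeff (u s)) (coeff (v s)) k i) volume 0 t :=
    (intervalIntegrable_of_lintegral_sq hT (hmeas k i)
      (lintegral_mode_lt_top hmeas (lintegral_transport_lt_top hu hV) k i)).1.mono_set htT
  have hsub : volume.restrict (Ioc 0 t) ≤ volume.restrict (Ioc 0 T) :=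
    Measure.restrict_mono (Ioc_subset_Ioc_right ht.2.le) le_rfl
  have key : ∀ L : ℂ →L[ℝ] ℝ, L (vol * coeff (v t) k i) =
      L (vol * (coeff w₀ k i - (∫ s in (0 : ℝ)..t, lap (coeff (v s)) k i) -
        ∫ s in (0 : ℝ)..t, transport (coeff (u s)) (coeff (v s)) k i)) := fun L => by
    -- Choose `t < t₁ < t₂ < T`; the strict inequality `t < t₁` makes the cutoff locally constant at
    -- the endpoint `t` as well.
    obtain ⟨t₁, h₁, h₁'⟩ := exists_between ht.2
    obtain ⟨t₂, h₂, h₂'⟩ := exists_between h₁'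
    have h := hv.2.2 _ (isTest_characterField h₂ h₂' L k i) t ht
    have hone : ∀ s ≤ t₁, Real.smoothTransition ((t₂ - s) / (t₂ - t₁)) = 1 := fun s hs =>
      Real.smoothTransition.one_of_one_le (by rw [le_div_iff₀ (by linarith)]; linarith)
    have hφ : ∀ s ≤ t₁, (fun x => Real.smoothTransition ((t₂ - s) / (t₂ - t₁)) •
        characterField L k i x) = characterField L k i := fun s hs => by
      simp only [hone s hs, one_smul]
    have hd : ∀ s ∈ uIcc 0 t, pairing (v s) (fun x => deriv (fun r =>
        Real.smoothTransition ((t₂ - r) / (t₂ - t₁)) • characterField L k i x) s) = 0 :=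
      fun s hs => by
      rw [uIcc_of_le ht.1] at hs
      have hs' : ∀ x, deriv (fun r =>
          Real.smoothTransition ((t₂ - r) / (t₂ - t₁)) • characterField L k i x) s = 0 := fun x => by
        have : (fun r => Real.smoothTransition ((t₂ - r) / (t₂ - t₁)) • characterField L k i x)
            =ᶠ[𝓝 s] fun _ => characterField L k i x := by
          filter_upwards [Iio_mem_nhds (hs.2.trans_lt h₁)] with r hr
          rw [hone r (le_of_lt hr), one_smul]
        rw [this.deriv_eq, deriv_const]
      simp [pairing, hs']
    have hle : ∀ s ∈ Ioc 0 t, s ≤ t₁ := fun s hs => hs.2.trans h₁.le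
    have hconv : ∀ {f : ℝ → ℝ} {g : ℝ → ℂ}, IntervalIntegrable g volume 0 t →
        (∀ᵐ s ∂(volume.restrict (Ioc 0 t)), f s = L (vol * g s)) →
        ∫ s in (0 : ℝ)..t, f s = L (vol * ∫ s in (0 : ℝ)..t, g s) := fun {f g} hg hfg => by
      rw [← intervalIntegral.integral_const_mul, ← L.intervalIntegral_comp_comm (hg.const_mul _),
        intervalIntegral.integral_of_le ht.1, intervalIntegral.integral_of_le ht.1]
      exact integral_congr_ae hfg
    rw [hφ t h₁.le, hφ 0 (ht.1.trans h₁.le), intervalIntegral.integral_congr hd,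
      hconv (g := fun s => transport (coeff (u s)) (coeff (v s)) k i) hi2 ?_,
      hconv (f := fun s => gradPairing (v s) fun x => Real.smoothTransition ((t₂ - s) / (t₂ - t₁)) •
        characterField L k i x) (g := fun s => lap (coeff (v s)) k i) hi1 ?_, pairing_characterField,
      pairing_characterField] at h
    · simp only [intervalIntegral.integral_zero, add_zero] at h
      rw [mul_sub, mul_sub, map_sub, map_sub]
      linarith
    · filter_upwards [ae_restrict_mem measurableSet_Ioc, ae_mono hsub hV.ae_fin] with s hs h2
      rw [hφ s (hle s hs), gradPairing_characterField L h2]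
    · filter_upwards [ae_restrict_mem measurableSet_Ioc, ae_mono hsub hV.ae_fin,
        ae_mono hsub hu.ae_fin] with s hs h2 h3
      rw [hφ s (hle s hs), transportPairing_characterField L h3 h2]
  -- The two functionals `re` and `im` together recover the complex identity.
  have h := mul_left_cancel₀ vol_ne_zero (Complex.ext (key Complex.reCLM) (key Complex.imCLM))
  have e : (fun s => -((((jap k : ℝ) ^ 2 - 1 : ℝ)) : ℂ) * coeff (v s) k i -
      transport (coeff (u s)) (coeff (v s)) k i) = fun s => -lap (coeff (v s)) k i -
        transport (coeff (u s)) (coeff (v s)) k i := by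
    ext s
    simp only [lap, neg_mul]
  rw [h, e, intervalIntegral.integral_sub (f := fun s => -lap (coeff (v s)) k i) hi1.neg hi2,
    intervalIntegral.integral_neg]
  ring

/-- The integral equation holds pointwise at every time, so the coefficients are themselves
primitives, with no modification on null sets. One works on `[0,t]` with `t < T` because nothing is
required at `T`. -/
theorem IsStrongSolution.isModeSol (hu : IsVelocity T fun t => coeff (u t))
    (hv : IsStrongSolution T u w₀ v) {t : ℝ} (ht : t ∈ Ico 0 T) :
    IsModeSol t (coeff w₀) (fun s => coeff (v s))
      (fun s => transport (coeff (u s)) (coeff (v s))) := by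
  have hT : 0 ≤ T := ht.1.trans ht.2.le
  have hV := isVelocity_of_memLpH hv.1 hv.2.1
  have hu' := hu.mono ht.2.le
  have hV' := hV.mono ht.2.le
  have hmeas := aestronglyMeasurable_transport hu'.meas hV'.meas hu'.ae_fin hV'.ae_fin
  have hfin := lintegral_transport_lt_top hu' hV'
  refine ⟨fun k i => ?_, fun k i => ?_, hmeas, hfin⟩
  · have hi1 : IntervalIntegrable (fun s => -((((jap k : ℝ) ^ 2 - 1 : ℝ)) : ℂ) * coeff (v s) k i)
        volume 0 t := ((hv.2.1.intervalIntegrable_coeff hT k i).const_mul _).mono_set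
      (uIcc_subset_uIcc (by simp) (by rw [uIcc_of_le hT]; exact ⟨ht.1, ht.2.le⟩))
    have hi2 := (intervalIntegrable_of_lintegral_sq ht.1 (hmeas k i)
      (lintegral_mode_lt_top hmeas hfin k i)).1
    exact (HasACDeriv.of_integral (hi1.sub hi2) (coeff w₀ k i)).congr_fun ht.1 fun s hs =>
      hv.coeff_eq hu ⟨hs.1, hs.2.trans_lt ht.2⟩ k i
  -- At time `0` the integral equation reduces to the initial condition, which the weak formulation
  -- contains only implicitly.
  · rw [hv.coeff_eq hu ⟨le_rfl, ht.1.trans_lt ht.2⟩, intervalIntegral.integral_same, add_zero]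

/-- Linearity: the difference solves the mode system with zero data, so its coefficients vanish at
time `t`, and coefficients determine elements of `L²`. -/
theorem IsStrongSolution.unique (hu : IsVelocity T fun t => coeff (u t))
    {w : ℝ → L2} (hv : IsStrongSolution T u w₀ v) (hw : IsStrongSolution T u w₀ w)
    {t : ℝ} (ht : t ∈ Ico 0 T) : v t = w t := by
  have h := (hv.isModeSol hu ht).sub (hw.isModeSol hu ht)
  rw [sub_self] at h
  have hV := (isVelocity_of_memLpH hv.1 hv.2.1).mono ht.2.le
  have hW := (isVelocity_of_memLpH hw.1 hw.2.1).mono ht.2.le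
  have hu' := hu.mono ht.2.le
  have h0 := h.eq_zero_of_transport ht.1 hu' (by
    filter_upwards [hu'.ae_fin, hV.ae_fin, hW.ae_fin] with s h1 h2 h3
    rw [transport_sub h1 h2 h3])
  exact L2_ext_coeff fun k i => sub_eq_zero.1 (congrFun (congrFun h0 k) i)

end

end Magnetization

end

theorem mainTheorem4 (T : ℝ) (hT : 0 < T)
    (u : ℝ → Magnetization.L2)
    (hu : Magnetization.MemLpH ⊤ T (1 / 2) u) (hu' : Magnetization.MemLpH 2 T (3 / 2) u)
    (w₀ : Magnetization.L2) (hw₀ : Magnetization.MemH (1 / 2) w₀) :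
    ∃ w : ℝ → Magnetization.L2,
      Magnetization.IsStrongSolution T u w₀ w ∧
      Magnetization.ContinuousIntoH T (1 / 2) w ∧
      ∀ v : ℝ → Magnetization.L2, Magnetization.IsStrongSolution T u w₀ v →
        ∀ t ∈ Ico 0 T, v t = w t := by
  have hU := Magnetization.isVelocity_of_memLpH hu hu'
  obtain ⟨w, hw, hwc⟩ := Magnetization.exists_isStrongSolution hT hU
    (Magnetization.memH_half_iff.1 hw₀)
  exact ⟨w, hw, hwc, fun v hv t ht => hv.unique hU hw ht⟩
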